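/- **Setting.** Let $X$ (clients) and $Y$ (servers) be finite families of points of a metric space, with distance $d$, let $1\le k\le |Y|$ be an integer, and let $\alpha\ge 1$ be real. For radii $r:Y\to[0,\infty)$ put $\mathrm{cost}(r)=\sum_{y\in Y} r(y)^\alpha$; $r$ is a *$k$-cover* of $X$ if for every $x\in X$ at least $k$ servers $y$ satisfy $d(x,y)\le r(y)$. A *$1$-cover of $X$ using $Y'\subseteq Y$* assigns radii $\ge 0$ to the servers in $Y'$ only, such that every client lies in one of the balls; its cost is the sum over $Y'$. Fix, for each client $x$, an ordering $y_1(x),y_2(x),\dots$ of $Y$ by distance from $x$, ties broken arbitrarily, and let $N_i(x)=\{y_1(x),\dots,y_i(x)\}$. Let $G_i$ be the graph on $X$ in which distinct $x,x'$ are adjacent iff $N_i(x)\cap N_i(x')\ne\varnothing$. A *net* of $G_i$ is a set of clients with pairwise hop distance at least $3$ such that every client is within two hops of the set. **Computational model.** A real RAM with unit-cost reading of distances, integer arithmetic, comparison, addition and subtraction of reals, and the operation $a\mapsto a^\alpha$ on reals $a\ge0$. Wherever an algorithm makes an arbitrary choice, the claims below hold for every possible choice. A *Cover algorithm with time bound $q$*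 (a polynomial) is an algorithm which, for all finite families $X,Y$ of points of a metric space and all $Y'\subseteq Y$ (with $Y'\neq\varnothing$ unless $X=\varnothing$), returns within $q(|X|+|Y|)$ steps a $1$-cover of $X$ using $Y'$ of cost at most $3^\alpha$ times the cost of every $1$-cover of $X$ using $Y'$. **Algorithm MetricMultiCover** (for a given Cover algorithm). 1. Set $r(y)=0$ for all $y\in Y$, mark all servers available, and let $l=\lceil k/2\rceil$. 2. Compute nets $X_k\subseteq X_{k-1}\subseteq\dots\subseteq X_l$ of $G_k,\dots,G_l$: for $i=k,k-1,\dots,l$ start with $X_i=X_{i+1}$ (with $X_i=\varnothing$ if $i=k$), and, as long as some client is not within two hops of $X_i$ in $G_i$, add an arbitrary such client to $X_i$. 3. For $i=k,k-1,\dots,l$ and for all $x\in X_i$: if $i>l$, move the available server that is the last one in the ordering of $N_i(x)$ to $Y_i^s$ (it is no longer available); if $i>l$, or if $i=l$ and $k$ is odd, move an arbitrary available server of $N_l(x)$ to $Y_i^p$ (it is no longer available). 4. For each of the $k$ sets $Y'$ among $Y_i^s,Y_i^p$ ($l<i\le k$) and, if $k$ is odd, $Y_l^p$: compute a $1$-cover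 $\bar r$ of $X$ using $Y'$ by the Cover algorithm, and set $r(y)=\bar r(y)$ for $y\in Y'$. Return $r$. **Theorem.** There are an algorithm and a polynomial $q$ such that, for every $\alpha\ge1$, it is a Cover algorithm with time bound $q$. Moreover, for every polynomial $q$ there is a polynomial $P$ such that, for every $\alpha\ge 1$ and every Cover algorithm with time bound $q$, on every instance $(X,Y,k)$ with $1\le k\le|Y|$ every run of MetricMultiCover * takes at most $P(|X|+|Y|)$ steps; * returns a $k$-cover $r$ of $X$ with $\mathrm{cost}(r)\le 2\cdot(108)^\alpha\cdot \mathrm{cost}(r')$ for every $k$-cover $r'$ of $X$; * returns a combination of $1$-covers on disjoint sets: there are $k$ pairwise disjoint sets $F_1,\dots,F_k\subseteq Y$ such that, for each $a$, the restriction of $r$ to $F_a$ is a $1$-cover of $X$ that the Cover algorithm can return on $(X,F_a)$, and $r=0$ outside $F_1\cup\dots\cup F_k$. -/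

import Mathlib

universe u

namespace MMC

/-! ## Covers and costs

Clients are a finite family `x : Fin n → M` and servers a finite family `y : Fin m → M` of points
of a metric space `M` (finite sets of points are the injective families). -/

section Covers

variable {M : Type*} [MetricSpace M] {n m : ℕ}

/-- The radii `r` form a `k`-cover: every client lies in at least `k` of the server balls. -/
def IsKCover (x : Fin n → M) (y : Fin m → M) (k : ℕ) (r : Fin m → ℝ) : Prop :=
  (∀ j, 0 ≤ r j) ∧ ∀ i, k ≤ Set.ncard {j : Fin m | dist (x i) (y j) ≤ r j}

/-- The radii `r` on the set `S` of servers form a `1`-cover: every client lies in a ball centred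
at a server of `S`. (Values of `r` outside `S` are irrelevant.) -/
def IsOneCoverOn (x : Fin n → M) (y : Fin m → M) (S : Finset (Fin m)) (r : Fin m → ℝ) : Prop :=
  (∀ j ∈ S, 0 ≤ r j) ∧ ∀ i, ∃ j ∈ S, dist (x i) (y j) ≤ r j

/-- Sum of the `α`-th powers of the radii of the servers in `S`. -/
noncomputable def costOn (α : ℝ) (S : Finset (Fin m)) (r : Fin m → ℝ) : ℝ :=
  ∑ j ∈ S, r j ^ α

/-- The cost of an assignment of radii to all servers. -/
noncomputable def cost (α : ℝ) (r : Fin m → ℝ) : ℝ :=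
  costOn α Finset.univ r

end Covers

/-! ## A real RAM with step count

Programs work on a read-only input and on a memory of two-dimensional arrays of natural numbers
and of real numbers; arrays are named by numbers, a scalar is the entry `(0, 0)` of an array and a
one-dimensional array is row `0`. -/

/-- A read-only input: the numbers `n` of clients and `m` of servers, the demand `k`, the exponent
`α`, the distances between two clients, a client and a server, two servers, and a table `mask`
marking with `1` the servers that may be used. -/
structure Input where
  n : ℕ
  m : ℕ
  k : ℕ
  α : ℝ
  cc : ℕ → ℕ → ℝ
  cs : ℕ → ℕ → ℝ
  ss : ℕ → ℕ → ℝ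
  mask : ℕ → ℕ

structure State where
  nat : ℕ → ℕ → ℕ → ℕ
  real : ℕ → ℕ → ℕ → ℝ

namespace State

/-- The memory in which every cell is zero. -/
def init : State := ⟨fun _ _ _ => 0, fun _ _ _ => 0⟩

def setNat (s : State) (a i j v : ℕ) : State :=
  { s with nat := fun a' i' j' => if a' = a ∧ i' = i ∧ j' = j then v else s.nat a' i' j' }

noncomputable def setReal (s : State) (a i j : ℕ) (v : ℝ) : State :=
  { s with real := fun a' i' j' => if a' = a ∧ i' = i ∧ j' = j then v else s.real a' i' j' }

/-- Writes `v 0, …, v (m - 1)` to the first `m` entries of row `0` of the real array `a`. -/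
noncomputable def setRow (s : State) (a m : ℕ) (v : ℕ → ℝ) : State :=
  { s with real := fun a' i' j' => if a' = a ∧ i' = 0 ∧ j' < m then v j' else s.real a' i' j' }

/-- The first `m` entries of row `0` of the real array `0`, where programs leave their result. -/
def radii (s : State) (m : ℕ) : Fin m → ℝ := fun j => s.real 0 0 j

end State

/-- Expressions with values in the natural numbers. -/
inductive NExp where
  | lit (c : ℕ)
  | n
  | m
  | k
  | mask (j : NExp)
  | get (a : ℕ) (i j : NExp)
  | add (e f : NExp)
  | sub (e f : NExp)
  | half (e : NExp)

/-- Expressions with values in the real numbers. -/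
inductive RExp where
  | zero
  | cc (i j : NExp)
  | cs (i j : NExp)
  | ss (i j : NExp)
  | get (a : ℕ) (i j : NExp)
  | add (e f : RExp)
  | sub (e f : RExp)
  | pow (e : RExp)

/-- Tests. -/
inductive BExp where
  | eq (e f : NExp)
  | lt (e f : NExp)
  | rle (e f : RExp)
  | rlt (e f : RExp)
  | not (b : BExp)
  | and (b c : BExp)
  | or (b c : BExp)

namespace NExp

def eval (inp : Input) (s : State) : NExp → ℕ
  | lit c => c
  | n => inp.n
  | m => inp.m
  | k => inp.k
  | mask j => inp.mask (j.eval inp s)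
  | get a i j => s.nat a (i.eval inp s) (j.eval inp s)
  | add e f => e.eval inp s + f.eval inp s
  | sub e f => e.eval inp s - f.eval inp s
  | half e => e.eval inp s / 2

/-- The number of elementary operations of an evaluation. -/
def size : NExp → ℕ
  | lit _ => 1
  | n => 1
  | m => 1
  | k => 1
  | mask j => 1 + j.size
  | get _ i j => 1 + i.size + j.size
  | add e f => 1 + e.size + f.size
  | sub e f => 1 + e.size + f.size
  | half e => 1 + e.size

end NExp

namespace RExp

/-- Besides reading, adding, and subtracting, the machine can raise a non-negative real number to
the power `α` (for a negative number, its absolute value is used). -/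
noncomputable def eval (inp : Input) (s : State) : RExp → ℝ
  | zero => 0
  | cc i j => inp.cc (i.eval inp s) (j.eval inp s)
  | cs i j => inp.cs (i.eval inp s) (j.eval inp s)
  | ss i j => inp.ss (i.eval inp s) (j.eval inp s)
  | get a i j => s.real a (i.eval inp s) (j.eval inp s)
  | add e f => e.eval inp s + f.eval inp s
  | sub e f => e.eval inp s - f.eval inp s
  | pow e => |e.eval inp s| ^ inp.α

def size : RExp → ℕ
  | zero => 1
  | cc i j => 1 + i.size + j.size
  | cs i j => 1 + i.size + j.size
  | ss i j => 1 + i.size + j.size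
  | get _ i j => 1 + i.size + j.size
  | add e f => 1 + e.size + f.size
  | sub e f => 1 + e.size + f.size
  | pow e => 1 + e.size

end RExp

namespace BExp

def Holds (inp : Input) (s : State) : BExp → Prop
  | eq e f => e.eval inp s = f.eval inp s
  | lt e f => e.eval inp s < f.eval inp s
  | rle e f => e.eval inp s ≤ f.eval inp s
  | rlt e f => e.eval inp s < f.eval inp s
  | not b => ¬ b.Holds inp s
  | and b c => b.Holds inp s ∧ c.Holds inp s
  | or b c => b.Holds inp s ∨ c.Holds inp s

def size : BExp → ℕ
  | eq e f => 1 + e.size + f.size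
  | lt e f => 1 + e.size + f.size
  | rle e f => 1 + e.size + f.size
  | rlt e f => 1 + e.size + f.size
  | not b => 1 + b.size
  | and b c => 1 + b.size + c.size
  | or b c => 1 + b.size + c.size

end BExp

/-- Programs.
* `loop v e c`: for `v = 0, …, e - 1` run `c` (the bound `e` is evaluated once, on entry).
* `pick v e b c d`: if the test `b` holds for some value `v < e`, set `v` to an *arbitrary* such
  value and run `c`; otherwise run `d`. It is charged as a scan of all `v < e`.
* `call c a e out`: procedure call. The program `c` is run on a zero memory of its own, on the
  same input but with demand `1` and with exactly those servers `j` marked for which entry `(e, j)`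
  of the array `a` is nonzero; the radii that it returns are written to the real array `out`. -/
inductive Cmd where
  | skip
  | nset (a : ℕ) (i j e : NExp)
  | rset (a : ℕ) (i j : NExp) (e : RExp)
  | seq (c d : Cmd)
  | ite (b : BExp) (c d : Cmd)
  | loop (v : ℕ) (e : NExp) (c : Cmd)
  | pick (v : ℕ) (e : NExp) (b : BExp) (c d : Cmd)
  | call (c : Cmd) (a : ℕ) (e : NExp) (out : ℕ)

/-- The possible (final state, number of steps) after the runs of `body 0, …, body (N - 1)`. -/
def iter (body : ℕ → State → Set (State × ℕ)) : ℕ → State → Set (State × ℕ)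
  | 0, s => {(s, 0)}
  | N + 1, s =>
    {p | ∃ q ∈ iter body N s, ∃ q' ∈ body N q.1, p = (q'.1, q.2 + q'.2 + 1)}

/-- The input on which a procedure works. -/
def Input.restrict (inp : Input) (S : ℕ → Prop) [DecidablePred S] : Input :=
  { inp with k := 1, mask := fun j => if j < inp.m ∧ S j then 1 else 0 }

/-- The set of all possible outcomes (final state, number of steps) of a program. -/
noncomputable def exec : Cmd → Input → State → Set (State × ℕ)
  | .skip, _, s => {(s, 1)}
  | .nset a i j e, inp, s =>
    {(s.setNat a (i.eval inp s) (j.eval inp s) (e.eval inp s), 1 + i.size + j.size + e.size)}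
  | .rset a i j e, inp, s =>
    {(s.setReal a (i.eval inp s) (j.eval inp s) (e.eval inp s), 1 + i.size + j.size + e.size)}
  | .seq c d, inp, s =>
    {p | ∃ q ∈ exec c inp s, ∃ q' ∈ exec d inp q.1, p = (q'.1, q.2 + q'.2)}
  | .ite b c d, inp, s =>
    {p | (b.Holds inp s ∧ ∃ q ∈ exec c inp s, p = (q.1, 1 + b.size + q.2)) ∨
         (¬ b.Holds inp s ∧ ∃ q ∈ exec d inp s, p = (q.1, 1 + b.size + q.2))}
  | .loop v e c, inp, s =>
    {p | ∃ q ∈ iter (fun t s' => exec c inp (s'.setNat v 0 0 t)) (e.eval inp s) s,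
         p = (q.1, 1 + e.size + q.2)}
  | .pick v e b c d, inp, s =>
    {p | (∃ t < e.eval inp s, b.Holds inp (s.setNat v 0 0 t) ∧
            ∃ q ∈ exec c inp (s.setNat v 0 0 t),
              p = (q.1, 1 + e.size + e.eval inp s * (1 + b.size) + q.2)) ∨
         ((∀ t < e.eval inp s, ¬ b.Holds inp (s.setNat v 0 0 t)) ∧
            ∃ q ∈ exec d inp s,
              p = (q.1, 1 + e.size + e.eval inp s * (1 + b.size) + q.2))}
  | .call c a e out, inp, s =>
    {p | ∃ q ∈ exec c (inp.restrict fun j => s.nat a (e.eval inp s) j ≠ 0) State.init,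
         p = (s.setRow out inp.m (q.1.real 0 0), 1 + e.size + 2 * inp.m + q.2)}

/-! ## Encoding of instances -/

section Encoding

variable {M : Type*} [MetricSpace M]

/-- The table of the distances between the points of two families, zero outside of its range. -/
noncomputable def distTable {p q : ℕ} (u : Fin p → M) (v : Fin q → M) (i j : ℕ) : ℝ :=
  if h : i < p ∧ j < q then dist (u ⟨i, h.1⟩) (v ⟨j, h.2⟩) else 0

/-- The instance with clients `x`, servers `y`, demand `k`, exponent `α` in which only the servers
in `S` may be used. -/
noncomputable def encode {n m : ℕ} (x : Fin n → M) (y : Fin m → M) (k : ℕ) (α : ℝ)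
    (S : Finset (Fin m)) : Input where
  n := n
  m := m
  k := k
  α := α
  cc := distTable x x
  cs := distTable x y
  ss := distTable y y
  mask j := if ∃ h : j < m, (⟨j, h⟩ : Fin m) ∈ S then 1 else 0

/-- `C` is a `3 ^ α`-approximation algorithm with at most `q (n + m)` steps for the problem of
covering the clients by balls centred at the servers of a given set `S`. Nothing is required when
there is no `1`-cover, that is, when there are clients but `S` is empty. -/
def IsCoverAlgorithm (C : Cmd) (q : Polynomial ℕ) (α : ℝ) : Prop :=
  ∀ (M : Type u) [MetricSpace M] (n m : ℕ) (x : Fin n → M) (y : Fin m → M) (S : Finset (Fin m)),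
    (S.Nonempty ∨ n = 0) →
    (exec C (encode x y 1 α S) State.init).Nonempty ∧
    ∀ p ∈ exec C (encode x y 1 α S) State.init,
      p.2 ≤ q.eval (n + m) ∧
      IsOneCoverOn x y S (p.1.radii m) ∧
      ∀ r' : Fin m → ℝ, IsOneCoverOn x y S r' →
        costOn α S (p.1.radii m) ≤ (3 : ℝ) ^ α * costOn α S r'

end Encoding

/-! ## The program `MetricMultiCover` -/

namespace Alg

/-! Scalars. Clients are numbered `0, …, n - 1`, servers `0, …, m - 1`. -/

def l : ℕ := 0
def i : ℕ := 1
def t : ℕ := 2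
def c : ℕ := 3
def u : ℕ := 4
def w : ℕ := 5
def j : ℕ := 6
def z : ℕ := 7
def best : ℕ := 8
def found : ℕ := 9
def rounds : ℕ := 10
def ys : ℕ := 11

/-! Arrays. -/

/-- `near c j` is the `(j + 1)`-st closest server of client `c`. -/
def near : ℕ := 20
/-- `rank c z = j` means that server `z` is the `(j + 1)`-st closest server of client `c`; thus
`z` belongs to the `i`-neighbourhood of `c` iff `rank c z < i`. -/
def rank : ℕ := 21
/-- `placed c z = 1` once the rank of `z` is known. -/
def placed : ℕ := 22
/-- The adjacency matrix of the intersection graph `G i` of the `i`-neighbourhoods. -/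
def adj : ℕ := 23
/-- `net i c = 1` iff client `c` is in the net `X i`. -/
def net : ℕ := 24
/-- Marks of the clients within two hops of the current net. -/
def marked : ℕ := 25
/-- `avail z = 1` iff server `z` is available. -/
def avail : ℕ := 26
/-- `shared i z = 1` iff server `z` is in the set `Y i s`. -/
def shared : ℕ := 27
/-- `priv i z = 1` iff server `z` is in the set `Y i p`. -/
def priv : ℕ := 28

/-- The real array of the radii that are returned. -/
def r : ℕ := 0
/-- The real array that receives a `1`-cover. -/
def rbar : ℕ := 1

def zero : NExp := .lit 0
def one : NExp := .lit 1
/-- The value of a scalar. -/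
def val (a : ℕ) : NExp := .get a zero zero
/-- Assignment to a scalar. -/
def put (a : ℕ) (e : NExp) : Cmd := .nset a zero zero e
/-- The test that an entry of an array is `1`. -/
def on (a : ℕ) (e f : NExp) : BExp := .eq (.get a e f) one
def block : List Cmd → Cmd
  | [] => .skip
  | [p] => p
  | p :: p' :: ps => .seq p (block (p' :: ps))
def when (b : BExp) (c : Cmd) : Cmd := .ite b c .skip

/-- For `i = k` down to `l`. -/
def downLoop (body : Cmd) : Cmd :=
  .loop t (.sub (.add .k one) (val l)) (.seq (put i (.sub .k (val t))) body)

/-- Sort the servers by their distance from each client, with ties broken arbitrarily: the next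
server is found from an arbitrary remaining one by moving to strictly closer ones. -/
def sortServers : Cmd :=
  .loop c .n (.loop j .m (.pick z .m (.not (on placed (val c) (val z)))
    (block [
      put best (val z),
      .loop z .m (when (.and (.not (on placed (val c) (val z)))
          (.rlt (.cs (val c) (val z)) (.cs (val c) (val best))))
        (put best (val z))),
      .nset near (val c) (val j) (val best),
      .nset rank (val c) (val best) (val j),
      .nset placed (val c) (val best) one])
    .skip))

/-- Compute the graph `G i`. -/
def computeGraph : Cmd :=
  .loop u .n (.loop w .n (.pick z .m
    (.and (.lt (.get rank (val u) (val z)) (val i)) (.lt (.get rank (val w) (val z)) (val i)))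
    (.nset adj (val u) (val w) one)
    (.nset adj (val u) (val w) zero)))

/-- Mark the clients within two hops of `c` in `G i` (in which, as `i ≥ 1`, every client is
adjacent to itself). -/
def markTwoHops : Cmd :=
  .loop u .n (.pick w .n
    (.and (on adj (val c) (val w)) (on adj (val w) (val u)))
    (.nset marked zero (val u) one)
    .skip)

/-- Compute nets `X k ⊆ … ⊆ X l`: `X i` starts as `X (i + 1)` (as the empty set if `i = k`), and
arbitrary unmarked clients are added until all clients are marked. -/
def computeNets : Cmd :=
  downLoop (block [
    computeGraph,
    .loop u .n (.nset marked zero (val u) zero),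
    .loop c .n (block [
      .nset net (val i) (val c) (.get net (.add (val i) one) (val c)),
      when (on net (val i) (val c)) markTwoHops]),
    .loop rounds .n (.pick c .n (.not (on marked zero (val c)))
      (.seq (.nset net (val i) (val c) one) markTwoHops)
      .skip)])

/-- Move the farthest available server of the `i`-neighbourhood of `c` to `Y i s`. -/
def chooseShared : Cmd :=
  block [
    put found zero,
    .loop j (val i) (when (on avail zero (.get near (val c) (val j)))
      (.seq (put ys (.get near (val c) (val j))) (put found one))),
    when (.eq (val found) one)
      (.seq (.nset shared (val i) (val ys) one) (.nset avail zero (val ys) zero))]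

/-- Move an arbitrary available server of the `l`-neighbourhood of `c` to `Y i p`. -/
def choosePrivate : Cmd :=
  .pick j (val l) (on avail zero (.get near (val c) (val j)))
    (.seq (.nset priv (val i) (.get near (val c) (val j)) one)
      (.nset avail zero (.get near (val c) (val j)) zero))
    .skip

/-- The test that `i > l`. -/
def aboveL : BExp := .lt (val l) (val i)
/-- The test that `i > l` or `k` is odd, where `l = ⌈k / 2⌉`. -/
def aboveLOrOdd : BExp := .or aboveL (.lt .k (.add (val l) (val l)))

/-- `ComputeServerSubsets`: extract the disjoint server sets `Y i s` and `Y i p`. -/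
def computeServerSubsets : Cmd :=
  block [
    .loop z .m (.nset avail zero (val z) one),
    put l (.half (.add .k one)),
    sortServers,
    computeNets,
    downLoop (.loop c .n (when (on net (val i) (val c))
      (block [
        when aboveL chooseShared,
        when aboveLOrOdd choosePrivate])))]

/-- Call `C` on the set stored in row `i` of `a` and take over its radii on that set. -/
def useCover (C : Cmd) (a : ℕ) : Cmd :=
  .seq (.call C a (val i) rbar)
    (.loop z .m (when (on a (val i) (val z))
      (.rset r zero (val z) (.get rbar zero (val z)))))

/-- `MetricMultiCover`, for a given algorithm `C` for computing `1`-covers. -/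
def metricMultiCover (C : Cmd) : Cmd :=
  block [
    .loop z .m (.rset r zero (val z) .zero),
    computeServerSubsets,
    downLoop (block [
      when aboveL (useCover C shared),
      when aboveLOrOdd (useCover C priv)])]

end Alg

end MMC

/-! Running time and existence of outcomes come from a small Hoare logic for total correctness
(`Spec`). A time polynomial is read off the text of a program, valid in any bound for its loop
lengths; here all of them are at most `n + m`. The rest is combinatorics on the invariants.

A Cover algorithm is obtained by primal-dual (`PrimalDual.isCoverAlgorithm`). The balls considered
have an allowed server as centre and a client on the boundary. Each client in turn raises its dual
variable until some ball that contains it is tight. Among the largest tight balls of the servers,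
balls with no common client are chosen in decreasing order of radius and then tripled. Each chosen
ball is paid for by the duals of its own clients, and the sum of all duals is at most the cost of
any cover; this gives `3 ^ α`.

Extraction of the server sets (`Extracted.count_step`): after `N` rounds, every client of the net `X
e` of a level still to come has at least `e - N` available servers among its `e` closest ones. A
round may take two servers from the neighbourhood of a net point, but one of them is the farthest
available. If this one lies in the smaller neighbourhood of a lower level `e'`, so do all available
servers of the larger one, and the stronger bound of the larger level compensates for the second
loss. Clients outside the current net lose at most one server, because net points are three hops
apart. Since `L = ⌈k/2⌉`, at least two servers remain at each level above `L`, and one remains at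
level `L` if `k` is odd. So every move succeeds, and there are `k` disjoint sets, at most two for
each level `e`, each meeting the `e`-neighbourhoods of all points of `X e`.

For the cost, a `k`-cover is split into disjoint outer covers of all levels `e ≤ k`
(`exists_outerCovers`): every client lies in a ball at least as large as its distance to its `e`-th
closest server. This loses a factor 3 in the radii. A client is within two hops of a net point,
whose neighbourhood meets the given server set. The largest of the three outer balls along this
path, enlarged 12 times and moved to that server, covers the client (`exists_oneCover`). The Cover
algorithm contributes another factor 3, and `3 * 12 * 3 = 108`. As each level serves at most two of
the sets, the total gains a factor 2. Finally, `k` disjoint `1`-covers form a `k`-cover. -/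

namespace MMC

/-! ## Time bounds, frames and a program logic -/

namespace Cmd

/-- The natural-number arrays that a program may write. -/
def natWrites : Cmd → List ℕ
  | skip => []
  | nset a _ _ _ => [a]
  | rset _ _ _ _ => []
  | seq c d => c.natWrites ++ d.natWrites
  | ite _ c d => c.natWrites ++ d.natWrites
  | loop v _ c => v :: c.natWrites
  | pick v _ _ c d => v :: (c.natWrites ++ d.natWrites)
  | call _ _ _ _ => []

/-- The real arrays that a program may write. -/
def realWrites : Cmd → List ℕ
  | skip => []
  | nset _ _ _ _ => []
  | rset a _ _ _ => [a]
  | seq c d => c.realWrites ++ d.realWrites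
  | ite _ c d => c.realWrites ++ d.realWrites
  | loop _ _ c => c.realWrites
  | pick _ _ _ c d => c.realWrites ++ d.realWrites
  | call _ _ _ out => [out]

/-- A bound for the number of steps as a polynomial in a bound for the values of all loop bounds,
when `q` bounds the time of every procedure call. -/
noncomputable def time (q : Polynomial ℕ) : Cmd → Polynomial ℕ
  | skip => 1
  | nset _ i j e => Polynomial.C (1 + i.size + j.size + e.size)
  | rset _ i j e => Polynomial.C (1 + i.size + j.size + e.size)
  | seq c d => c.time q + d.time q
  | ite b c d => Polynomial.C (1 + b.size) + (c.time q + d.time q)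
  | loop _ e c => Polynomial.C (1 + e.size) + Polynomial.X * (c.time q + 1)
  | pick _ e b c d => Polynomial.C (1 + e.size) + Polynomial.X * Polynomial.C (1 + b.size) +
      (c.time q + d.time q)
  | call _ _ e _ => Polynomial.C (1 + e.size) + 2 * Polynomial.X + q

end Cmd

/-- The state `s'` agrees with `s` on all arrays that `c` does not write. -/
structure Unch (c : Cmd) (s s' : State) : Prop where
  nat : ∀ a, a ∉ c.natWrites → s'.nat a = s.nat a
  real : ∀ a, a ∉ c.realWrites → s'.real a = s.real a

lemma Unch.refl (c : Cmd) (s : State) : Unch c s s := ⟨fun _ _ => rfl, fun _ _ => rfl⟩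

lemma Unch.trans {c : Cmd} {s s' s'' : State} (h : Unch c s s') (h' : Unch c s' s'') :
    Unch c s s'' :=
  ⟨fun a ha => (h'.nat a ha).trans (h.nat a ha), fun a ha => (h'.real a ha).trans (h.real a ha)⟩

lemma Unch.mono {c d : Cmd} {s s' : State} (h : Unch c s s')
    (hn : c.natWrites ⊆ d.natWrites) (hr : c.realWrites ⊆ d.realWrites) : Unch d s s' :=
  ⟨fun a ha => h.nat a fun h' => ha (hn h'), fun a ha => h.real a fun h' => ha (hr h')⟩

namespace State

@[simp] lemma setNat_nat (s : State) (a i j v a' i' j' : ℕ) :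
    (s.setNat a i j v).nat a' i' j' =
      if a' = a ∧ i' = i ∧ j' = j then v else s.nat a' i' j' := rfl

lemma setNat_nat_of_ne (s : State) {a a' : ℕ} (h : a' ≠ a) (i j v : ℕ) :
    (s.setNat a i j v).nat a' = s.nat a' := by
  funext i' j'; simp [h]

@[simp] lemma setNat_real (s : State) (a i j v : ℕ) : (s.setNat a i j v).real = s.real := rfl

@[simp] lemma setReal_nat (s : State) (a i j : ℕ) (v : ℝ) : (s.setReal a i j v).nat = s.nat := rfl

@[simp] lemma setReal_real (s : State) (a i j : ℕ) (v : ℝ) (a' i' j' : ℕ) :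
    (s.setReal a i j v).real a' i' j' =
      if a' = a ∧ i' = i ∧ j' = j then v else s.real a' i' j' := rfl

lemma setReal_real_of_ne (s : State) {a a' : ℕ} (h : a' ≠ a) (i j : ℕ) (v : ℝ) :
    (s.setReal a i j v).real a' = s.real a' := by
  funext i' j'; simp [h]

@[simp] lemma setRow_nat (s : State) (a m : ℕ) (v : ℕ → ℝ) : (s.setRow a m v).nat = s.nat := rfl

@[simp] lemma setRow_real (s : State) (a m : ℕ) (v : ℕ → ℝ) (a' i' j' : ℕ) :
    (s.setRow a m v).real a' i' j' =
      if a' = a ∧ i' = 0 ∧ j' < m then v j' else s.real a' i' j' := rfl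

lemma setRow_real_of_ne (s : State) {a a' : ℕ} (h : a' ≠ a) (m : ℕ) (v : ℕ → ℝ) :
    (s.setRow a m v).real a' = s.real a' := by
  funext i' j'; simp [h]

end State

lemma unch_setNat {c : Cmd} (s : State) {v : ℕ} (h : v ∈ c.natWrites) (i j t : ℕ) :
    Unch c s (s.setNat v i j t) :=
  ⟨fun a ha => s.setNat_nat_of_ne (by rintro rfl; exact ha h) _ _ _, fun _ _ => rfl⟩

lemma unch_iter {body : ℕ → State → Set (State × ℕ)} {c : Cmd}
    (h : ∀ t s p, p ∈ body t s → Unch c s p.1) :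
    ∀ N s p, p ∈ iter body N s → Unch c s p.1
  | 0, s, p, hp => by
    obtain rfl : p = (s, 0) := hp
    exact Unch.refl c s
  | N + 1, s, p, hp => by
    obtain ⟨q, hq, q', hq', rfl⟩ := hp
    exact (unch_iter h N s q hq).trans (h _ _ q' hq')

/-- The write lists are syntactic, so the frame does not depend on the arbitrary choices of a run. A
call works on a memory of its own and touches only its output array. -/
lemma unch_exec (c : Cmd) (inp : Input) (s : State) (p : State × ℕ) (hp : p ∈ exec c inp s) :
    Unch c s p.1 := by
  induction c generalizing s p with
  | skip =>
    obtain rfl : p = (s, 1) := hp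
    exact Unch.refl _ s
  | nset a i j e =>
    have hp' : p = _ := hp
    subst hp'
    exact unch_setNat s (by simp [Cmd.natWrites]) _ _ _
  | rset a i j e =>
    have hp' : p = _ := hp
    subst hp'
    exact ⟨fun _ _ => rfl, fun a' ha => s.setReal_real_of_ne
      (by simpa [Cmd.realWrites] using ha) _ _ _⟩
  | seq c d ihc ihd =>
    obtain ⟨q, hq, q', hq', rfl⟩ := hp
    exact ((ihc s q hq).mono (by simp [Cmd.natWrites]) (by simp [Cmd.realWrites])).trans
      ((ihd q.1 q' hq').mono (by simp [Cmd.natWrites]) (by simp [Cmd.realWrites]))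
  | ite b c d ihc ihd =>
    rcases hp with ⟨-, q, hq, rfl⟩ | ⟨-, q, hq, rfl⟩
    · exact (ihc s q hq).mono (by simp [Cmd.natWrites]) (by simp [Cmd.realWrites])
    · exact (ihd s q hq).mono (by simp [Cmd.natWrites]) (by simp [Cmd.realWrites])
  | loop v e c ih =>
    obtain ⟨q, hq, rfl⟩ := hp
    refine unch_iter (fun t s' p' hp' => ?_) _ s q hq
    exact (unch_setNat s' (by simp [Cmd.natWrites]) _ _ _).trans
      ((ih _ p' hp').mono (by simp [Cmd.natWrites]) (by simp [Cmd.realWrites]))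
  | pick v e b c d ihc ihd =>
    rcases hp with ⟨t, -, -, q, hq, rfl⟩ | ⟨-, q, hq, rfl⟩
    · exact (unch_setNat s (by simp [Cmd.natWrites]) _ _ _).trans
        ((ihc _ q hq).mono (by simp [Cmd.natWrites]) (by simp [Cmd.realWrites]))
    · exact (ihd s q hq).mono (by simp [Cmd.natWrites]) (by simp [Cmd.realWrites])
  | call c a e out ih =>
    obtain ⟨q, hq, rfl⟩ := hp
    exact ⟨fun _ _ => rfl, fun a' ha => s.setRow_real_of_ne
      (by simpa [Cmd.realWrites] using ha) _ _⟩

/-- Total correctness with a time bound: `c` has an outcome, and every outcome satisfies `Q` and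
takes at most the time `c.time q` evaluated at `B`. -/
def Spec (q : Polynomial ℕ) (B : ℕ) (inp : Input) (c : Cmd) (s : State) (Q : State → Prop) :
    Prop :=
  (exec c inp s).Nonempty ∧ ∀ p ∈ exec c inp s, p.2 ≤ (c.time q).eval B ∧ Q p.1

/-! ### Rules of the program logic. -/

namespace Spec

variable {q : Polynomial ℕ} {B : ℕ} {inp : Input} {c d : Cmd} {s : State} {Q Q' : State → Prop}

/-- Consequence rule; the frame of the program comes for free. -/
lemma conseq (h : Spec q B inp c s Q') (hQ : ∀ s', Unch c s s' → Q' s' → Q s') :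
    Spec q B inp c s Q :=
  ⟨h.1, fun p hp => ⟨(h.2 p hp).1, hQ _ (unch_exec c inp s p hp) (h.2 p hp).2⟩⟩

lemma skip (h : Q s) : Spec q B inp .skip s Q := by
  refine ⟨⟨_, rfl⟩, ?_⟩
  rintro p (rfl : p = _)
  exact ⟨by simp [Cmd.time], h⟩

lemma nset {a : ℕ} {i j e : NExp}
    (h : Q (s.setNat a (i.eval inp s) (j.eval inp s) (e.eval inp s))) :
    Spec q B inp (.nset a i j e) s Q := by
  refine ⟨⟨_, rfl⟩, ?_⟩
  rintro p (rfl : p = _)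
  exact ⟨by simp [Cmd.time], h⟩

lemma rset {a : ℕ} {i j : NExp} {e : RExp}
    (h : Q (s.setReal a (i.eval inp s) (j.eval inp s) (e.eval inp s))) :
    Spec q B inp (.rset a i j e) s Q := by
  refine ⟨⟨_, rfl⟩, ?_⟩
  rintro p (rfl : p = _)
  exact ⟨by simp [Cmd.time], h⟩

/-- With the specification of `d` as postcondition of `c`, every outcome of `c` can be continued, so
no choice made in `c` leads to a dead end. -/
lemma seq (h : Spec q B inp c s fun s' => Spec q B inp d s' Q) :
    Spec q B inp (.seq c d) s Q := by
  obtain ⟨⟨p, hp⟩, h⟩ := h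
  obtain ⟨p', hp'⟩ := (h p hp).2.1
  refine ⟨⟨_, p, hp, p', hp', rfl⟩, ?_⟩
  rintro _ ⟨p, hp, p', hp', rfl⟩
  have h1 := h p hp
  have h2 := h1.2.2 p' hp'
  exact ⟨by simpa [Cmd.time] using add_le_add h1.1 h2.1, h2.2⟩

lemma ite {b : BExp} (hc : b.Holds inp s → Spec q B inp c s Q)
    (hd : ¬ b.Holds inp s → Spec q B inp d s Q) : Spec q B inp (.ite b c d) s Q := by
  constructor
  · by_cases hb : b.Holds inp s
    · obtain ⟨p, hp⟩ := (hc hb).1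
      exact ⟨_, Or.inl ⟨hb, p, hp, rfl⟩⟩
    · obtain ⟨p, hp⟩ := (hd hb).1
      exact ⟨_, Or.inr ⟨hb, p, hp, rfl⟩⟩
  · rintro _ (⟨hb, p, hp, rfl⟩ | ⟨hb, p, hp, rfl⟩)
    · have := (hc hb).2 p hp
      refine ⟨?_, this.2⟩
      simp only [Cmd.time, Polynomial.eval_add, Polynomial.eval_C]
      omega
    · have := (hd hb).2 p hp
      refine ⟨?_, this.2⟩
      simp only [Cmd.time, Polynomial.eval_add, Polynomial.eval_C]
      omega

lemma when {b : BExp} (hc : b.Holds inp s → Spec q B inp c s Q)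
    (hd : ¬ b.Holds inp s → Q s) : Spec q B inp (Alg.when b c) s Q :=
  ite hc fun h => skip (hd h)

/-- The bound is evaluated once, on entry, so only its value in `s` matters. The invariant speaks of
the state before the counter is set, and the frame relative to the initial state is handed to each
iteration. -/
lemma loop {v : ℕ} {e : NExp} (I : ℕ → State → Prop) (he : e.eval inp s ≤ B) (h0 : I 0 s)
    (hstep : ∀ t < e.eval inp s, ∀ s', Unch (.loop v e c) s s' → I t s' →
      Spec q B inp c (s'.setNat v 0 0 t) (I (t + 1)))
    (hQ : ∀ s', Unch (.loop v e c) s s' → I (e.eval inp s) s' → Q s') :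
    Spec q B inp (.loop v e c) s Q := by
  have hU : ∀ t s' p, p ∈ exec c inp (s'.setNat v 0 0 t) → Unch (.loop v e c) s' p.1 :=
    fun t s' p hp => (unch_setNat s' (by simp [Cmd.natWrites]) _ _ _).trans
      ((unch_exec c inp _ p hp).mono (by simp [Cmd.natWrites]) (by simp [Cmd.realWrites]))
  -- The extra 1 in each iteration is the charge that `iter` makes for the counter.
  have key : ∀ N ≤ e.eval inp s,
      (iter (fun t s' => exec c inp (s'.setNat v 0 0 t)) N s).Nonempty ∧
      ∀ p ∈ iter (fun t s' => exec c inp (s'.setNat v 0 0 t)) N s,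
        p.2 ≤ N * ((c.time q).eval B + 1) ∧ I N p.1 := by
    intro N
    induction N with
    | zero =>
      intro _
      refine ⟨⟨_, rfl⟩, ?_⟩
      rintro p (rfl : p = _)
      exact ⟨by simp, h0⟩
    | succ N ih =>
      intro hN
      obtain ⟨⟨p, hp⟩, h⟩ := ih (by omega)
      have hs : ∀ p ∈ iter (fun t s' => exec c inp (s'.setNat v 0 0 t)) N s,
          Spec q B inp c (p.1.setNat v 0 0 N) (I (N + 1)) := fun p hp =>
        hstep N (by omega) p.1 (unch_iter hU N s p hp) (h p hp).2
      obtain ⟨p', hp'⟩ := (hs p hp).1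
      refine ⟨⟨_, p, hp, p', hp', rfl⟩, ?_⟩
      rintro _ ⟨p, hp, p', hp', rfl⟩
      have h1 := h p hp
      have h2 := (hs p hp).2 p' hp'
      refine ⟨?_, h2.2⟩
      have h3 := h1.1
      have h4 := h2.1
      simp only [add_mul, one_mul]
      omega
  obtain ⟨⟨p, hp⟩, h⟩ := key _ le_rfl
  refine ⟨⟨_, p, hp, rfl⟩, ?_⟩
  rintro _ ⟨p, hp, rfl⟩
  have h1 := h p hp
  refine ⟨?_, hQ _ (unch_iter hU _ s p hp) h1.2⟩
  simp only [Cmd.time, Polynomial.eval_add, Polynomial.eval_C, Polynomial.eval_mul,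
    Polynomial.eval_X, Polynomial.eval_one]
  have h2 := h1.1.trans (Nat.mul_le_mul_right ((c.time q).eval B + 1) he)
  omega

lemma pick {v : ℕ} {e : NExp} {b : BExp} (he : e.eval inp s ≤ B)
    (hc : ∀ t < e.eval inp s, b.Holds inp (s.setNat v 0 0 t) →
      Spec q B inp c (s.setNat v 0 0 t) Q)
    (hd : (∀ t < e.eval inp s, ¬ b.Holds inp (s.setNat v 0 0 t)) → Spec q B inp d s Q) :
    Spec q B inp (.pick v e b c d) s Q := by
  constructor
  · by_cases h : ∃ t < e.eval inp s, b.Holds inp (s.setNat v 0 0 t)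
    · obtain ⟨t, ht, hb⟩ := h
      obtain ⟨p, hp⟩ := (hc t ht hb).1
      exact ⟨_, Or.inl ⟨t, ht, hb, p, hp, rfl⟩⟩
    · push Not at h
      obtain ⟨p, hp⟩ := (hd h).1
      exact ⟨_, Or.inr ⟨h, p, hp, rfl⟩⟩
  · have h1 := Nat.mul_le_mul_right (1 + b.size) he
    rintro _ (⟨t, ht, hb, p, hp, rfl⟩ | ⟨h, p, hp, rfl⟩)
    · have := (hc t ht hb).2 p hp
      refine ⟨?_, this.2⟩
      simp only [Cmd.time, Polynomial.eval_add, Polynomial.eval_C, Polynomial.eval_mul,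
        Polynomial.eval_X]
      omega
    · have := (hd h).2 p hp
      refine ⟨?_, this.2⟩
      simp only [Cmd.time, Polynomial.eval_add, Polynomial.eval_C, Polynomial.eval_mul,
        Polynomial.eval_X]
      omega

lemma call {a : ℕ} {e : NExp} {out : ℕ} (hm : inp.m ≤ B)
    (hne : (exec c (inp.restrict fun j => s.nat a (e.eval inp s) j ≠ 0) State.init).Nonempty)
    (h : ∀ p ∈ exec c (inp.restrict fun j => s.nat a (e.eval inp s) j ≠ 0) State.init,
      p.2 ≤ q.eval B ∧ Q (s.setRow out inp.m (p.1.real 0 0))) :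
    Spec q B inp (.call c a e out) s Q := by
  obtain ⟨p, hp⟩ := hne
  refine ⟨⟨_, p, hp, rfl⟩, ?_⟩
  rintro _ ⟨p, hp, rfl⟩
  refine ⟨?_, (h p hp).2⟩
  have := (h p hp).1
  simp only [Cmd.time, Polynomial.eval_add, Polynomial.eval_C, Polynomial.eval_mul,
    Polynomial.eval_X, Polynomial.eval_ofNat]
  omega

end Spec

end MMC

namespace MMC

attribute [simp] NExp.eval RExp.eval BExp.Holds Alg.val Alg.zero Alg.one Alg.on Alg.block Alg.put

/-- Rule for two nested loops; `I a b` holds when the rows before `a` and the first `b` entries of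
row `a` have been processed. -/
lemma Spec.loop₂ {q : Polynomial ℕ} {B : ℕ} {inp : Input} {c : Cmd} {s : State}
    {Q : State → Prop} {v w : ℕ} {e f : NExp} (N : ℕ) (I : ℕ → ℕ → State → Prop)
    (he : e.eval inp s ≤ B) (hf : ∀ s, f.eval inp s = N) (hN : N ≤ B)
    (hv : v ∉ (Cmd.loop w f c).natWrites)
    (hset : ∀ a b t s', I a b s' → I a b (s'.setNat v 0 0 t)) (h0 : I 0 0 s)
    (hstep : ∀ a < e.eval inp s, ∀ b < N, ∀ s', Unch (.loop v e (.loop w f c)) s s' →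
      s'.nat v 0 0 = a → I a b s' → Spec q B inp c (s'.setNat w 0 0 b) (I a (b + 1)))
    (hrow : ∀ a s', I a N s' → I (a + 1) 0 s')
    (hQ : ∀ s', Unch (.loop v e (.loop w f c)) s s' → I (e.eval inp s) 0 s' → Q s') :
    Spec q B inp (.loop v e (.loop w f c)) s Q := by
  refine Spec.loop (fun a => I a 0) he h0 (fun a ha s' hU hI => ?_) hQ
  have hU' : Unch (.loop v e (.loop w f c)) s (s'.setNat v 0 0 a) :=
    hU.trans (unch_setNat s' (by simp [Cmd.natWrites]) _ _ _)
  refine Spec.loop (I a) (by rw [hf]; exact hN) (hset _ _ _ _ hI) (fun b hb s'' hU'' hI' => ?_)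
    (fun s'' _ h => hrow a s'' (by rwa [hf] at h))
  rw [hf] at hb
  refine hstep a ha b hb s'' (hU'.trans (hU''.mono ?_ ?_)) ?_ hI'
  · simp [Cmd.natWrites]
  · simp [Cmd.realWrites]
  · rw [hU''.nat v hv]; simp

/-! ## A primal-dual algorithm for `1`-covers -/

namespace PrimalDual

open Alg (val put block when on zero one)

def c : ℕ := 0
def j : ℕ := 1
def i : ℕ := 2
def z : ℕ := 3
def best : ℕ := 4
def rounds : ℕ := 5
/-- `act j = 1` iff there is a tight ball with centre `j` that may still be chosen. -/
def act : ℕ := 6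

def r : ℕ := 0
/-- `slack j i` is the slack of the dual constraint of the ball around `j` with `i` on its
boundary. -/
def slack : ℕ := 1
/-- The radius of the largest tight ball around a server. -/
def rad : ℕ := 2
def delta : ℕ := 3

def initSlack : Cmd :=
  .loop j .m (.loop i .n (.rset slack (val j) (val i) (.pow (.cs (val i) (val j)))))

/-- The smallest slack of a ball containing `c`, starting from the one around `z`. -/
def minSlack : Cmd :=
  .seq (.rset delta zero zero (.get slack (val z) (val c)))
    (.loop j .m (.loop i .n (when (.and (.eq (.mask (val j)) one)
        (.and (.rle (.cs (val c) (val j)) (.cs (val i) (val j)))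
          (.rlt (.get slack (val j) (val i)) (.get delta zero zero))))
      (.rset delta zero zero (.get slack (val j) (val i))))))

/-- Raise the dual variable of `c` by `delta`. -/
def lowerSlack : Cmd :=
  .loop j .m (.loop i .n (when (.rle (.cs (val c) (val j)) (.cs (val i) (val j)))
    (.rset slack (val j) (val i) (.sub (.get slack (val j) (val i)) (.get delta zero zero)))))

def raiseDuals : Cmd :=
  .loop c .n (.pick z .m (.eq (.mask (val z)) one) (.seq minSlack lowerSlack) .skip)

def findTight : Cmd :=
  .loop j .m (.loop i .n (when (.and (.eq (.mask (val j)) one)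
      (.and (.rle (.get slack (val j) (val i)) .zero)
        (.or (.not (on act zero (val j))) (.rlt (.get rad zero (val j)) (.cs (val i) (val j))))))
    (.seq (.rset rad zero (val j) (.cs (val i) (val j))) (.nset act zero (val j) one))))

/-- From the tight balls, choose a set of balls that have no clients in common, in the order of
decreasing radius, and triple their radii. -/
def chooseBalls : Cmd :=
  .loop rounds .m (.pick z .m (on act zero (val z))
    (block [
      put best (val z),
      .loop z .m (when (.and (on act zero (val z))
          (.rlt (.get rad zero (val best)) (.get rad zero (val z))))
        (put best (val z))),
      .rset r zero (val best)
        (.add (.get rad zero (val best))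
          (.add (.get rad zero (val best)) (.get rad zero (val best)))),
      .loop z .m (.pick c .n
        (.and (.rle (.cs (val c) (val best)) (.get rad zero (val best)))
          (.rle (.cs (val c) (val z)) (.get rad zero (val z))))
        (.nset act zero (val z) zero) .skip)])
    .skip)

def program : Cmd := block [initSlack, raiseDuals, findTight, chooseBalls]

/-! ### The four phases of the primal-dual program. -/

variable {q : Polynomial ℕ} {B : ℕ} {inp : Input} {s : State}

open State in
-- With all dual variables zero, the slack of a ball is its own cost.
lemma initSlack_spec (hn : inp.n ≤ B) (hm : inp.m ≤ B) :
    Spec q B inp initSlack s fun s' => ∀ b < inp.m, ∀ a < inp.n,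
      s'.real slack b a = |inp.cs a b| ^ inp.α := by
  refine Spec.loop₂ inp.n (fun b a s' => ∀ b' < inp.m, ∀ a' < inp.n,
    (b' < b ∨ b' = b ∧ a' < a) → s'.real slack b' a' = |inp.cs a' b'| ^ inp.α)
    hm (fun _ => rfl) hn (by decide) (fun a b t s' h => h) (by simp) ?_ ?_ ?_
  · intro b hb a ha s' _ hj h
    apply Spec.rset
    intro b' hb' a' ha' hlt
    simp +decide [hj]
    split_ifs with h1
    · rw [h1.1, h1.2]
    · exact h b' hb' a' ha' (by grind)
  · intro b s' h b' hb' a' ha' hlt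
    exact h b' hb' a' ha' (by omega)
  · intro s' _ h b' hb' a' ha'
    exact h b' hb' a' ha' (Or.inl hb')

lemma minSlack_spec (hn : inp.n ≤ B) (hm : inp.m ≤ B) (hz : s.nat z 0 0 < inp.m)
    (hmask : inp.mask (s.nat z 0 0) = 1) (hc : s.nat c 0 0 < inp.n) :
    Spec q B inp minSlack s fun s' =>
      (∃ b < inp.m, inp.mask b = 1 ∧ ∃ a < inp.n, inp.cs (s.nat c 0 0) b ≤ inp.cs a b ∧
        s'.real delta 0 0 = s.real slack b a) ∧
      ∀ b < inp.m, inp.mask b = 1 → ∀ a < inp.n, inp.cs (s.nat c 0 0) b ≤ inp.cs a b →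
        s'.real delta 0 0 ≤ s.real slack b a := by
  refine Spec.seq (Spec.rset ?_)
  refine Spec.loop₂ inp.n (fun b a s' =>
      (∃ b < inp.m, inp.mask b = 1 ∧ ∃ a < inp.n, inp.cs (s.nat c 0 0) b ≤ inp.cs a b ∧
        s'.real delta 0 0 = s.real slack b a) ∧
      ∀ b' < inp.m, inp.mask b' = 1 → ∀ a' < inp.n, inp.cs (s.nat c 0 0) b' ≤ inp.cs a' b' →
        (b' < b ∨ b' = b ∧ a' < a) → s'.real delta 0 0 ≤ s.real slack b' a')
    hm (fun _ => rfl) hn (by decide) (fun a b t s' h => h) ?_ ?_ ?_ ?_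
  -- The ball around `z` with `c` on its boundary contains `c`, so the search starts from an
  -- attained value.
  · exact ⟨⟨_, hz, hmask, _, hc, le_rfl, by simp⟩, by simp⟩
  · rintro b hb a ha s' hU hj ⟨h1, h2⟩
    have hsl : s'.real slack = s.real slack := by
      rw [hU.real slack (by decide)]
      exact State.setReal_real_of_ne _ (by decide) _ _ _
    have hc' : s'.nat c = s.nat c := hU.nat c (by decide)
    refine Spec.when (fun hh => Spec.rset ?_) (fun hh => ?_)
    · simp +decide [hj, hsl, hc'] at hh ⊢
      refine ⟨⟨b, hb, hh.1, a, ha, hh.2.1, rfl⟩, fun b' hb' hm' a' ha' hle hlt => ?_⟩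
      by_cases hba : b' = b ∧ a' = a
      · rw [hba.1, hba.2]
      · exact hh.2.2.le.trans (h2 b' hb' hm' a' ha' hle (by omega))
    · simp +decide [hj, hsl, hc'] at hh ⊢
      refine ⟨h1, fun b' hb' hm' a' ha' hle hlt => ?_⟩
      by_cases hba : b' = b ∧ a' = a
      · rw [hba.1] at hm' hle ⊢
        rw [hba.2] at hle ⊢
        exact hh hm' hle
      · exact h2 b' hb' hm' a' ha' hle (by omega)
  · rintro b s' ⟨h1, h2⟩
    exact ⟨h1, fun b' hb' hm' a' ha' hle hlt => h2 b' hb' hm' a' ha' hle (by omega)⟩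
  · rintro s' _ ⟨h1, h2⟩
    exact ⟨h1, fun b' hb' hm' a' ha' hle => h2 b' hb' hm' a' ha' hle (Or.inl hb')⟩

lemma lowerSlack_spec (hn : inp.n ≤ B) (hm : inp.m ≤ B) :
    Spec q B inp lowerSlack s fun s' => ∀ b < inp.m, ∀ a < inp.n, s'.real slack b a =
      s.real slack b a - if inp.cs (s.nat c 0 0) b ≤ inp.cs a b then s.real delta 0 0 else 0 := by
  refine Spec.loop₂ inp.n (fun b a s' => ∀ b' < inp.m, ∀ a' < inp.n, s'.real slack b' a' =
      s.real slack b' a' - if (b' < b ∨ b' = b ∧ a' < a) ∧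
        inp.cs (s.nat c 0 0) b' ≤ inp.cs a' b' then s.real delta 0 0 else 0)
    hm (fun _ => rfl) hn (by decide) (fun a b t s' h => h) (by simp) ?_ ?_ ?_
  · rintro b hb a ha s' hU hj h
    have hd : s'.real delta = s.real delta := hU.real delta (by decide)
    have hc' : s'.nat c = s.nat c := hU.nat c (by decide)
    refine Spec.when (fun hh => Spec.rset ?_) (fun hh => ?_)
    · simp +decide [hj, hd, hc'] at hh ⊢
      intro b' hb' a' ha'
      by_cases hba : b' = b ∧ a' = a
      · obtain ⟨rfl, rfl⟩ := hba
        simp [h b' hb a' ha, hh]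
      · rw [if_neg hba, h b' hb' a' ha']
        congr 2
        grind
    · simp +decide [hj, hc'] at hh ⊢
      intro b' hb' a' ha'
      rw [h b' hb' a' ha']
      congr 2
      grind
  · intro b s' h b' hb' a' ha'
    rw [h b' hb' a' ha']
    congr 2
    grind
  · intro s' _ h b' hb' a' ha'
    rw [h b' hb' a' ha']
    congr 2
    simp [hb']

/-- The slacks that belong to a dual solution `β`, in which the first `N` clients lie in tight
balls. -/
structure DualInv (inp : Input) (N : ℕ) (β : ℕ → ℝ) (s : State) : Prop where
  nonneg : ∀ a, 0 ≤ β a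
  slack_eq : ∀ b < inp.m, ∀ a < inp.n, s.real slack b a =
    |inp.cs a b| ^ inp.α - ∑ a' ∈ Finset.range N with inp.cs a' b ≤ inp.cs a b, β a'
  slack_nonneg : ∀ b < inp.m, inp.mask b = 1 → ∀ a < inp.n, 0 ≤ s.real slack b a
  tight : ∀ a' < N, ∃ b < inp.m, inp.mask b = 1 ∧ ∃ a < inp.n, inp.cs a' b ≤ inp.cs a b ∧
    s.real slack b a ≤ 0

/-- Raising the dual of a client by the least slack of the balls containing it keeps these slacks
nonnegative and makes one of them zero. Slacks of forbidden servers are updated as well and may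
become negative; nothing is claimed about their sign. -/
lemma raiseDuals_spec (hn : inp.n ≤ B) (hm : inp.m ≤ B)
    (hS : inp.n = 0 ∨ ∃ b < inp.m, inp.mask b = 1)
    (hs : ∀ b < inp.m, ∀ a < inp.n, s.real slack b a = |inp.cs a b| ^ inp.α) :
    Spec q B inp raiseDuals s fun s' => ∃ β, DualInv inp inp.n β s' := by
  refine Spec.loop (fun N s' => ∃ β, DualInv inp N β s') hn ⟨0, ?_⟩ ?_ (fun s' _ h => h)
  · refine ⟨fun _ => le_rfl, by simpa using hs, fun b hb _ a ha => ?_, by simp⟩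
    rw [hs b hb a ha]; positivity
  · rintro N hN s' _ ⟨β, h⟩
    simp only [NExp.eval] at hN
    refine Spec.pick hm (fun t ht hb => ?_) (fun hb => ?_)
    · simp only [NExp.eval] at ht
      simp at hb
      refine Spec.seq ((minSlack_spec hn hm (by simpa using ht) (by simpa using hb)
        (by simpa +decide using hN)).conseq ?_)
      rintro s₁ hU₁ ⟨⟨b₀, hb₀, hm₀, a₀, ha₀, hle₀, hd₀⟩, hmin⟩
      refine (lowerSlack_spec hn hm).conseq ?_
      intro s₂ hU₂ hs₂
      have hsl : s₁.real slack = s'.real slack := hU₁.real slack (by decide)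
      have hc' : s₁.nat c 0 0 = N := by rw [hU₁.nat c (by decide)]; simp +decide
      simp +decide only [State.setNat_nat, State.setNat_real] at hle₀ hd₀ hmin
      simp only [hc', hsl] at hs₂
      simp at hle₀ hmin
      have hd0 : 0 ≤ s₁.real delta 0 0 := by
        rw [hd₀]; exact h.slack_nonneg b₀ hb₀ hm₀ a₀ ha₀
      -- Client `N` has not yet entered the sums over the first `N` clients, so its dual value can
      -- be set freely.
      refine ⟨Function.update β N (s₁.real delta 0 0), fun a => ?_, fun b hb a ha => ?_,
        fun b hb hmb a ha => ?_, fun a' ha' => ?_⟩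
      · by_cases haN : a = N
        · subst haN; simpa using hd0
        · simpa [haN] using h.nonneg a
      · rw [hs₂ b hb a ha, h.slack_eq b hb a ha, Finset.range_add_one, Finset.filter_insert]
        have hsum : ∀ A : Finset ℕ, A ⊆ Finset.range N →
            ∑ a' ∈ A, Function.update β N (s₁.real delta 0 0) a' = ∑ a' ∈ A, β a' := by
          intro A hA
          refine Finset.sum_congr rfl fun a' ha' => ?_
          have := Finset.mem_range.1 (hA ha')
          rw [Function.update_of_ne (by omega)]
        split_ifs
        · rw [Finset.sum_insert (by simp), hsum _ (Finset.filter_subset _ _)]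
          simp; ring
        · rw [hsum _ (Finset.filter_subset _ _)]; ring
      · rw [hs₂ b hb a ha]
        split_ifs with hle
        · linarith [hmin b hb hmb a ha hle]
        · simpa using h.slack_nonneg b hb hmb a ha
      · rcases Nat.lt_succ_iff_lt_or_eq.1 ha' with ha' | rfl
        -- Slacks only decrease, so a tight ball stays tight.
        · obtain ⟨b, hb, hmb, a, ha, hle, ht⟩ := h.tight a' ha'
          refine ⟨b, hb, hmb, a, ha, hle, ?_⟩
          rw [hs₂ b hb a ha]
          split_ifs <;> linarith
        · refine ⟨b₀, hb₀, hm₀, a₀, ha₀, hle₀, ?_⟩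
          rw [hs₂ b₀ hb₀ a₀ ha₀, if_pos hle₀, hd₀]
          simp
    · exfalso
      rcases hS with hS | ⟨b, hb', hmb⟩
      · omega
      · exact hb b hb' (by simpa using hmb)

/-- Active servers have a tight ball of radius `rad`, and all tight balls are inside these. -/
structure TightInv (inp : Input) (T : ℕ → ℕ → Prop) (s : State) : Prop where
  of_act : ∀ b < inp.m, s.nat act 0 b = 1 → inp.mask b = 1 ∧
    ∃ a < inp.n, s.real slack b a ≤ 0 ∧ s.real rad 0 b = inp.cs a b
  of_tight : ∀ b < inp.m, inp.mask b = 1 → ∀ a < inp.n, T b a → s.real slack b a ≤ 0 →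
    s.nat act 0 b = 1 ∧ inp.cs a b ≤ s.real rad 0 b

lemma findTight_spec (hn : inp.n ≤ B) (hm : inp.m ≤ B) (hact : s.nat act = 0) :
    Spec q B inp findTight s (TightInv inp fun _ _ => True) := by
  refine Spec.loop₂ inp.n (fun b a => TightInv inp fun b' a' => b' < b ∨ b' = b ∧ a' < a)
    hm (fun _ => rfl) hn (by decide) (fun a b t s' h => ?_) ?_ ?_ ?_ ?_
  · exact ⟨by simpa +decide using h.1, by simpa +decide using h.2⟩
  · exact ⟨by simp [hact], by simp⟩
  · rintro b hb a ha s' hU hj ⟨h1, h2⟩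
    refine Spec.when (fun hh => Spec.seq (Spec.rset (Spec.nset ?_))) (fun hh => ?_)
    · simp +decide [hj] at hh ⊢
      constructor
      · intro b' hb' hab
        simp +decide at hab ⊢
        by_cases hbb : b' = b
        · subst hbb
          simp
          exact ⟨hh.1, a, ha, hh.2.1, rfl⟩
        · simp [hbb] at hab ⊢
          exact h1 b' hb' hab
      · intro b' hb' hmb a' ha' hT ht
        simp +decide at ht ⊢
        by_cases hbb : b' = b
        · subst hbb
          simp
          by_cases haa : a' = a
          · rw [haa]
          · have := h2 b' hb hmb a' ha' (by omega) ht
            -- The server is already active, so the test has passed because the new tight ball is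
            -- larger.
            exact this.2.trans (hh.2.2.resolve_left (by simpa using this.1)).le
        · simp [hbb]
          exact h2 b' hb' hmb a' ha' (by omega) ht
    · simp +decide [hj] at hh ⊢
      constructor
      · intro b' hb' hab
        simp +decide at hab ⊢
        exact h1 b' hb' hab
      · intro b' hb' hmb a' ha' hT ht
        simp +decide at ht ⊢
        by_cases hba : b' = b ∧ a' = a
        · obtain ⟨rfl, rfl⟩ := hba
          exact hh hmb ht
        · exact h2 b' hb' hmb a' ha' (by omega) ht
  · intro b s' h
    exact ⟨h.1, fun b' hb' hmb a' ha' hT => h.2 b' hb' hmb a' ha' (by omega)⟩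
  · intro s' _ h
    exact ⟨h.1, fun b' hb' hmb a' ha' _ => h.2 b' hb' hmb a' ha' (Or.inl hb')⟩

/-- The balls of radius `R` around `b` and `b'` have a client in common. -/
def Share (inp : Input) (R : ℕ → ℝ) (b b' : ℕ) : Prop :=
  ∃ a < inp.n, inp.cs a b ≤ R b ∧ inp.cs a b' ≤ R b'

lemma Share.symm {R : ℕ → ℝ} {b b' : ℕ} (h : Share inp R b b') : Share inp R b' b := by
  obtain ⟨a, ha, h1, h2⟩ := h
  exact ⟨a, ha, h2, h1⟩

lemma maxActive_spec (hm : inp.m ≤ B) (hb : s.nat best 0 0 < inp.m)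
    (hact : s.nat act 0 (s.nat best 0 0) = 1) :
    Spec q B inp (.loop z .m (when (.and (on act zero (val z))
          (.rlt (.get rad zero (val best)) (.get rad zero (val z))))
        (put best (val z)))) s fun s' =>
      s'.nat best 0 0 < inp.m ∧ s.nat act 0 (s'.nat best 0 0) = 1 ∧
      ∀ b < inp.m, s.nat act 0 b = 1 → s.real rad 0 b ≤ s.real rad 0 (s'.nat best 0 0) := by
  refine Spec.loop (fun N s' => s'.nat best 0 0 < inp.m ∧ s.nat act 0 (s'.nat best 0 0) = 1 ∧
      ∀ b < N, s.nat act 0 b = 1 → s.real rad 0 b ≤ s.real rad 0 (s'.nat best 0 0)) hm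
    ⟨hb, hact, by simp⟩ ?_ (fun s' _ h => h)
  rintro N hN s' hU ⟨h1, h2, h3⟩
  have ha : s'.nat act = s.nat act := hU.nat act (by decide)
  have hr : s'.real = s.real := funext fun a => hU.real a (by simp [Cmd.realWrites, when])
  simp only [NExp.eval] at hN
  refine Spec.when (fun hh => Spec.nset ?_) (fun hh => ?_)
  · simp +decide [ha, hr] at hh ⊢
    refine ⟨hN, hh.1, fun b hb hab => ?_⟩
    rcases hb.lt_or_eq with hb | rfl
    · exact (h3 b hb hab).trans hh.2.le
    · rfl
  · simp +decide [ha, hr] at hh ⊢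
    refine ⟨h1, h2, fun b hb hab => ?_⟩
    rcases hb.lt_or_eq with hb | rfl
    · exact h3 b hb hab
    · exact hh hab

lemma deactivate_spec (hn : inp.n ≤ B) (hm : inp.m ≤ B) :
    Spec q B inp (.loop z .m (.pick c .n
        (.and (.rle (.cs (val c) (val best)) (.get rad zero (val best)))
          (.rle (.cs (val c) (val z)) (.get rad zero (val z))))
        (.nset act zero (val z) zero) .skip)) s fun s' => ∀ b < inp.m,
      s'.nat act 0 b = 1 ↔
        s.nat act 0 b = 1 ∧ ¬ Share inp (s.real rad 0) (s.nat best 0 0) b := by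
  refine Spec.loop (fun N s' => ∀ b < inp.m, s'.nat act 0 b = 1 ↔
        s.nat act 0 b = 1 ∧ ¬ (b < N ∧ Share inp (s.real rad 0) (s.nat best 0 0) b)) hm
    (by simp) ?_ ?_
  · intro N hN s' hU h
    have hb : s'.nat best = s.nat best := hU.nat best (by decide)
    have hr : s'.real = s.real := funext fun a => hU.real a (by simp [Cmd.realWrites])
    refine Spec.pick hn (fun t ht hh => Spec.nset ?_) (fun hh => Spec.skip ?_)
    · simp +decide [hb, hr] at hh ht ⊢
      intro b hbm
      by_cases hbN : b = N
      · subst hbN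
        have : Share inp (s.real rad 0) (s.nat best 0 0) b := ⟨t, ht, hh⟩
        simp [this]
      · simp only [hbN, if_false, h b hbm]
        grind
    · simp +decide [hb, hr] at hh ⊢
      intro b hbm
      rw [h b hbm]
      by_cases hbN : b = N
      · subst hbN
        have : ¬ Share inp (s.real rad 0) (s.nat best 0 0) b := by
          rintro ⟨a, ha, h1, h2⟩
          exact absurd h2 (not_le.2 (hh a ha h1))
        simp [this]
      · grind
  · intro s' _ h b hb
    simp only [NExp.eval] at h
    rw [h b hb]
    simp [hb]

/-- `A` marks the servers that are active before the first round, `D` the balls chosen in `N`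
rounds. By `count`, every round so far has removed an active server, or none is left; hence `m`
rounds suffice. -/
structure ChooseInv (inp : Input) (A : ℕ → Prop) (R : ℕ → ℝ) (N : ℕ) (D : Finset ℕ)
    (s : State) : Prop where
  sub : ∀ b ∈ D, b < inp.m ∧ A b
  disj : ∀ b ∈ D, ∀ b' ∈ D, b ≠ b' → ¬ Share inp R b b'
  radii : ∀ b, s.real r 0 b = if b ∈ D then R b + (R b + R b) else 0
  of_act : ∀ b < inp.m, s.nat act 0 b = 1 → A b ∧ ∀ b' ∈ D, ¬ Share inp R b' b
  dominated : ∀ b < inp.m, A b →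
    s.nat act 0 b = 1 ∨ ∃ b' ∈ D, Share inp R b' b ∧ R b ≤ R b'
  count : {b ∈ Finset.range inp.m | s.nat act 0 b = 1}.card + N ≤ inp.m ∨
    ∀ b < inp.m, s.nat act 0 b ≠ 1

/-- A server is deactivated only when its ball shares a client with a chosen ball that had maximal
radius among the active ones. So each discarded ball is dominated by a chosen one that is at least
as large. -/
lemma chooseBalls_spec (hn : inp.n ≤ B) (hm : inp.m ≤ B) (hr : ∀ b, s.real r 0 b = 0)
    (hs : ∀ b < inp.m, s.nat act 0 b = 1 → ∃ a < inp.n, inp.cs a b ≤ s.real rad 0 b) :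
    Spec q B inp chooseBalls s fun s' => ∃ D : Finset ℕ,
      (∀ b ∈ D, b < inp.m ∧ s.nat act 0 b = 1) ∧
      (∀ b ∈ D, ∀ b' ∈ D, b ≠ b' → ¬ Share inp (s.real rad 0) b b') ∧
      (∀ b, s'.real r 0 b = if b ∈ D then
        s.real rad 0 b + (s.real rad 0 b + s.real rad 0 b) else 0) ∧
      ∀ b < inp.m, s.nat act 0 b = 1 →
        ∃ b' ∈ D, Share inp (s.real rad 0) b' b ∧ s.real rad 0 b ≤ s.real rad 0 b' := by
  refine Spec.loop (fun N s' => ∃ D, ChooseInv inp (fun b => s.nat act 0 b = 1) (s.real rad 0)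
    N D s') hm ⟨∅, ?_⟩ ?_ ?_
  · refine ⟨by simp, by simp, by simpa using hr, by simp, by simp +contextual, Or.inl ?_⟩
    simpa using Finset.card_filter_le (Finset.range inp.m) fun b => s.nat act 0 b = 1
  · rintro N hN s₀ hU ⟨D, h⟩
    have hrad : s₀.real rad = s.real rad := hU.real rad (by decide)
    refine Spec.pick hm (fun t ht hh => ?_) (fun hh => Spec.skip ⟨D, ?_⟩)
    · simp +decide at ht hh
      refine Spec.seq (Spec.nset (Spec.seq ((maxActive_spec hm ?_ ?_).conseq ?_)))
      · simpa +decide using ht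
      · simpa +decide using hh
      · rintro s₁ hU₁ ⟨hb, hab, hmax⟩
        have hact₁ : s₁.nat act = s₀.nat act := by
          rw [hU₁.nat act (by decide)]
          funext a b
          simp +decide
        have hr₁ : s₁.real = s₀.real := by
          funext a
          rw [hU₁.real a (by simp [Cmd.realWrites, when])]
          simp
        simp +decide [hrad] at hab hmax
        refine Spec.seq (Spec.rset ((deactivate_spec hn hm).conseq ?_))
        intro s₂ hU₂ hact
        have hr₂ : s₂.real r 0 = Function.update (s₀.real r 0) (s₁.nat best 0 0)
            (s.real rad 0 (s₁.nat best 0 0) + (s.real rad 0 (s₁.nat best 0 0) +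
              s.real rad 0 (s₁.nat best 0 0))) := by
          rw [hU₂.real r (by decide)]
          funext b
          simp +decide [hr₁, hrad, Function.update_apply]
        simp +decide [hact₁, hr₁, State.setReal_real_of_ne, hrad] at hact
        generalize s₁.nat best 0 0 = b₀ at *
        -- A ball that contains a client meets itself, so the chosen server is deactivated too and
        -- the number of active servers drops.
        have hself : Share inp (s.real rad 0) b₀ b₀ := by
          obtain ⟨a, ha, hle⟩ := hs b₀ hb (h.of_act b₀ hb hab).1
          exact ⟨a, ha, hle, hle⟩
        refine ⟨insert b₀ D, ?_, ?_, fun b => ?_, fun b hbm hb1 => ?_, fun b hbm hA => ?_, ?_⟩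
        · intro b hbD
          rcases Finset.mem_insert.1 hbD with rfl | hbD
          · exact ⟨hb, (h.of_act b hb hab).1⟩
          · exact h.sub b hbD
        · intro b hbD b' hbD' hne
          rcases Finset.mem_insert.1 hbD with rfl | h1 <;>
            rcases Finset.mem_insert.1 hbD' with rfl | h2
          · exact absurd rfl hne
          · exact fun hsh => (h.of_act b hb hab).2 b' h2 hsh.symm
          · exact (h.of_act b' hb hab).2 b h1
          · exact h.disj b h1 b' h2 hne
        · rw [hr₂, Function.update_apply]
          by_cases hbb : b = b₀
          · simp [hbb]
          · simp [hbb, h.radii b]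
        · obtain ⟨h1, h2⟩ := (hact b hbm).1 hb1
          refine ⟨(h.of_act b hbm h1).1, fun b' hbD => ?_⟩
          rcases Finset.mem_insert.1 hbD with rfl | hbD
          · exact h2
          · exact (h.of_act b hbm h1).2 b' hbD
        · by_cases hsh : Share inp (s.real rad 0) b₀ b
          · rcases h.dominated b hbm hA with h1 | ⟨b', hbD, h1⟩
            · exact Or.inr ⟨b₀, by simp, hsh, hmax b hbm h1⟩
            · exact Or.inr ⟨b', by simp [hbD], h1⟩
          · rcases h.dominated b hbm hA with h1 | ⟨b', hbD, h1⟩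
            · exact Or.inl ((hact b hbm).2 ⟨h1, hsh⟩)
            · exact Or.inr ⟨b', by simp [hbD], h1⟩
        · left
          have hc := h.count.resolve_right (fun h' => h' b₀ hb hab)
          have hlt : {b ∈ Finset.range inp.m | s₂.nat act 0 b = 1}.card <
              {b ∈ Finset.range inp.m | s₀.nat act 0 b = 1}.card := by
            refine Finset.card_lt_card (Finset.ssubset_iff_of_subset ?_ |>.2 ⟨b₀, ?_, ?_⟩)
            · intro b hb'
              simp only [Finset.mem_filter, Finset.mem_range] at hb' ⊢
              exact ⟨hb'.1, ((hact b hb'.1).1 hb'.2).1⟩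
            · simpa using ⟨hb, hab⟩
            · simp only [Finset.mem_filter, Finset.mem_range, not_and]
              exact fun _ h' => ((hact b₀ hb).1 h').2 hself
          omega
    · simp +decide at hh
      exact ⟨h.sub, h.disj, h.radii, h.of_act, h.dominated, Or.inr hh⟩
  · rintro s' _ ⟨D, h⟩
    have hna : ∀ b < inp.m, s'.nat act 0 b ≠ 1 := by
      rcases h.count with hc | hc
      · intro b hb h1
        have : 0 < {b ∈ Finset.range inp.m | s'.nat act 0 b = 1}.card :=
          Finset.card_pos.2 ⟨b, by simpa using ⟨hb, h1⟩⟩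
        simp only [NExp.eval] at hc
        omega
      · exact hc
    exact ⟨D, h.sub, h.disj, h.radii, fun b hb hA => (h.dominated b hb hA).resolve_left (hna b hb)⟩

end PrimalDual
end MMC

/-! ### Encoded instances and the approximation ratio of the primal-dual program. -/

namespace MMC

section Encode

variable {M : Type*} [MetricSpace M] {n m : ℕ} (x : Fin n → M) (y : Fin m → M)

lemma distTable_of_lt {p q : ℕ} (u : Fin p → M) (v : Fin q → M) {i j : ℕ} (hi : i < p)
    (hj : j < q) : distTable u v i j = dist (u ⟨i, hi⟩) (v ⟨j, hj⟩) := by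
  simp [distTable, hi, hj]

lemma distTable_nonneg {p q : ℕ} (u : Fin p → M) (v : Fin q → M) (i j : ℕ) :
    0 ≤ distTable u v i j := by
  unfold distTable; split_ifs <;> positivity

lemma encode_mask_eq_one {k : ℕ} {α : ℝ} {S : Finset (Fin m)} (j : Fin m) :
    (encode x y k α S).mask j = 1 ↔ j ∈ S := by
  simp [encode]

end Encode

namespace PrimalDual

/-- This collects all that the analysis needs and no longer mentions slacks: a feasible dual
solution `β`, and radii `R` with chosen centres `D`. On `D` the dual constraints are equalities,
since a tight slack is both nonnegative and nonpositive. -/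
lemma program_spec {q : Polynomial ℕ} {B : ℕ} {inp : Input} (hn : inp.n ≤ B) (hm : inp.m ≤ B)
    (hS : inp.n = 0 ∨ ∃ b < inp.m, inp.mask b = 1) :
    Spec q B inp program State.init fun s => ∃ (β R : ℕ → ℝ) (D : Finset ℕ),
      (∀ a, 0 ≤ β a) ∧
      (∀ b < inp.m, inp.mask b = 1 → ∀ a < inp.n,
        ∑ a' ∈ Finset.range inp.n with inp.cs a' b ≤ inp.cs a b, β a' ≤
          |inp.cs a b| ^ inp.α) ∧
      (∀ a' < inp.n, ∃ b < inp.m, inp.mask b = 1 ∧ ∃ a < inp.n, inp.cs a' b ≤ inp.cs a b ∧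
        inp.cs a b ≤ R b ∧ ∃ b' ∈ D, Share inp R b' b ∧ R b ≤ R b') ∧
      (∀ b ∈ D, b < inp.m ∧ inp.mask b = 1 ∧ (∃ a < inp.n, R b = inp.cs a b) ∧
        |R b| ^ inp.α = ∑ a' ∈ Finset.range inp.n with inp.cs a' b ≤ R b, β a') ∧
      (∀ b ∈ D, ∀ b' ∈ D, b ≠ b' → ¬ Share inp R b b') ∧
      ∀ b, s.real r 0 b = if b ∈ D then R b + (R b + R b) else 0 := by
  refine Spec.seq ((initSlack_spec hn hm).conseq fun s₁ hU₁ h₁ => ?_)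
  refine Spec.seq ((raiseDuals_spec hn hm hS h₁).conseq fun s₂ hU₂ ⟨β, h₂⟩ => ?_)
  refine Spec.seq ((findTight_spec hn hm ?_).conseq fun s₃ hU₃ h₃ => ?_)
  · rw [hU₂.nat act (by decide), hU₁.nat act (by decide)]; rfl
  have hsl : s₃.real slack = s₂.real slack := hU₃.real slack (by decide)
  have hr : s₃.real r = 0 := by
    rw [hU₃.real r (by decide), hU₂.real r (by decide), hU₁.real r (by decide)]; rfl
  refine (chooseBalls_spec hn hm (by simp [hr]) fun b hb hab => ?_).conseq
    fun s₄ _ ⟨D, hD, hdisj, hr, hdom⟩ => ?_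
  · obtain ⟨-, a, ha, -, h⟩ := h₃.of_act b hb hab
    exact ⟨a, ha, h.ge⟩
  refine ⟨β, s₃.real rad 0, D, h₂.nonneg, fun b hb hmb a ha => ?_, fun a' ha' => ?_,
    fun b hb => ?_, hdisj, hr⟩
  · have h1 := h₂.slack_nonneg b hb hmb a ha
    rw [h₂.slack_eq b hb a ha] at h1
    linarith
  · obtain ⟨b, hb, hmb, a, ha, hle, ht⟩ := h₂.tight a' ha'
    obtain ⟨h1, h2⟩ := h₃.of_tight b hb hmb a ha trivial (by rwa [hsl])
    exact ⟨b, hb, hmb, a, ha, hle, h2, hdom b hb h1⟩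
  · obtain ⟨hbm, hab⟩ := hD b hb
    obtain ⟨hmb, a, ha, hs, hra⟩ := h₃.of_act b hbm hab
    refine ⟨hbm, hmb, ⟨a, ha, hra⟩, ?_⟩
    have h1 := h₂.slack_nonneg b hbm hmb a ha
    rw [hsl] at hs
    have h2 := h₂.slack_eq b hbm a ha
    rw [hra]
    linarith

/-- The primal-dual program is a Cover algorithm. -/
theorem isCoverAlgorithm {α : ℝ} (hα : 1 ≤ α) :
    IsCoverAlgorithm.{u} program (program.time 0) α := by
  intro M _ n m x y S hS
  have hS' : (encode x y 1 α S).n = 0 ∨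
      ∃ b < (encode x y 1 α S).m, (encode x y 1 α S).mask b = 1 := by
    rcases hS with ⟨j, hj⟩ | hn
    · exact Or.inr ⟨j, j.2, (encode_mask_eq_one x y j).2 hj⟩
    · exact Or.inl hn
  -- The program makes no calls, so the polynomial charged for calls can be zero.
  have hspec := program_spec (q := 0) (B := n + m) (inp := encode x y 1 α S)
    (Nat.le_add_right n m) (Nat.le_add_left m n) hS'
  refine ⟨hspec.1, fun p hp => ?_⟩
  obtain ⟨htime, β, R, D, hβ, hfeas, hcov, hD, hdisj, hr⟩ := hspec.2 p hp
  refine ⟨htime, ?_⟩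
  have hcs : ∀ (a : Fin n) (b : Fin m), (encode x y 1 α S).cs a b = dist (x a) (y b) :=
    fun a b => distTable_of_lt x y a.2 b.2
  have hcs0 : ∀ a b, 0 ≤ (encode x y 1 α S).cs a b := distTable_nonneg x y
  have hR : ∀ b ∈ D, 0 ≤ R b := fun b hb => by
    obtain ⟨-, -, ⟨a, -, h⟩, -⟩ := hD b hb
    rw [h]; exact hcs0 a b
  have hrad : ∀ b : Fin m, p.1.radii m b = if (b : ℕ) ∈ D then 3 * R b else 0 := fun b => by
    rw [State.radii]
    change p.1.real r 0 b = _
    rw [hr]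
    split_ifs <;> ring
  have hα0 : α ≠ 0 := by linarith
  refine ⟨⟨fun j _ => ?_, fun a => ?_⟩, fun r' hr' => ?_⟩
  · rw [hrad]
    split_ifs with h
    · have := hR _ h; positivity
    · rfl
  · obtain ⟨b, hb, -, a₁, -, h1, h2, b', hb', ⟨a₂, ha₂, h3, h4⟩, h5⟩ := hcov a a.2
    obtain ⟨hbm', hmb', -⟩ := hD b' hb'
    refine ⟨⟨b', hbm'⟩, (encode_mask_eq_one x y ⟨b', hbm'⟩).1 hmb', ?_⟩
    rw [hrad, if_pos hb']
    have e1 := hcs a ⟨b, hb⟩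
    have e2 := hcs ⟨a₂, ha₂⟩ ⟨b, hb⟩
    have e3 := hcs ⟨a₂, ha₂⟩ ⟨b', hbm'⟩
    -- The path from the client via `b` and the common client `a₂` to `b'` has length at most `2 * R
    -- b + R b' ≤ 3 * R b'`.
    have t1 := dist_triangle (x a) (y ⟨b, hb⟩) (y ⟨b', hbm'⟩)
    have t2 := dist_triangle_left (y ⟨b, hb⟩) (y ⟨b', hbm'⟩) (x ⟨a₂, ha₂⟩)
    simp only at e1 e2 e3
    linarith
  · set inp := encode x y 1 α S with hinp
    -- Weak duality: each client is charged to a ball of `r'` that contains it.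
    have hdual : ∑ a ∈ Finset.range n, β a ≤ costOn α S r' := by
      have h1 : ∀ a ∈ Finset.range n,
          β a ≤ ∑ j ∈ S, if inp.cs a j ≤ r' j then β a else 0 := by
        intro a ha
        obtain ⟨j, hj, hle⟩ := hr'.2 ⟨a, Finset.mem_range.1 ha⟩
        rw [← hcs ⟨a, Finset.mem_range.1 ha⟩ j] at hle
        refine le_trans (by rw [if_pos hle]) (Finset.single_le_sum
          (f := fun j : Fin m => if inp.cs a j ≤ r' j then β a else 0) (fun j _ => ?_) hj)
        split_ifs
        · exact hβ a
        · rfl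
      refine (Finset.sum_le_sum h1).trans ?_
      rw [Finset.sum_comm]
      refine Finset.sum_le_sum fun j hj => ?_
      rw [← Finset.sum_filter]
      -- A nonempty ball is shrunk until its farthest client is on the boundary; for the shrunken
      -- ball there is a dual constraint.
      rcases ({a ∈ Finset.range n | inp.cs a j ≤ r' j}).eq_empty_or_nonempty with he | hne
      · rw [he, Finset.sum_empty]
        exact Real.rpow_nonneg (hr'.1 j hj) _
      · obtain ⟨a, ha, hmax⟩ := Finset.exists_max_image _ (fun a => inp.cs a j) hne
        simp only [Finset.mem_filter, Finset.mem_range] at ha hmax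
        have h2 := hfeas j j.2 ((encode_mask_eq_one x y j).2 hj) a ha.1
        rw [abs_of_nonneg (hcs0 a j)] at h2
        refine le_trans (Finset.sum_le_sum_of_subset_of_nonneg ?_ fun a _ _ => hβ a)
          (h2.trans (Real.rpow_le_rpow (hcs0 a j) ha.2 (zero_le_one.trans hα)))
        intro a' ha'
        simp only [Finset.mem_filter, Finset.mem_range] at ha' ⊢
        exact ⟨ha'.1, hmax a' ha'⟩
    refine le_trans ?_ (mul_le_mul_of_nonneg_left hdual (by positivity))
    have hcost : costOn α S (p.1.radii m) = ∑ j ∈ S.filter fun j : Fin m => (j : ℕ) ∈ D,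
        (3 : ℝ) ^ α * ∑ a ∈ Finset.range n with inp.cs a j ≤ R j, β a := by
      rw [costOn, Finset.sum_filter]
      refine Finset.sum_congr rfl fun j _ => ?_
      rw [hrad]
      split_ifs with h
      · have := (hD j h).2.2.2
        rw [abs_of_nonneg (hR j h)] at this
        rw [Real.mul_rpow (by norm_num) (hR j h)]
        exact congrArg _ this
      · exact Real.zero_rpow hα0
    rw [hcost, ← Finset.mul_sum]
    refine mul_le_mul_of_nonneg_left ?_ (by positivity)
    -- The chosen balls have no common client, so no dual variable is counted twice.
    rw [← Finset.sum_biUnion]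
    · refine Finset.sum_le_sum_of_subset_of_nonneg ?_ fun a _ _ => hβ a
      intro a ha
      simp only [Finset.mem_biUnion, Finset.mem_filter] at ha
      obtain ⟨_, _, h, _⟩ := ha
      exact h
    · intro j hj j' hj' hne
      simp only [Finset.coe_filter, Set.mem_ofPred_eq] at hj hj'
      refine Finset.disjoint_left.2 fun a ha ha' => ?_
      simp only [Finset.mem_filter, Finset.mem_range] at ha ha'
      exact hdisj j hj.2 j' hj'.2 (fun h => hne (Fin.ext h)) ⟨a, ha.1, ha.2, ha'.2⟩

end PrimalDual
end MMC

namespace MMC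

/-! ## Sorting the servers -/

namespace Alg

variable {q : Polynomial ℕ} {B : ℕ} {inp : Input} {s : State}

/-- `nr` lists the servers by their distance from `a`, and `rk` is the inverse list. -/
structure SortedRow (inp : Input) (a : ℕ) (nr rk : ℕ → ℕ) : Prop where
  near_lt : ∀ b < inp.m, nr b < inp.m
  rank_near : ∀ b < inp.m, rk (nr b) = b
  rank_lt : ∀ v < inp.m, rk v < inp.m
  near_rank : ∀ v < inp.m, nr (rk v) = v
  mono : ∀ b b', b ≤ b' → b' < inp.m → inp.cs a (nr b) ≤ inp.cs a (nr b')

/-- `nr` lists the `N` servers closest to `a`, which are the ones marked in `pl`. -/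
structure PartSorted (inp : Input) (a N : ℕ) (nr rk pl : ℕ → ℕ) : Prop where
  near_lt : ∀ b < N, nr b < inp.m
  placed_near : ∀ b < N, pl (nr b) = 1
  rank_near : ∀ b < N, rk (nr b) = b
  surj : ∀ v < inp.m, pl v = 1 → ∃ b < N, nr b = v
  mono : ∀ b b', b ≤ b' → b' < N → inp.cs a (nr b) ≤ inp.cs a (nr b')
  rest : ∀ b < N, ∀ v < inp.m, pl v ≠ 1 → inp.cs a (nr b) ≤ inp.cs a v

namespace PartSorted

variable {a N : ℕ} {nr rk pl : ℕ → ℕ}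

lemma exists_unplaced (h : PartSorted inp a N nr rk pl) (hN : N < inp.m) :
    ∃ v < inp.m, pl v ≠ 1 := by
  by_contra! hall
  have hsub : Finset.range inp.m ⊆ (Finset.range N).image nr := by
    intro v hv
    obtain ⟨b, hb, rfl⟩ := h.surj v (Finset.mem_range.1 hv) (hall v (Finset.mem_range.1 hv))
    exact Finset.mem_image_of_mem _ (Finset.mem_range.2 hb)
  have := (Finset.card_le_card hsub).trans Finset.card_image_le
  simp at this
  omega

lemma sortedRow (h : PartSorted inp a inp.m nr rk pl) : SortedRow inp a nr rk := by
  have himg : (Finset.range inp.m).image nr = Finset.range inp.m := by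
    refine Finset.eq_of_subset_of_card_le (fun v hv => ?_) ?_
    · obtain ⟨b, hb, rfl⟩ := Finset.mem_image.1 hv
      exact Finset.mem_range.2 (h.near_lt b (Finset.mem_range.1 hb))
    · rw [Finset.card_image_of_injOn]
      intro b hb b' hb' heq
      have := congrArg rk heq
      rwa [h.rank_near b (by simpa using hb), h.rank_near b' (by simpa using hb')] at this
  have hex : ∀ v < inp.m, ∃ b < inp.m, nr b = v := by
    intro v hv
    have := Finset.mem_range.2 hv
    rw [← himg] at this
    simpa using this
  refine ⟨h.near_lt, h.rank_near, fun v hv => ?_, fun v hv => ?_, h.mono⟩ <;>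
    obtain ⟨b, hb, rfl⟩ := hex v hv <;> rw [h.rank_near b hb]
  exact hb

/-- By `rest`, no unplaced server is closer than a listed one, so a closest unplaced server can be
appended without spoiling the order. -/
lemma step (h : PartSorted inp a N nr rk pl) {v : ℕ} (hv : v < inp.m) (hp : pl v ≠ 1)
    (hmin : ∀ v' < inp.m, pl v' ≠ 1 → inp.cs a v ≤ inp.cs a v') :
    PartSorted inp a (N + 1) (Function.update nr N v) (Function.update rk v N)
      (Function.update pl v 1) := by
  have hne : ∀ b < N, nr b ≠ v := fun b hb hbv => hp (hbv ▸ h.placed_near b hb)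
  have hcase : ∀ b < N + 1, (b = N ∧ Function.update nr N v b = v) ∨
      (b < N ∧ Function.update nr N v b = nr b) := by
    intro b hb
    by_cases hbN : b = N
    · exact Or.inl ⟨hbN, by simp [hbN]⟩
    · exact Or.inr ⟨by omega, by simp [hbN]⟩
  refine ⟨fun b hb => ?_, fun b hb => ?_, fun b hb => ?_, fun v' hv' hp' => ?_,
    fun b b' hle hb' => ?_, fun b hb v' hv' hp' => ?_⟩
  · rcases hcase b hb with ⟨-, e⟩ | ⟨hb, e⟩ <;> rw [e]
    exacts [hv, h.near_lt b hb]
  · rcases hcase b hb with ⟨-, e⟩ | ⟨hb, e⟩ <;> rw [e]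
    · simp
    · rw [Function.update_of_ne (hne b hb), h.placed_near b hb]
  · rcases hcase b hb with ⟨rfl, e⟩ | ⟨hb, e⟩ <;> rw [e]
    · simp
    · rw [Function.update_of_ne (hne b hb), h.rank_near b hb]
  · by_cases hvv : v' = v
    · exact ⟨N, by omega, by simp [hvv]⟩
    · rw [Function.update_of_ne hvv] at hp'
      obtain ⟨b, hb, rfl⟩ := h.surj v' hv' hp'
      exact ⟨b, by omega, by rw [Function.update_of_ne (by omega)]⟩
  · rcases hcase b' hb' with ⟨rfl, e'⟩ | ⟨hb', e'⟩ <;>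
      rcases hcase b (by omega) with ⟨rfl, e⟩ | ⟨hb, e⟩ <;> first | rw [e, e'] | rw [e]
    · exact h.rest b hb v hv hp
    · omega
    · exact h.mono b b' hle hb'
  · have hvv : v' ≠ v := by rintro rfl; simp at hp'
    rw [Function.update_of_ne hvv] at hp'
    rcases hcase b hb with ⟨rfl, e⟩ | ⟨hb, e⟩ <;> rw [e]
    · exact hmin v' hv' hp'
    · exact h.rest b hb v' hv' hp'

end PartSorted

lemma closestUnplaced_spec (hm : inp.m ≤ B) (hb : s.nat best 0 0 < inp.m)
    (hp : s.nat placed (s.nat c 0 0) (s.nat best 0 0) ≠ 1) :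
    Spec q B inp (.loop z .m (when (.and (.not (on placed (val c) (val z)))
          (.rlt (.cs (val c) (val z)) (.cs (val c) (val best))))
        (put best (val z)))) s fun s' =>
      s'.nat best 0 0 < inp.m ∧ s.nat placed (s.nat c 0 0) (s'.nat best 0 0) ≠ 1 ∧
      ∀ v < inp.m, s.nat placed (s.nat c 0 0) v ≠ 1 →
        inp.cs (s.nat c 0 0) (s'.nat best 0 0) ≤ inp.cs (s.nat c 0 0) v := by
  refine Spec.loop (fun N s' => s'.nat best 0 0 < inp.m ∧
      s.nat placed (s.nat c 0 0) (s'.nat best 0 0) ≠ 1 ∧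
      ∀ v < N, s.nat placed (s.nat c 0 0) v ≠ 1 →
        inp.cs (s.nat c 0 0) (s'.nat best 0 0) ≤ inp.cs (s.nat c 0 0) v) hm
    ⟨hb, hp, by simp⟩ ?_ (fun s' _ h => h)
  rintro N hN s' hU ⟨h1, h2, h3⟩
  have hp : s'.nat placed = s.nat placed := hU.nat placed (by decide)
  have hc : s'.nat c = s.nat c := hU.nat c (by decide)
  simp only [NExp.eval] at hN
  refine Spec.when (fun hh => Spec.nset ?_) (fun hh => ?_)
  · simp +decide [hp, hc] at hh ⊢
    refine ⟨hN, hh.1, fun b hb hab => ?_⟩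
    rcases hb.lt_or_eq with hb | rfl
    · exact hh.2.le.trans (h3 b hb hab)
    · rfl
  · simp +decide [hp, hc] at hh ⊢
    refine ⟨h1, h2, fun b hb hab => ?_⟩
    rcases hb.lt_or_eq with hb | rfl
    · exact h3 b hb hab
    · exact hh hab

lemma sortServers_spec (hn : inp.n ≤ B) (hm : inp.m ≤ B) (hp : s.nat placed = 0) :
    Spec q B inp sortServers s fun s' =>
      ∀ a < inp.n, SortedRow inp a (s'.nat near a) (s'.nat rank a) := by
  refine Spec.loop (fun N s' => (∀ a < N, SortedRow inp a (s'.nat near a) (s'.nat rank a)) ∧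
    ∀ a, N ≤ a → s'.nat placed a = 0) hn ⟨by simp, by simp [hp]⟩ ?_ (fun s' _ h => h.1)
  rintro a ha s₀ - ⟨h1, h2⟩
  refine Spec.loop (fun N s' => PartSorted inp a N (s'.nat near a) (s'.nat rank a)
      (s'.nat placed a) ∧ s'.nat c 0 0 = a ∧ ∀ a', a' ≠ a → s'.nat near a' = s₀.nat near a' ∧
        s'.nat rank a' = s₀.nat rank a' ∧ s'.nat placed a' = s₀.nat placed a') hm ?_ ?_ ?_
  · refine ⟨?_, by simp, fun a' _ => ⟨?_, ?_, ?_⟩⟩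
    · have : (s₀.setNat c 0 0 a).nat placed a = 0 := by
        rw [State.setNat_nat_of_ne _ (by decide), h2 a le_rfl]
      rw [this]
      exact ⟨by simp, by simp, by simp, by simp, by simp, by simp⟩
    all_goals rw [State.setNat_nat_of_ne _ (by decide)]
  · rintro b hb s₁ - ⟨hP, hc, hrows⟩
    refine Spec.pick hm (fun t ht hh => ?_) (fun hh => ?_)
    · simp +decide [hc] at hh ht
      refine Spec.seq (Spec.nset (Spec.seq ((closestUnplaced_spec hm ?_ ?_).conseq ?_)))
      · simpa +decide using ht
      · simpa +decide [hc] using hh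
      · rintro s₂ hU₂ ⟨hbm, hbp, hmin⟩
        have hc₂ : s₂.nat c 0 0 = a := by
          rw [hU₂.nat c (by decide)]; simp +decide [hc]
        have hj₂ : s₂.nat j 0 0 = b := by
          rw [hU₂.nat j (by decide)]; simp +decide
        have hn₂ : s₂.nat near = s₁.nat near := by
          rw [hU₂.nat near (by decide)]; funext; simp +decide
        have hr₂ : s₂.nat rank = s₁.nat rank := by
          rw [hU₂.nat rank (by decide)]; funext; simp +decide
        have hp₂ : s₂.nat placed = s₁.nat placed := by
          rw [hU₂.nat placed (by decide)]; funext; simp +decide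
        simp +decide [hc] at hbp hmin
        have hstep := hP.step hbm hbp hmin
        refine Spec.seq (Spec.nset (Spec.seq (Spec.nset (Spec.nset ?_))))
        refine ⟨?_, by simp +decide [hc₂], fun a' ha' => ?_⟩
        · convert hstep using 1 <;> funext v <;>
            simp +decide [hc₂, hj₂, hn₂, hr₂, hp₂, Function.update_apply]
        · obtain ⟨e1, e2, e3⟩ := hrows a' ha'
          rw [← e1, ← e2, ← e3]
          refine ⟨?_, ?_, ?_⟩ <;> funext v <;> simp +decide [hc₂, hn₂, hr₂, hp₂, ha']
    · exfalso
      obtain ⟨v, hv, hpv⟩ := hP.exists_unplaced hb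
      have := hh v hv
      simp +decide [hc] at this
      exact hpv this
  · rintro s₁ - ⟨hP, -, hrows⟩
    refine ⟨fun a' ha' => ?_, fun a' ha' => ?_⟩
    · rcases Nat.lt_succ_iff_lt_or_eq.1 ha' with ha' | rfl
      · rw [(hrows a' ha'.ne).1, (hrows a' ha'.ne).2.1]
        exact h1 a' ha'
      · exact hP.sortedRow
    · rw [(hrows a' (by omega)).2.2]
      exact h2 a' (by omega)

end Alg
end MMC

namespace MMC
namespace Alg

/-! ## Nets -/

variable {q : Polynomial ℕ} {B : ℕ} {inp : Input} {s : State}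

/-- The invariant is indexed by the number `N` of levels already treated, so the current level is `k
- N`. It must ignore the two scalars that are set before the body runs. -/
lemma downLoop_spec {body : Cmd} {Q : State → Prop} {L : ℕ} (I : ℕ → State → Prop)
    (hl : s.nat l 0 0 = L) (hL : 1 ≤ L) (hk : inp.k ≤ B)
    (hset : ∀ N s' a v, a = t ∨ a = i → I N s' → I N (s'.setNat a 0 0 v)) (h0 : I 0 s)
    (hstep : ∀ N i₀, N + i₀ = inp.k → L ≤ i₀ → ∀ s', Unch (downLoop body) s s' →
      s'.nat i 0 0 = i₀ → I N s' → Spec q B inp body s' (I (N + 1)))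
    (hQ : ∀ s', Unch (downLoop body) s s' → I (inp.k + 1 - L) s' → Q s') :
    Spec q B inp (downLoop body) s Q := by
  refine Spec.loop I ?_ h0 (fun N hN s' hU hI => ?_) fun s' hU hI => ?_
  · simp [hl]; omega
  · simp [hl] at hN
    refine Spec.seq (Spec.nset ?_)
    refine hstep N (inp.k - N) (by omega) (by omega) _ ?_ ?_ ?_
    · exact (hU.trans (unch_setNat _ (by simp [Cmd.natWrites]) _ _ _)).trans
        (unch_setNat _ (by simp [Cmd.natWrites, put]) _ _ _)
    · simp +decide
    · exact hset _ _ _ _ (Or.inr rfl) (hset _ _ _ _ (Or.inl rfl) hI)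
  · exact hQ s' hU (by simpa [hl] using hI)

/-- The clients `a` and `a'` have a common server among their `e` closest ones. -/
def NbrAdj (inp : Input) (rk : ℕ → ℕ → ℕ) (e a a' : ℕ) : Prop :=
  ∃ v < inp.m, rk a v < e ∧ rk a' v < e

/-- The clients `a` and `a'` are at most two hops apart. -/
def TwoHops (inp : Input) (rk : ℕ → ℕ → ℕ) (e a a' : ℕ) : Prop :=
  ∃ b < inp.n, NbrAdj inp rk e a b ∧ NbrAdj inp rk e b a'

/-- For `e ≥ 1` and at least one server, each client is adjacent to itself in the sense of `NbrAdj`;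
then `TwoHops` includes shorter distances, and this is hop distance at least 3. -/
def Separated (inp : Input) (rk : ℕ → ℕ → ℕ) (e : ℕ) (X : ℕ → Prop) : Prop :=
  ∀ a < inp.n, X a → ∀ a' < inp.n, X a' → a ≠ a' → ¬ TwoHops inp rk e a a'

structure IsNet (inp : Input) (rk : ℕ → ℕ → ℕ) (e : ℕ) (X : ℕ → Prop) : Prop where
  separated : Separated inp rk e X
  covers : ∀ a' < inp.n, ∃ a < inp.n, X a ∧ TwoHops inp rk e a a'

variable {rk : ℕ → ℕ → ℕ}

lemma NbrAdj.symm {e a a' : ℕ} (h : NbrAdj inp rk e a a') : NbrAdj inp rk e a' a := by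
  obtain ⟨v, hv, h1, h2⟩ := h
  exact ⟨v, hv, h2, h1⟩

lemma TwoHops.symm {e a a' : ℕ} (h : TwoHops inp rk e a a') : TwoHops inp rk e a' a := by
  obtain ⟨v, hv, h1, h2⟩ := h
  exact ⟨v, hv, h2.symm, h1.symm⟩

lemma NbrAdj.mono {e e' a a' : ℕ} (he : e ≤ e') (h : NbrAdj inp rk e a a') :
    NbrAdj inp rk e' a a' := by
  obtain ⟨v, hv, h1, h2⟩ := h
  exact ⟨v, hv, h1.trans_le he, h2.trans_le he⟩

lemma TwoHops.mono {e e' a a' : ℕ} (he : e ≤ e') (h : TwoHops inp rk e a a') :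
    TwoHops inp rk e' a a' := by
  obtain ⟨v, hv, h1, h2⟩ := h
  exact ⟨v, hv, h1.mono he, h2.mono he⟩

/-- The graph of a lower level has fewer edges. This is why the net of level `e + 1` is a legitimate
start for the net of level `e`. -/
lemma Separated.mono {e e' : ℕ} {X : ℕ → Prop} (he : e ≤ e') (h : Separated inp rk e' X) :
    Separated inp rk e X :=
  fun a ha hX a' ha' hX' hne hh => h a ha hX a' ha' hX' hne (hh.mono he)

lemma Separated.insert {e c₀ : ℕ} {X X' : ℕ → Prop} (h : Separated inp rk e X)
    (hX : ∀ a, X' a → X a ∨ a = c₀) (hc : ∀ a < inp.n, X a → ¬ TwoHops inp rk e a c₀) :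
    Separated inp rk e X' := by
  intro a ha ha1 a' ha' ha1' hne
  rcases hX a ha1 with h1 | rfl <;> rcases hX a' ha1' with h2 | rfl
  · exact h a ha h1 a' ha' h2 hne
  · exact hc a ha h1
  · exact fun hh => hc a' ha' h2 hh.symm
  · exact absurd rfl hne

lemma computeGraph_spec (hn : inp.n ≤ B) (hm : inp.m ≤ B) :
    Spec q B inp computeGraph s fun s' => ∀ a < inp.n, ∀ a' < inp.n,
      s'.nat adj a a' = 1 ↔ NbrAdj inp (s.nat rank) (s.nat i 0 0) a a' := by
  refine Spec.loop₂ inp.n (fun N N' s' => ∀ a < inp.n, ∀ a' < inp.n, (a < N ∨ a = N ∧ a' < N') →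
    (s'.nat adj a a' = 1 ↔ NbrAdj inp (s.nat rank) (s.nat i 0 0) a a'))
    hn (fun _ => rfl) hn (by decide) (fun a b t s' h => ?_) (by simp) ?_ ?_ ?_
  · simpa +decide using h
  · rintro N hN N' hN' s' hU hu h
    have hr : s'.nat rank = s.nat rank := hU.nat rank (by decide)
    have hi : s'.nat i = s.nat i := hU.nat i (by decide)
    refine Spec.pick hm (fun t ht hh => Spec.nset ?_) (fun hh => Spec.nset ?_)
    · simp +decide [hr, hi, hu] at hh ht ⊢
      intro a ha a' ha' hlt
      by_cases hab : a = N ∧ a' = N'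
      · obtain ⟨rfl, rfl⟩ := hab
        simpa using ⟨t, ht, hh⟩
      · rw [imp_iff_right (by tauto)]
        exact h a ha a' ha' (by omega)
    · simp +decide [hr, hi, hu] at hh ⊢
      intro a ha a' ha' hlt
      by_cases hab : a = N ∧ a' = N'
      · obtain ⟨rfl, rfl⟩ := hab
        simp
        rintro ⟨v, hv, h1, h2⟩
        exact absurd h2 (not_lt.2 (hh v hv h1))
      · rw [if_neg hab]
        exact h a ha a' ha' (by omega)
  · intro N s' h a ha a' ha' hlt
    exact h a ha a' ha' (by omega)
  · intro s' _ h a ha a' ha'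
    exact h a ha a' ha' (Or.inl ha)

lemma markTwoHops_spec {e : ℕ} (hn : inp.n ≤ B) (hc : s.nat c 0 0 < inp.n)
    (hadj : ∀ a < inp.n, ∀ a' < inp.n, s.nat adj a a' = 1 ↔ NbrAdj inp rk e a a') :
    Spec q B inp markTwoHops s fun s' => ∀ b < inp.n,
      s'.nat marked 0 b = 1 ↔ s.nat marked 0 b = 1 ∨ TwoHops inp rk e (s.nat c 0 0) b := by
  refine Spec.loop (fun N s' => ∀ b < inp.n, s'.nat marked 0 b = 1 ↔ s.nat marked 0 b = 1 ∨
    (b < N ∧ TwoHops inp rk e (s.nat c 0 0) b)) hn (by simp) ?_ ?_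
  · intro N hN s' hU h
    have ha : s'.nat adj = s.nat adj := hU.nat adj (by decide)
    have hc' : s'.nat c = s.nat c := hU.nat c (by decide)
    simp only [NExp.eval] at hN
    refine Spec.pick hn (fun t ht hh => Spec.nset ?_) (fun hh => Spec.skip ?_)
    · simp +decide [ha, hc'] at hh ht ⊢
      intro b hb
      by_cases hbN : b = N
      · subst hbN
        have : TwoHops inp rk e (s.nat c 0 0) b :=
          ⟨t, ht, (hadj _ hc _ ht).1 hh.1, (hadj _ ht _ hb).1 hh.2⟩
        simp [this]
      · simp only [hbN, h b hb]
        grind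
    · simp +decide [ha, hc'] at hh ⊢
      intro b hb
      rw [h b hb]
      by_cases hbN : b = N
      · subst hbN
        have : ¬ TwoHops inp rk e (s.nat c 0 0) b := by
          rintro ⟨v, hv, h1, h2⟩
          exact hh v hv ((hadj _ hc _ hv).2 h1) ((hadj _ hv _ hb).2 h2)
        simp [this]
      · grind
  · intro s' _ h b hb
    simp only [NExp.eval] at h
    rw [h b hb]
    simp [hb]

/-- The part of `computeNets` that is executed for a fixed `i`. -/
def computeNet : Cmd :=
  block [
    computeGraph,
    .loop u .n (.nset marked zero (val u) zero),
    .loop c .n (block [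
      .nset net (val i) (val c) (.get net (.add (val i) one) (val c)),
      when (on net (val i) (val c)) markTwoHops]),
    .loop rounds .n (.pick c .n (.not (on marked zero (val c)))
      (.seq (.nset net (val i) (val c) one) markTwoHops)
      .skip)]

lemma clearMarks_spec (hn : inp.n ≤ B) :
    Spec q B inp (.loop u .n (.nset marked zero (val u) zero)) s fun s' =>
      ∀ b < inp.n, s'.nat marked 0 b = 0 := by
  refine Spec.loop (fun N s' => ∀ b < N, s'.nat marked 0 b = 0) hn (by simp) ?_
    (fun s' _ h => h)
  intro N hN s' _ h
  refine Spec.nset ?_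
  simp +decide
  intro b hb hne
  exact h b (by omega)

/-- The net `e` is being extended; the clients within two hops of it are marked. -/
structure NetInv (inp : Input) (rk : ℕ → ℕ → ℕ) (e : ℕ) (s₀ s : State) : Prop where
  rows : ∀ e', e' ≠ e → s.nat net e' = s₀.nat net e'
  marked : ∀ b < inp.n, s.nat marked 0 b = 1 ↔
    ∃ a < inp.n, s.nat net e a = 1 ∧ TwoHops inp rk e a b
  sup : ∀ a < inp.n, s₀.nat net (e + 1) a = 1 → s.nat net e a = 1
  separated : Separated inp rk e fun a => s.nat net e a = 1

/-- A new net point is unmarked, hence at least three hops from the old ones. Every round adds a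
point or finds all clients marked, so `n` rounds suffice. -/
lemma computeNet_spec {e : ℕ} (hn : inp.n ≤ B) (hm : inp.m ≤ B) (hi : s.nat i 0 0 = e)
    (hrefl : ∀ a < inp.n, NbrAdj inp (s.nat rank) e a a)
    (hsep : Separated inp (s.nat rank) e fun a => s.nat net (e + 1) a = 1) :
    Spec q B inp computeNet s fun s' =>
      (∀ e', e' ≠ e → s'.nat net e' = s.nat net e') ∧
      (∀ a < inp.n, s.nat net (e + 1) a = 1 → s'.nat net e a = 1) ∧
      IsNet inp (s.nat rank) e fun a => s'.nat net e a = 1 := by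
  refine Spec.seq ((computeGraph_spec hn hm).conseq fun s₁ hU₁ hadj₁ => ?_)
  refine Spec.seq ((clearMarks_spec hn).conseq fun s₂ hU₂ hmark₂ => ?_)
  rw [hi] at hadj₁
  rw [← hU₂.nat adj (by decide)] at hadj₁
  have hnet₂ : s₂.nat net = s.nat net := by
    rw [hU₂.nat net (by decide), hU₁.nat net (by decide)]
  have hi₂ : s₂.nat i 0 0 = e := by
    rw [hU₂.nat i (by decide), hU₁.nat i (by decide), hi]
  clear hU₁ hU₂
  generalize s.nat rank = rk at *
  refine Spec.seq (Spec.conseq (Q' := fun s' => NetInv inp rk e s s') ?_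
    fun s₃ hU₃ h₃ => ?_)
  · refine Spec.loop (fun N s' => (∀ e', e' ≠ e → s'.nat net e' = s.nat net e') ∧
      (∀ b < inp.n, s'.nat marked 0 b = 1 ↔
        ∃ a < N, s.nat net (e + 1) a = 1 ∧ TwoHops inp rk e a b) ∧
      (∀ a < N, s'.nat net e a = s.nat net (e + 1) a)) hn ?_ ?_ ?_
    · refine ⟨fun e' _ => by rw [hnet₂], fun b hb => ?_, by simp⟩
      simp [hmark₂ b hb]
    · rintro N hN s' hU ⟨h1, h2, h3⟩
      simp only [NExp.eval] at hN
      have hi' : s'.nat i 0 0 = e := by rw [hU.nat i (by decide), hi₂]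
      refine Spec.seq (Spec.nset ?_)
      simp +decide [hi']
      rw [h1 (e + 1) (by omega)]
      set s₄ := (s'.setNat c 0 0 N).setNat net e N (s.nat net (e + 1) N) with hs₄
      have hrow₄ : ∀ e', e' ≠ e → s₄.nat net e' = s.nat net e' := by
        intro e' he'
        rw [← h1 e' he']
        funext a
        simp +decide [hs₄, he']
      have hnew₄ : ∀ a ≤ N, s₄.nat net e a = s.nat net (e + 1) a := by
        intro a ha
        by_cases haN : a = N
        · simp +decide [hs₄, haN]
        · simp +decide [hs₄, haN]
          exact h3 a (by omega)
      have hi₄ : s₄.nat i 0 0 = e := by simp +decide [hs₄, hi']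
      have hc₄ : s₄.nat c 0 0 = N := by simp +decide [hs₄]
      have hm₄ : s₄.nat marked = s'.nat marked := by funext; simp +decide [hs₄]
      have ha₄ : s₄.nat adj = s₂.nat adj := by
        rw [← hU.nat adj (by decide)]; funext; simp +decide [hs₄]
      clear_value s₄
      refine Spec.when (fun hh => ?_) (fun hh => ⟨hrow₄, fun b hb => ?_, hnew₄⟩)
      · simp [hi₄, hc₄, hnew₄] at hh
        refine (markTwoHops_spec hn (by rw [hc₄]; exact hN) (by rw [ha₄]; exact hadj₁)).conseq
          fun s₅ hU₅ h₅ => ?_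
        rw [hU₅.nat net (by decide)]
        refine ⟨hrow₄, fun b hb => ?_, hnew₄⟩
        rw [h₅ b hb, hm₄, h2 b hb, hc₄]
        constructor
        · rintro (⟨a, ha, h⟩ | h)
          · exact ⟨a, by omega, h⟩
          · exact ⟨N, by omega, hh, h⟩
        · rintro ⟨a, ha, h, h'⟩
          rcases ha.lt_or_eq with ha | rfl
          · exact Or.inl ⟨a, ha, h, h'⟩
          · exact Or.inr h'
      · simp [hi₄, hc₄, hnew₄] at hh
        rw [hm₄, h2 b hb]
        constructor
        · rintro ⟨a, ha, h⟩
          exact ⟨a, by omega, h⟩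
        · rintro ⟨a, ha, h, h'⟩
          rcases ha.lt_or_eq with ha | rfl
          · exact ⟨a, ha, h, h'⟩
          · exact absurd h hh
    · rintro s' _ ⟨h1, h2, h3⟩
      refine ⟨h1, fun b hb => ?_, fun a ha h => (h3 a ha).trans h, ?_⟩
      · rw [h2 b hb]
        refine exists_congr fun a => and_congr_right fun ha => ?_
        rw [h3 a ha]
      · intro a ha hX a' ha' hX'
        exact hsep a ha ((h3 a ha).symm.trans hX) a' ha' ((h3 a' ha').symm.trans hX')
  · have ha₃ : s₃.nat adj = s₂.nat adj := hU₃.nat adj (by decide)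
    have hi₃ : s₃.nat i 0 0 = e := by rw [hU₃.nat i (by decide), hi₂]
    refine Spec.loop (fun N s' => NetInv inp rk e s s' ∧
      ((∀ b < inp.n, s'.nat marked 0 b = 1) ∨
        N ≤ {a ∈ Finset.range inp.n | s'.nat net e a = 1}.card)) hn ⟨h₃, Or.inr (by simp)⟩ ?_ ?_
    · rintro N hN s' hU ⟨h, hN'⟩
      have hi' : s'.nat i 0 0 = e := by rw [hU.nat i (by decide), hi₃]
      refine Spec.pick hn (fun t ht hh => Spec.seq (Spec.nset ?_)) (fun hh => Spec.skip ?_)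
      · simp +decide [hi'] at hh ht ⊢
        set s₄ := ((s'.setNat rounds 0 0 N).setNat c 0 0 t).setNat net e t 1 with hs₄
        have hrow₄ : ∀ e', e' ≠ e → s₄.nat net e' = s.nat net e' := by
          intro e' he'
          rw [← h.rows e' he']
          funext a
          simp +decide [hs₄, he']
        have hnew₄ : ∀ a, s₄.nat net e a = 1 ↔ s'.nat net e a = 1 ∨ a = t := by
          intro a
          by_cases hat : a = t <;> simp +decide [hs₄, hat]
        have hc₄ : s₄.nat c 0 0 = t := by simp +decide [hs₄]
        have hm₄ : s₄.nat marked = s'.nat marked := by funext; simp +decide [hs₄]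
        have ha₄ : s₄.nat adj = s₂.nat adj := by
          rw [← ha₃, ← hU.nat adj (by decide)]; funext; simp +decide [hs₄]
        clear_value s₄
        have hnt : ¬ ∃ a < inp.n, s'.nat net e a = 1 ∧ TwoHops inp rk e a t :=
          fun h' => hh ((h.marked t ht).2 h')
        refine (markTwoHops_spec hn (by rw [hc₄]; exact ht) (by rw [ha₄]; exact hadj₁)).conseq
          fun s₅ hU₅ h₅ => ?_
        have hn₅ : s₅.nat net = s₄.nat net := hU₅.nat net (by decide)
        refine ⟨⟨fun e' he' => by rw [hn₅, hrow₄ e' he'], fun b hb => ?_, fun a ha ha1 => ?_, ?_⟩,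
          Or.inr ?_⟩
        · rw [h₅ b hb, hm₄, h.marked b hb, hc₄]
          simp only [hn₅, hnew₄]
          constructor
          · rintro (⟨a, ha, h, h'⟩ | h)
            · exact ⟨a, ha, Or.inl h, h'⟩
            · exact ⟨t, ht, Or.inr rfl, h⟩
          · rintro ⟨a, ha, h | rfl, h'⟩
            · exact Or.inl ⟨a, ha, h, h'⟩
            · exact Or.inr h'
        · rw [hn₅, hnew₄]
          exact Or.inl (h.sup a ha ha1)
        · refine h.separated.insert (c₀ := t) (fun a ha => ?_) fun a ha h1 h2 => hnt ⟨a, ha, h1, h2⟩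
          rwa [hn₅, hnew₄] at ha
        · have hlt : {a ∈ Finset.range inp.n | s'.nat net e a = 1}.card <
              {a ∈ Finset.range inp.n | s₅.nat net e a = 1}.card := by
            refine Finset.card_lt_card (Finset.ssubset_iff_of_subset ?_ |>.2 ⟨t, ?_, ?_⟩)
            · intro a ha
              simp only [Finset.mem_filter, hn₅, hnew₄] at ha ⊢
              exact ⟨ha.1, Or.inl ha.2⟩
            · simp only [Finset.mem_filter, hn₅, hnew₄, Finset.mem_range]
              exact ⟨ht, Or.inr trivial⟩
            · simp only [Finset.mem_filter, Finset.mem_range, not_and]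
              -- A net point is two hops from itself along loops, so an unmarked client is not yet
              -- in the net.
              exact fun _ h1 => hnt ⟨t, ht, h1, t, ht, hrefl t ht, hrefl t ht⟩
          rcases hN' with hN' | hN'
          · exact absurd (hN' t ht) hh
          · omega
      · simp +decide at hh
        exact ⟨⟨h.rows, h.marked, h.sup, h.separated⟩, Or.inl hh⟩
    · rintro s' _ ⟨h, hN⟩
      refine ⟨h.rows, h.sup, h.separated, fun b hb => ?_⟩
      rcases hN with hN | hN
      · exact (h.marked b hb).1 (hN b hb)
      -- After `n` additions the net consists of all clients and each one covers itself.
      · have := Finset.eq_of_subset_of_card_le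
          (Finset.filter_subset (fun a => s'.nat net e a = 1) (Finset.range inp.n)) (by simpa using hN)
        have hb' := Finset.mem_range.2 hb
        rw [← this, Finset.mem_filter] at hb'
        exact ⟨b, hb, hb'.2, b, hb, hrefl b hb, hrefl b hb⟩

lemma computeNets_spec {L : ℕ} (hn : inp.n ≤ B) (hm : inp.m ≤ B) (hk : inp.k ≤ B)
    (hl : s.nat l 0 0 = L) (hL : 1 ≤ L) (hnet : s.nat net = 0)
    (hrefl : ∀ a < inp.n, NbrAdj inp (s.nat rank) 1 a a) :
    Spec q B inp computeNets s fun s' => ∀ e, L ≤ e → e ≤ inp.k →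
      IsNet inp (s.nat rank) e (fun a => s'.nat net e a = 1) ∧
      (e < inp.k → ∀ a < inp.n, s'.nat net (e + 1) a = 1 → s'.nat net e a = 1) := by
  -- Row `k + 1` is never written; its zeros make the net of level `k` start empty.
  refine downLoop_spec (L := L) (fun N s' => s'.nat net (inp.k + 1) = 0 ∧ ∀ e, L ≤ e →
    e ≤ inp.k → inp.k < e + N →
      IsNet inp (s.nat rank) e (fun a => s'.nat net e a = 1) ∧
      (e < inp.k → ∀ a < inp.n, s'.nat net (e + 1) a = 1 → s'.nat net e a = 1))
    hl hL hk ?_ ?_ ?_ ?_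
  · rintro N s' a v (rfl | rfl) h <;> rw [State.setNat_nat_of_ne _ (by decide)] <;> exact h
  · exact ⟨by rw [hnet]; rfl, fun e _ h1 h2 => by omega⟩
  · rintro N e hN hLe s' hU hi ⟨h0, h⟩
    have hr : s'.nat rank = s.nat rank := hU.nat rank (by decide)
    refine (computeNet_spec hn hm hi (fun a ha => ?_) ?_).conseq ?_
    · rw [hr]; exact (hrefl a ha).mono (by omega)
    · rw [hr]
      by_cases hek : e = inp.k
      · intro a _ ha
        simp [hek, h0] at ha
      · exact (h (e + 1) (by omega) (by omega) (by omega)).1.separated.mono (by omega)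
    · rw [hr]
      rintro s'' - ⟨hrows, hsup, hnet'⟩
      refine ⟨by rw [hrows _ (by omega), h0], fun e' hL' hk' hN' => ?_⟩
      by_cases hee : e' = e
      · subst hee
        refine ⟨hnet', fun _ a ha h1 => hsup a ha ?_⟩
        rwa [hrows _ (by omega)] at h1
      · rw [hrows e' hee, hrows (e' + 1) (by omega)]
        exact h e' hL' hk' (by omega)
  · rintro s' - ⟨-, h⟩ e hLe hek
    exact h e hLe hek (by omega)

end Alg
end MMC

namespace MMC
namespace Alg

/-! ## Choosing the server subsets -/

variable {inp : Input} {rk : ℕ → ℕ → ℕ} {L e : ℕ} {X A₀ A S P : ℕ → Prop} {NS NP : ℕ}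

/-- `v` is the last server of `A` among the `e` closest ones of `a`. -/
def IsLast (inp : Input) (rk : ℕ → ℕ → ℕ) (e : ℕ) (A : ℕ → Prop) (a v : ℕ) : Prop :=
  v < inp.m ∧ A v ∧ rk a v < e ∧ ∀ v' < inp.m, A v' → rk a v' < e → rk a v' ≤ rk a v

/-- The sets `S` and `P` of servers have been extracted from `A₀` for the first `NS` and `NP`
clients, respectively, of the net `X` of level `e`, and `A` is left. -/
structure Round (inp : Input) (rk : ℕ → ℕ → ℕ) (L e : ℕ) (X A₀ : ℕ → Prop) (NS NP : ℕ)
    (A S P : ℕ → Prop) : Prop where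
  avail : ∀ v, A v ↔ A₀ v ∧ ¬ S v ∧ ¬ P v
  disj : ∀ v, S v → ¬ P v
  of_shared : ∀ v, S v → ∃ a < inp.n, a < NS ∧ X a ∧ IsLast inp rk e A₀ a v
  of_private : ∀ v, P v → v < inp.m ∧ A₀ v ∧ ∃ a < inp.n, a < NP ∧ X a ∧ rk a v < L
  private_unique : ∀ a < inp.n, X a → ∀ v v', P v → P v' → rk a v < e → rk a v' < e → v = v'
  shared_hits : L < e → ∀ a < NS, X a → ∃ v < inp.m, S v ∧ rk a v < e
  private_hits : (L < e ∨ inp.k < L + L) → ∀ a < NP, X a → ∃ v < inp.m, P v ∧ rk a v < L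

/-- A common server gives an edge between the two clients and a loop at the first, that is, a walk
of two hops. -/
lemma Separated.eq_of_common (h : Separated inp rk e X) {a a' v : ℕ} (ha : a < inp.n) (hX : X a)
    (ha' : a' < inp.n) (hX' : X a') (hv : v < inp.m) (h1 : rk a v < e) (h2 : rk a' v < e) :
    a = a' := by
  by_contra hne
  exact h a ha hX a' ha' hX' hne ⟨a, ha, ⟨v, hv, h1, h1⟩, ⟨v, hv, h1, h2⟩⟩

namespace Round

lemma start : Round inp rk L e X A₀ 0 0 A₀ (fun _ => False) (fun _ => False) where
  avail := by simp
  disj := by simp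
  of_shared := by simp
  of_private := by simp
  private_unique := by simp
  shared_hits := by simp
  private_hits := by simp

/-- All servers moved so far in this round lie in neighbourhoods of other net points, which are
disjoint from that of `a`. So the order in which a round treats the net points is irrelevant, and
`IsLast` can refer to the state at its start. -/
lemma avail_iff (h : Round inp rk L e X A₀ NS NP A S P) (hX : Separated inp rk e X) (hL : L ≤ e)
    {a v : ℕ} (ha : a < inp.n) (hXa : X a) (hS : NS ≤ a) (hP : NP ≤ a) (hv : v < inp.m)
    (hr : rk a v < e) : A v ↔ A₀ v := by
  rw [h.avail]
  refine ⟨fun h' => h'.1, fun h' => ⟨h', fun hs => ?_, fun hp => ?_⟩⟩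
  · obtain ⟨a', ha', hlt, hXa', hl⟩ := h.of_shared v hs
    have := hX.eq_of_common ha hXa ha' hXa' hv hr hl.2.2.1
    omega
  · obtain ⟨-, -, a', ha', hlt, hXa', hl⟩ := h.of_private v hp
    have := hX.eq_of_common ha hXa ha' hXa' hv hr (hl.trans_le hL)
    omega

lemma skipShared (h : Round inp rk L e X A₀ NS NP A S P) (hs : ¬ L < e ∨ ¬ X NS) :
    Round inp rk L e X A₀ (NS + 1) NP A S P where
  avail := h.avail
  disj := h.disj
  of_shared v hv := by
    obtain ⟨a, ha, hlt, h'⟩ := h.of_shared v hv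
    exact ⟨a, ha, by omega, h'⟩
  of_private := h.of_private
  private_unique := h.private_unique
  shared_hits hL a ha hXa := by
    rcases Nat.lt_succ_iff_lt_or_eq.1 ha with ha | rfl
    · exact h.shared_hits hL a ha hXa
    · tauto
  private_hits := h.private_hits

lemma skipPrivate (h : Round inp rk L e X A₀ NS NP A S P)
    (hs : ¬ (L < e ∨ inp.k < L + L) ∨ ¬ X NP) : Round inp rk L e X A₀ NS (NP + 1) A S P where
  avail := h.avail
  disj := h.disj
  of_shared := h.of_shared
  of_private v hv := by
    obtain ⟨hv, hA, a, ha, hlt, h'⟩ := h.of_private v hv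
    exact ⟨hv, hA, a, ha, by omega, h'⟩
  private_unique := h.private_unique
  shared_hits := h.shared_hits
  private_hits hL a ha hXa := by
    rcases Nat.lt_succ_iff_lt_or_eq.1 ha with ha | rfl
    · exact h.private_hits hL a ha hXa
    · tauto

lemma addShared (h : Round inp rk L e X A₀ NS NP A S P) {v : ℕ} (hn : NS < inp.n) (hXa : X NS)
    (hA : A v) (hv : IsLast inp rk e A₀ NS v) :
    Round inp rk L e X A₀ (NS + 1) NP (fun w => A w ∧ w ≠ v) (fun w => S w ∨ w = v) P where
  avail w := by rw [h.avail]; tauto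
  disj w hw := by
    rcases hw with hw | rfl
    · exact h.disj w hw
    · exact ((h.avail w).1 hA).2.2
  of_shared w hw := by
    rcases hw with hw | rfl
    · obtain ⟨a, ha, hlt, h'⟩ := h.of_shared w hw
      exact ⟨a, ha, by omega, h'⟩
    · exact ⟨NS, hn, by omega, hXa, hv⟩
  of_private := h.of_private
  private_unique := h.private_unique
  shared_hits hL a ha hXa := by
    rcases Nat.lt_succ_iff_lt_or_eq.1 ha with ha | rfl
    · obtain ⟨w, hw, h1, h2⟩ := h.shared_hits hL a ha hXa
      exact ⟨w, hw, Or.inl h1, h2⟩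
    · exact ⟨v, hv.1, Or.inr rfl, hv.2.2.1⟩
  private_hits := h.private_hits

lemma addPrivate (h : Round inp rk L e X A₀ NS NP A S P) (hsep : Separated inp rk e X)
    (hL : L ≤ e) {v : ℕ} (hn : NP < inp.n) (hXa : X NP)
    (hA : A v) (hv : v < inp.m) (hr : rk NP v < L) :
    Round inp rk L e X A₀ NS (NP + 1) (fun w => A w ∧ w ≠ v) S (fun w => P w ∨ w = v) where
  avail w := by rw [h.avail]; tauto
  disj w hw := by
    rintro (hw' | rfl)
    · exact h.disj w hw hw'
    · exact ((h.avail w).1 hA).2.1 hw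
  of_shared := h.of_shared
  of_private w hw := by
    rcases hw with hw | rfl
    · obtain ⟨hw, hA, a, ha, hlt, h'⟩ := h.of_private w hw
      exact ⟨hw, hA, a, ha, by omega, h'⟩
    · exact ⟨hv, ((h.avail w).1 hA).1, NP, hn, by omega, hXa, hr⟩
  private_unique a ha hXa' w w' hw hw' hr1 hr2 := by
    -- An older private server and the new one `v` belong to different net points, so a single net
    -- point cannot have both nearby.
    have key : ∀ u, P u → rk a u < e → rk a v < e → False := by
      intro u hu h1 h2
      obtain ⟨hum, -, a', ha', hlt, hXa'', h'⟩ := h.of_private u hu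
      have e1 := hsep.eq_of_common ha hXa' ha' hXa'' hum h1 (h'.trans_le hL)
      have e2 := hsep.eq_of_common ha hXa' hn hXa hv h2 (hr.trans_le hL)
      omega
    rcases hw with hw | rfl <;> rcases hw' with hw' | rfl
    · exact h.private_unique a ha hXa' w w' hw hw' hr1 hr2
    · exact (key w hw hr1 hr2).elim
    · exact (key w' hw' hr2 hr1).elim
    · rfl
  shared_hits := h.shared_hits
  private_hits hL a ha hXa := by
    rcases Nat.lt_succ_iff_lt_or_eq.1 ha with ha | rfl
    · obtain ⟨w, hw, h1, h2⟩ := h.private_hits hL a ha hXa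
      exact ⟨w, hw, Or.inl h1, h2⟩
    · exact ⟨v, hv, Or.inr rfl, hr⟩

end Round

open scoped Classical in
/-- The available servers among the `e` closest ones of `a`. -/
noncomputable def availNear (inp : Input) (rk : ℕ → ℕ → ℕ) (A : ℕ → Prop) (e a : ℕ) : Finset ℕ :=
  {v ∈ Finset.range inp.m | A v ∧ rk a v < e}

lemma mem_availNear {a v : ℕ} :
    v ∈ availNear inp rk A e a ↔ v < inp.m ∧ A v ∧ rk a v < e := by
  simp [availNear]

/-- The sets `Sh e` and `Pr e` have been extracted for the `N` largest values of `e`. -/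
structure Extracted (inp : Input) (rk : ℕ → ℕ → ℕ) (L : ℕ) (X : ℕ → ℕ → Prop) (N : ℕ)
    (A : ℕ → Prop) (Sh Pr : ℕ → ℕ → Prop) : Prop where
  shared_lt : ∀ e v, Sh e v → v < inp.m ∧ ¬ A v ∧ inp.k < e + N
  private_lt : ∀ e v, Pr e v → v < inp.m ∧ ¬ A v ∧ inp.k < e + N
  shared_disj : ∀ e e' v, Sh e v → Sh e' v → e = e'
  private_disj : ∀ e e' v, Pr e v → Pr e' v → e = e'
  shared_private : ∀ e e' v, Sh e v → ¬ Pr e' v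
  shared_hits : ∀ e ≤ inp.k, inp.k < e + N → L < e → ∀ a < inp.n, X e a →
    ∃ v < inp.m, Sh e v ∧ rk a v < e
  private_hits : ∀ e ≤ inp.k, inp.k < e + N → L ≤ e → (L < e ∨ inp.k < L + L) →
    ∀ a < inp.n, X e a → ∃ v < inp.m, Pr e v ∧ rk a v < L
  count : ∀ e, L ≤ e → e + N ≤ inp.k → ∀ a < inp.n, X e a →
    e ≤ N + (availNear inp rk A e a).card

/-! ### The counting argument. -/

namespace Extracted

variable {Xs : ℕ → ℕ → Prop} {N : ℕ} {Sh Pr : ℕ → ℕ → Prop}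

lemma exists_last (h : Extracted inp rk L Xs N A Sh Pr) (hk : inp.k ≤ L + L)
    (he : N + e = inp.k) (hL : L < e) {a : ℕ} (ha : a < inp.n) (hX : Xs e a) :
    ∃ v < inp.m, A v ∧ rk a v < e := by
  have := h.count e hL.le (by omega) a ha hX
  obtain ⟨v, hv⟩ := Finset.card_pos.1 (show 0 < (availNear inp rk A e a).card by omega)
  exact ⟨v, mem_availNear.1 hv⟩

/-- At a level `e > L`, at least `e - N = 2 * e - k ≥ 2` servers are available. If the last one `v`
is among the `L` closest, so are all of them, and one besides `v` is left. Otherwise `v` is no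
obstacle, and the count at level `L` gives `L - N ≥ 1`. -/
lemma exists_private (h : Extracted inp rk L Xs N A Sh Pr) (hk : inp.k ≤ L + L)
    (he : N + e = inp.k) (hL : L < e) {a : ℕ} (ha : a < inp.n) (hX : Xs e a) (hXL : Xs L a)
    {v : ℕ} (hv : IsLast inp rk e A a v) :
    ∃ w < inp.m, A w ∧ rk a w < L ∧ w ≠ v := by
  by_cases hvL : rk a v < L
  · have := h.count e hL.le (by omega) a ha hX
    obtain ⟨w, hw, hne⟩ := Finset.exists_mem_ne
      (show 1 < (availNear inp rk A e a).card by omega) v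
    obtain ⟨hwm, hA, hr⟩ := mem_availNear.1 hw
    exact ⟨w, hwm, hA, (hv.2.2.2 w hwm hA hr).trans_lt hvL, hne⟩
  · have := h.count L le_rfl (by omega) a ha hXL
    obtain ⟨w, hw⟩ := Finset.card_pos.1 (show 0 < (availNear inp rk A L a).card by omega)
    obtain ⟨hwm, hA, hr⟩ := mem_availNear.1 hw
    exact ⟨w, hwm, hA, hr, by rintro rfl; exact hvL hr⟩

lemma exists_private_of_odd (h : Extracted inp rk L Xs N A Sh Pr) (hk : inp.k < L + L)
    (he : N + L = inp.k) {a : ℕ} (ha : a < inp.n) (hX : Xs L a) :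
    ∃ w < inp.m, A w ∧ rk a w < L := by
  have := h.count L le_rfl (by omega) a ha hX
  obtain ⟨v, hv⟩ := Finset.card_pos.1 (show 0 < (availNear inp rk A L a).card by omega)
  exact ⟨v, mem_availNear.1 hv⟩

variable {A' S' P' : ℕ → Prop} {Sh' Pr' : ℕ → ℕ → Prop}

/-- An upper bound for the number of available servers that get lost. -/
lemma card_availNear_le {e' a d : ℕ} {T : Finset ℕ}
    (h : ∀ v ∈ availNear inp rk A e a, v ∈ availNear inp rk A' e' a ∨ v ∈ T) (hT : T.card ≤ d) :
    (availNear inp rk A e a).card ≤ (availNear inp rk A' e' a).card + d := by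
  refine (Finset.card_le_card (t := availNear inp rk A' e' a ∪ T) fun v hv => ?_).trans
    ((Finset.card_union_le _ _).trans (by omega))
  exact Finset.mem_union.2 (h v hv)

/-- The allowance `N` grows by one while a client may lose two servers. Two losses occur only if the
client is in the net of level `e` and its shared server is among its `e'` closest ones; as this
server was the last available one, the count can be taken from level `e ≥ e' + 1` instead. -/
lemma count_step (h : Extracted inp rk L Xs N A Sh Pr)
    (hR : Round inp rk L e (Xs e) A inp.n inp.n A' S' P') (he : N + e = inp.k)
    (hinj : ∀ a < inp.n, ∀ v < inp.m, ∀ v' < inp.m, rk a v = rk a v' → v = v')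
    (hsep : ∀ e', L ≤ e' → e' ≤ e → Separated inp rk e' (Xs e'))
    (hsub : ∀ e', L ≤ e' → e' ≤ e → ∀ a < inp.n, Xs e a → Xs e' a)
    {e' : ℕ} (hL : L ≤ e') (he' : e' + (N + 1) ≤ inp.k) {a : ℕ} (ha : a < inp.n) (hX : Xs e' a) :
    e' ≤ N + 1 + (availNear inp rk A' e' a).card := by
  classical
  have hLe : L ≤ e := by omega
  have hlast : ∀ b v w, b < inp.n → IsLast inp rk e A b v → IsLast inp rk e A b w → v = w :=
    fun b v w hb hv hw => hinj b hb v hv.1 w hw.1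
      (le_antisymm (hw.2.2.2 v hv.1 hv.2.1 hv.2.2.1) (hv.2.2.2 w hw.1 hw.2.1 hw.2.2.1))
  by_cases hXe : Xs e a
  · have hS : ∀ v < inp.m, S' v → rk a v < e → IsLast inp rk e A a v := by
      intro v hv hS hr
      obtain ⟨b, hb, -, hXb, hl⟩ := hR.of_shared v hS
      rwa [(hsep e hLe le_rfl).eq_of_common ha hXe hb hXb hv hr hl.2.2.1]
    have hP : (availNear inp rk P' e a).card ≤ 1 := by
      rw [Finset.card_le_one]
      intro v hv w hw
      rw [mem_availNear] at hv hw
      exact hR.private_unique a ha hXe v w hv.2.1 hw.2.1 hv.2.2 hw.2.2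
    by_cases hex : ∃ v < inp.m, S' v ∧ rk a v < e'
    · obtain ⟨v, hv, hSv, hr⟩ := hex
      have hl := hS v hv hSv (by omega)
      have hc := h.count e hLe (by omega) a ha hXe
      have := card_availNear_le (inp := inp) (rk := rk) (A := A) (A' := A') (e := e) (e' := e')
        (a := a) (T := insert v (availNear inp rk P' e a)) (d := 2) (fun w hw => ?_)
        ((Finset.card_insert_le _ _).trans (by omega))
      · omega
      · rw [mem_availNear] at hw
        have hwe : rk a w < e' := (hl.2.2.2 w hw.1 hw.2.1 hw.2.2).trans_lt hr
        by_cases hSw : S' w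
        · rw [hlast a w v ha (hS w hw.1 hSw hw.2.2) hl]
          simp
        · by_cases hPw : P' w
          · right
            simp only [Finset.mem_insert, mem_availNear]
            exact Or.inr ⟨hw.1, hPw, hw.2.2⟩
          · left
            exact mem_availNear.2 ⟨hw.1, (hR.avail w).2 ⟨hw.2.1, hSw, hPw⟩, hwe⟩
    -- The shared server lies outside the smaller neighbourhood, so only the private one is lost.
    · have hc := h.count e' hL (by omega) a ha hX
      have := card_availNear_le (inp := inp) (rk := rk) (A := A) (A' := A') (e := e') (e' := e')
        (a := a) (T := availNear inp rk P' e a) (d := 1) (fun w hw => ?_) hP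
      · omega
      · rw [mem_availNear] at hw
        by_cases hPw : P' w
        · exact Or.inr (mem_availNear.2 ⟨hw.1, hPw, by omega⟩)
        · exact Or.inl (mem_availNear.2 ⟨hw.1, (hR.avail w).2
            ⟨hw.2.1, fun hSw => hex ⟨w, hw.1, hSw, hw.2.2⟩, hPw⟩, hw.2.2⟩)
  -- Two shared servers near `a` would belong to two net points joined by a walk through `a`.
  · have hS : (availNear inp rk S' e' a).card ≤ 1 := by
      rw [Finset.card_le_one]
      intro v hv w hw
      rw [mem_availNear] at hv hw
      obtain ⟨b, hb, -, hXb, hlb⟩ := hR.of_shared v hv.2.1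
      obtain ⟨b', hb', -, hXb', hlb'⟩ := hR.of_shared w hw.2.1
      by_cases hbb : b = b'
      · subst hbb
        exact hlast b v w hb hlb hlb'
      · exact (hsep e hLe le_rfl b hb hXb b' hb' hXb' hbb ⟨a, ha,
          ⟨v, hv.1, hlb.2.2.1, by omega⟩, ⟨w, hw.1, by omega, hlb'.2.2.1⟩⟩).elim
    -- Private servers are among the `L ≤ e'` closest ones of a point of `Xs e`, which is also a
    -- point of `Xs e'`. One near `a` would force `a` to be that point.
    have hP : ∀ v < inp.m, rk a v < e' → ¬ P' v := by
      intro v hv hr hPv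
      obtain ⟨-, -, b, hb, -, hXb, hrb⟩ := hR.of_private v hPv
      have := (hsep e' hL (by omega)).eq_of_common ha hX hb (hsub e' hL (by omega) b hb hXb) hv hr
        (by omega)
      exact hXe (this ▸ hXb)
    have hc := h.count e' hL (by omega) a ha hX
    have := card_availNear_le (inp := inp) (rk := rk) (A := A) (A' := A') (e := e') (e' := e')
      (a := a) (T := availNear inp rk S' e' a) (d := 1) (fun w hw => ?_) hS
    · omega
    · rw [mem_availNear] at hw
      by_cases hSw : S' w
      · exact Or.inr (mem_availNear.2 ⟨hw.1, hSw, hw.2.2⟩)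
      · exact Or.inl (mem_availNear.2 ⟨hw.1, (hR.avail w).2
          ⟨hw.2.1, hSw, hP w hw.1 hw.2.2⟩, hw.2.2⟩)

/-- Disjointness holds because the new sets are taken from `A`, while all old sets lie outside `A`.
-/
lemma step (h : Extracted inp rk L Xs N A Sh Pr)
    (hR : Round inp rk L e (Xs e) A inp.n inp.n A' (Sh' e) (Pr' e)) (he : N + e = inp.k)
    (hLe : L ≤ e)
    (hinj : ∀ a < inp.n, ∀ v < inp.m, ∀ v' < inp.m, rk a v = rk a v' → v = v')
    (hsep : ∀ e', L ≤ e' → e' ≤ e → Separated inp rk e' (Xs e'))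
    (hsub : ∀ e', L ≤ e' → e' ≤ e → ∀ a < inp.n, Xs e a → Xs e' a)
    (hSh : ∀ e', e' ≠ e → Sh' e' = Sh e') (hPr : ∀ e', e' ≠ e → Pr' e' = Pr e') :
    Extracted inp rk L Xs (N + 1) A' Sh' Pr' := by
  have hS : ∀ v, Sh' e v → A v := fun v hv => by
    obtain ⟨a, -, -, -, hl⟩ := hR.of_shared v hv
    exact hl.2.1
  have hP : ∀ v, Pr' e v → A v := fun v hv => (hR.of_private v hv).2.1
  have hA : ∀ v, ¬ A v → ¬ A' v := fun v hv hv' => hv ((hR.avail v).1 hv').1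
  refine ⟨fun e' v hv => ?_, fun e' v hv => ?_, fun e₁ e₂ v h1 h2 => ?_, fun e₁ e₂ v h1 h2 => ?_,
    fun e₁ e₂ v h1 h2 => ?_, fun e' hk hN hL a ha hX => ?_, fun e' hk hN hL hL' a ha hX => ?_,
    fun e' hL hN a ha hX => h.count_step hR he hinj hsep hsub hL hN ha hX⟩
  · by_cases hee : e' = e
    · subst hee
      obtain ⟨a, -, -, -, hl⟩ := hR.of_shared v hv
      exact ⟨hl.1, fun hA' => ((hR.avail v).1 hA').2.1 hv, by omega⟩
    · rw [hSh e' hee] at hv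
      obtain ⟨h1, h2, h3⟩ := h.shared_lt e' v hv
      exact ⟨h1, hA v h2, by omega⟩
  · by_cases hee : e' = e
    · subst hee
      exact ⟨(hR.of_private v hv).1, fun hA' => ((hR.avail v).1 hA').2.2 hv, by omega⟩
    · rw [hPr e' hee] at hv
      obtain ⟨h1, h2, h3⟩ := h.private_lt e' v hv
      exact ⟨h1, hA v h2, by omega⟩
  · by_cases he1 : e₁ = e <;> by_cases he2 : e₂ = e
    · rw [he1, he2]
    · subst he1
      rw [hSh e₂ he2] at h2
      exact absurd (hS v h1) (h.shared_lt e₂ v h2).2.1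
    · subst he2
      rw [hSh e₁ he1] at h1
      exact absurd (hS v h2) (h.shared_lt e₁ v h1).2.1
    · rw [hSh e₁ he1] at h1
      rw [hSh e₂ he2] at h2
      exact h.shared_disj e₁ e₂ v h1 h2
  · by_cases he1 : e₁ = e <;> by_cases he2 : e₂ = e
    · rw [he1, he2]
    · subst he1
      rw [hPr e₂ he2] at h2
      exact absurd (hP v h1) (h.private_lt e₂ v h2).2.1
    · subst he2
      rw [hPr e₁ he1] at h1
      exact absurd (hP v h2) (h.private_lt e₁ v h1).2.1
    · rw [hPr e₁ he1] at h1
      rw [hPr e₂ he2] at h2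
      exact h.private_disj e₁ e₂ v h1 h2
  · by_cases he1 : e₁ = e <;> by_cases he2 : e₂ = e
    · subst he1
      rw [he2] at h2
      exact hR.disj v h1 h2
    · subst he1
      rw [hPr e₂ he2] at h2
      exact absurd (hS v h1) (h.private_lt e₂ v h2).2.1
    · subst he2
      rw [hSh e₁ he1] at h1
      exact absurd (hP v h2) (h.shared_lt e₁ v h1).2.1
    · rw [hSh e₁ he1] at h1
      rw [hPr e₂ he2] at h2
      exact h.shared_private e₁ e₂ v h1 h2
  · by_cases hee : e' = e
    · subst hee
      exact hR.shared_hits hL a ha hX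
    · rw [hSh e' hee]
      exact h.shared_hits e' hk (by omega) hL a ha hX
  · by_cases hee : e' = e
    · subst hee
      exact hR.private_hits hL' a ha hX
    · rw [hPr e' hee]
      exact h.private_hits e' hk (by omega) hL hL' a ha hX

end Extracted

end Alg
end MMC

/-! ### The program that extracts the server sets. -/

namespace MMC
namespace Alg

variable {q : Polynomial ℕ} {B : ℕ} {inp : Input} {s : State} {L e a : ℕ}

/-- The scan runs from near to far and overwrites `ys`, so its final value is the last available
server. -/
lemma chooseShared_spec (hm : inp.m ≤ B) (he : e ≤ inp.m) (hi : s.nat i 0 0 = e)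
    (hc : s.nat c 0 0 = a) (hsort : SortedRow inp a (s.nat near a) (s.nat rank a))
    (hex : ∃ v < inp.m, s.nat avail 0 v = 1 ∧ s.nat rank a v < e) :
    Spec q B inp chooseShared s fun s' => ∃ v,
      IsLast inp (s.nat rank) e (fun w => s.nat avail 0 w = 1) a v ∧
      s'.nat shared = (s.setNat shared e v 1).nat shared ∧
      s'.nat avail = (s.setNat avail 0 v 0).nat avail := by
  refine Spec.seq (Spec.nset ?_)
  refine Spec.seq (Spec.loop (fun N s' =>
    (s'.nat found 0 0 = 0 ∧ ∀ b < N, s.nat avail 0 (s.nat near a b) ≠ 1) ∨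
    (s'.nat found 0 0 = 1 ∧ ∃ b < N, s'.nat ys 0 0 = s.nat near a b ∧
      s.nat avail 0 (s.nat near a b) = 1 ∧
      ∀ b' < N, s.nat avail 0 (s.nat near a b') = 1 → b' ≤ b)) ?_ ?_ ?_ ?_)
  · simp +decide [hi]; omega
  · simp +decide
  · intro N hN s' hU hI
    have hn : s'.nat near = s.nat near := by
      rw [hU.nat near (by decide), State.setNat_nat_of_ne _ (by decide)]
    have ha : s'.nat avail = s.nat avail := by
      rw [hU.nat avail (by decide), State.setNat_nat_of_ne _ (by decide)]
    have hc' : s'.nat c 0 0 = a := by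
      rw [hU.nat c (by decide), State.setNat_nat_of_ne _ (by decide), hc]
    refine Spec.when (fun hh => Spec.seq (Spec.nset (Spec.nset ?_))) (fun hh => ?_)
    · simp +decide [hn, ha, hc'] at hh ⊢
      exact ⟨N, le_rfl, rfl, hh, fun b hb _ => hb⟩
    · simp +decide [hn, ha, hc'] at hh ⊢
      rcases hI with ⟨h1, h2⟩ | ⟨h1, b, hb, h2, h3, h4⟩
      · refine Or.inl ⟨h1, fun b hb => ?_⟩
        rcases hb.lt_or_eq with hb | rfl
        exacts [h2 b hb, hh]
      · refine Or.inr ⟨h1, b, hb.le, h2, h3, fun b' hb' hab => ?_⟩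
        rcases hb'.lt_or_eq with hb' | rfl
        exacts [h4 b' hb' hab, absurd hab hh]
  · intro s' hU hI
    simp +decide [hi] at hI
    have hi' : s'.nat i 0 0 = e := by
      rw [hU.nat i (by decide), State.setNat_nat_of_ne _ (by decide), hi]
    have ha : s'.nat avail = s.nat avail := by
      rw [hU.nat avail (by decide), State.setNat_nat_of_ne _ (by decide)]
    have hs : s'.nat shared = s.nat shared := by
      rw [hU.nat shared (by decide), State.setNat_nat_of_ne _ (by decide)]
    rcases hI with ⟨h1, h2⟩ | ⟨h1, b, hb, h2, h3, h4⟩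
    · obtain ⟨v, hv, hva, hvr⟩ := hex
      have := h2 _ hvr
      rw [hsort.near_rank v hv] at this
      exact absurd hva this
    · refine Spec.when (fun _ => Spec.seq (Spec.nset (Spec.nset ?_))) (fun hh => ?_)
      · refine ⟨s.nat near a b, ⟨hsort.near_lt b (by omega), h3, ?_, fun v hv hva hvr => ?_⟩, ?_, ?_⟩
        · rwa [hsort.rank_near b (by omega)]
        · rw [hsort.rank_near b (by omega)]
          exact h4 _ hvr (by rwa [hsort.near_rank v hv])
        · funext x w
          simp +decide [hi', hs, h2]
        · funext x w
          simp +decide [ha, h2]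
      · simp [h1] at hh

lemma choosePrivate_spec (hm : inp.m ≤ B) (hL : L ≤ inp.m) (hl : s.nat l 0 0 = L)
    (hi : s.nat i 0 0 = e) (hc : s.nat c 0 0 = a)
    (hsort : SortedRow inp a (s.nat near a) (s.nat rank a))
    (hex : ∃ v < inp.m, s.nat avail 0 v = 1 ∧ s.nat rank a v < L) :
    Spec q B inp choosePrivate s fun s' => ∃ v < inp.m, s.nat avail 0 v = 1 ∧
      s.nat rank a v < L ∧
      s'.nat priv = (s.setNat priv e v 1).nat priv ∧
      s'.nat avail = (s.setNat avail 0 v 0).nat avail := by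
  refine Spec.pick (by simp [hl]; omega) (fun t ht hh => ?_) (fun hh => ?_)
  · simp +decide [hl, hc] at ht hh
    refine Spec.seq (Spec.nset (Spec.nset ?_))
    refine ⟨s.nat near a t, hsort.near_lt t (by omega), hh, ?_, ?_, ?_⟩
    · rwa [hsort.rank_near t (by omega)]
    · funext x w
      simp +decide [hi, hc]
    · funext x w
      simp +decide [hc]
  · obtain ⟨v, hv, hva, hvr⟩ := hex
    have := hh (s.nat rank a v) (by simpa [hl] using hvr)
    simp +decide [hc, hsort.near_rank v hv, hva] at this

/-- The state of the extraction of the server subsets. -/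
structure SubsetsInv (inp : Input) (L N : ℕ) (s : State) : Prop where
  extracted : Extracted inp (s.nat rank) L (fun e a => s.nat net e a = 1) N
    (fun v => s.nat avail 0 v = 1) (fun e v => s.nat shared e v = 1) (fun e v => s.nat priv e v = 1)
  shared_le : ∀ e v, s.nat shared e v ≤ 1
  priv_le : ∀ e v, s.nat priv e v ≤ 1

def NetsOK (inp : Input) (L : ℕ) (rk : ℕ → ℕ → ℕ) (X : ℕ → ℕ → ℕ) : Prop :=
  ∀ e, L ≤ e → e ≤ inp.k → IsNet inp rk e (fun a => X e a = 1) ∧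
    (e < inp.k → ∀ a < inp.n, X (e + 1) a = 1 → X e a = 1)

lemma NetsOK.sub {rk X : ℕ → ℕ → ℕ} (h : NetsOK inp L rk X) {e e' : ℕ} (hL : L ≤ e')
    (hle : e' ≤ e) (hk : e ≤ inp.k) {a : ℕ} (ha : a < inp.n) (hX : X e a = 1) : X e' a = 1 := by
  induction e, hle using Nat.le_induction with
  | base => exact hX
  | succ e hle ih => exact ih (by omega) ((h e (by omega) (by omega)).2 (by omega) a ha hX)

/-- The part of `computeServerSubsets` that is executed for a fixed `i`. -/
def chooseServers : Cmd :=
  .loop c .n (when (on net (val i) (val c))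
      (block [
        when aboveL chooseShared,
        when aboveLOrOdd choosePrivate]))

lemma chooseServers_spec {N : ℕ} (hn : inp.n ≤ B) (hm : inp.m ≤ B) (hk : inp.k ≤ inp.m)
    (hkL : inp.k ≤ L + L) (hLe : L ≤ e) (hNe : N + e = inp.k) (hl : s.nat l 0 0 = L)
    (hi : s.nat i 0 0 = e)
    (hsort : ∀ a < inp.n, SortedRow inp a (s.nat near a) (s.nat rank a))
    (hnet : NetsOK inp L (s.nat rank) (s.nat net)) (hs : SubsetsInv inp L N s) :
    Spec q B inp chooseServers s (SubsetsInv inp L (N + 1)) := by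
  have hinj : ∀ a < inp.n, ∀ v < inp.m, ∀ v' < inp.m,
      s.nat rank a v = s.nat rank a v' → v = v' := fun a ha v hv v' hv' heq => by
    rw [← (hsort a ha).near_rank v hv, heq, (hsort a ha).near_rank v' hv']
  have hsep := (hnet e hLe (by omega)).1.separated
  refine Spec.loop (fun M s' =>
    Round inp (s.nat rank) L e (fun a => s.nat net e a = 1) (fun v => s.nat avail 0 v = 1) M M
      (fun v => s'.nat avail 0 v = 1) (fun v => s'.nat shared e v = 1)
      (fun v => s'.nat priv e v = 1) ∧
    (∀ e', e' ≠ e → s'.nat shared e' = s.nat shared e') ∧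
    (∀ e', e' ≠ e → s'.nat priv e' = s.nat priv e') ∧
    (∀ e v, s'.nat shared e v ≤ 1) ∧ (∀ e v, s'.nat priv e v ≤ 1)) hn ?_ ?_ ?_
  · refine ⟨?_, fun _ _ => rfl, fun _ _ => rfl, hs.shared_le, hs.priv_le⟩
    have h1 : ∀ v, s.nat shared e v ≠ 1 := fun v hv => by
      have := (hs.extracted.shared_lt e v hv).2.2
      omega
    have h2 : ∀ v, s.nat priv e v ≠ 1 := fun v hv => by
      have := (hs.extracted.private_lt e v hv).2.2
      omega
    simp only [h1, h2]
    exact Round.start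
  · rintro a ha s₁ hU ⟨hR, hsh, hpr, hsh1, hpr1⟩
    simp only [NExp.eval] at ha
    have e₁ : s₁.nat near = s.nat near := hU.nat near (by decide)
    have e₂ : s₁.nat rank = s.nat rank := hU.nat rank (by decide)
    have e₃ : s₁.nat net = s.nat net := hU.nat net (by decide)
    have e₄ : s₁.nat i 0 0 = e := by rw [hU.nat i (by decide), hi]
    have e₅ : s₁.nat l 0 0 = L := by rw [hU.nat l (by decide), hl]
    refine Spec.when (fun hX => ?_) (fun hX => ?_)
    · simp +decide [e₃, e₄] at hX
      -- Between the two moves, the last clause keeps what the second one needs: an available server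
      -- among the `L` closest, whenever a private server is to be taken.
      let Mid : State → Prop := fun s' =>
        Round inp (s.nat rank) L e (fun a => s.nat net e a = 1) (fun v => s.nat avail 0 v = 1)
          (a + 1) a (fun v => s'.nat avail 0 v = 1) (fun v => s'.nat shared e v = 1)
          (fun v => s'.nat priv e v = 1) ∧
        (∀ e', e' ≠ e → s'.nat shared e' = s.nat shared e') ∧
        (∀ e', e' ≠ e → s'.nat priv e' = s.nat priv e') ∧
        (∀ e v, s'.nat shared e v ≤ 1) ∧ (∀ e v, s'.nat priv e v ≤ 1) ∧
        (L < e ∨ inp.k < L + L → ∃ v < inp.m, s'.nat avail 0 v = 1 ∧ s.nat rank a v < L)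
      have hav : ∀ v < inp.m, s.nat rank a v < e →
          (s₁.nat avail 0 v = 1 ↔ s.nat avail 0 v = 1) := fun v hv hr =>
        hR.avail_iff hsep hLe ha hX le_rfl le_rfl hv hr
      refine Spec.seq (Spec.conseq (Q' := Mid) (Spec.when (fun hL => ?_) (fun hL => ?_)) ?_)
      · simp +decide [aboveL, e₄, e₅] at hL
        have hXL : s.nat net L a = 1 := hnet.sub le_rfl hLe (by omega) ha hX
        obtain ⟨v, hv, hva, hvr⟩ := hs.extracted.exists_last hkL hNe hL ha hX
        refine (chooseShared_spec (e := e) (a := a) hm (by omega) ?_ ?_ ?_ ⟨v, hv, ?_, ?_⟩).conseq ?_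
        · simpa +decide using e₄
        · simp
        · simpa +decide [State.setNat_nat_of_ne, e₁, e₂] using hsort a ha
        · simpa +decide using (hav v hv hvr).2 hva
        · simpa +decide [e₂] using hvr
        · rintro s₂ hU₂ ⟨v, hv, h1, h2⟩
          simp +decide only [State.setNat_nat_of_ne, ne_eq, e₂] at hv
          have hl' : IsLast inp (s.nat rank) e (fun v => s.nat avail 0 v = 1) a v :=
            ⟨hv.1, (hav v hv.1 hv.2.2.1).1 hv.2.1, hv.2.2.1,
              fun w hw hwa hwr => hv.2.2.2 w hw ((hav w hw hwr).2 hwa) hwr⟩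
          have hav₂ : ∀ w, s₂.nat avail 0 w = 1 ↔ s₁.nat avail 0 w = 1 ∧ w ≠ v := by
            intro w
            rw [h2]
            by_cases hw : w = v <;> simp +decide [hw]
          have hsh₂ : ∀ w, s₂.nat shared e w = 1 ↔ s₁.nat shared e w = 1 ∨ w = v := by
            intro w
            rw [h1]
            by_cases hw : w = v <;> simp +decide [hw]
          have hpr₂ : s₂.nat priv = s₁.nat priv := by
            rw [hU₂.nat priv (by decide), State.setNat_nat_of_ne _ (by decide)]
          refine ⟨?_, fun e' he' => ?_, by rwa [hpr₂], fun e' w => ?_, by rwa [hpr₂], fun _ => ?_⟩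
          · simp only [hav₂, hsh₂, hpr₂]
            exact hR.addShared ha hX hv.2.1 hl'
          · rw [h1, ← hsh e' he']
            funext w
            simp +decide [he']
          · rw [h1]
            simp +decide
            split_ifs
            exacts [le_rfl, hsh1 e' w]
          · obtain ⟨w, hw, hwa, hwr, hne⟩ :=
              hs.extracted.exists_private hkL hNe hL ha hX hXL hl'
            exact ⟨w, hw, (hav₂ w).2 ⟨(hav w hw (by omega)).2 hwa, hne⟩, hwr⟩
      · simp +decide [aboveL, e₄, e₅] at hL
        obtain rfl : e = L := le_antisymm hL hLe
        refine ⟨hR.skipShared (Or.inl (lt_irrefl _)), hsh, hpr, hsh1, hpr1, fun hodd => ?_⟩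
        obtain ⟨w, hw, hwa, hwr⟩ :=
          hs.extracted.exists_private_of_odd (by omega) hNe ha hX
        exact ⟨w, hw, (hav w hw hwr).2 hwa, hwr⟩
      · rintro s₂ hU₂ ⟨hR₂, hsh₂, hpr₂, hsh1₂, hpr1₂, hex⟩
        have f₁ : s₂.nat near = s.nat near := by
          rw [hU₂.nat near (by decide), State.setNat_nat_of_ne _ (by decide), e₁]
        have f₂ : s₂.nat rank = s.nat rank := by
          rw [hU₂.nat rank (by decide), State.setNat_nat_of_ne _ (by decide), e₂]
        have f₄ : s₂.nat i 0 0 = e := by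
          rw [hU₂.nat i (by decide), State.setNat_nat_of_ne _ (by decide), e₄]
        have f₅ : s₂.nat l 0 0 = L := by
          rw [hU₂.nat l (by decide), State.setNat_nat_of_ne _ (by decide), e₅]
        have f₆ : s₂.nat c 0 0 = a := by
          rw [hU₂.nat c (by decide)]; simp
        refine Spec.when (fun hL => ?_) (fun hL => ?_)
        · simp +decide [aboveL, aboveLOrOdd, f₄, f₅] at hL
          refine (choosePrivate_spec (L := L) (e := e) (a := a) hm (by omega) f₅ f₄ f₆ ?_ ?_).conseq ?_
          · rw [f₁, f₂]; exact hsort a ha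
          · rw [f₂]; exact hex hL
          · rintro s₃ hU₃ ⟨v, hv, hva, hvr, h1, h2⟩
            rw [f₂] at hvr
            have hav₃ : ∀ w, s₃.nat avail 0 w = 1 ↔ s₂.nat avail 0 w = 1 ∧ w ≠ v := by
              intro w
              rw [h2]
              by_cases hw : w = v <;> simp +decide [hw]
            have hpr₃ : ∀ w, s₃.nat priv e w = 1 ↔ s₂.nat priv e w = 1 ∨ w = v := by
              intro w
              rw [h1]
              by_cases hw : w = v <;> simp +decide [hw]
            have hsh₃ : s₃.nat shared = s₂.nat shared := hU₃.nat shared (by decide)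
            refine ⟨?_, by rwa [hsh₃], fun e' he' => ?_, by rwa [hsh₃], fun e' w => ?_⟩
            · simp only [hav₃, hsh₃, hpr₃]
              exact hR₂.addPrivate hsep hLe ha hX hva hv hvr
            · rw [h1, ← hpr₂ e' he']
              funext w
              simp +decide [he']
            · rw [h1]
              simp +decide
              split_ifs
              exacts [le_rfl, hpr1₂ e' w]
        · simp +decide only [BExp.Holds, aboveL, aboveLOrOdd, NExp.eval, val, zero, f₄, f₅] at hL
          exact ⟨hR₂.skipPrivate (Or.inl hL), hsh₂, hpr₂, hsh1₂, hpr1₂⟩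
    · simp +decide [e₃, e₄] at hX
      exact ⟨(hR.skipShared (Or.inr hX)).skipPrivate (Or.inr hX), hsh, hpr, hsh1, hpr1⟩
  · rintro s₁ hU ⟨hR, hsh, hpr, hsh1, hpr1⟩
    have e₂ : s₁.nat rank = s.nat rank := hU.nat rank (by decide)
    have e₃ : s₁.nat net = s.nat net := hU.nat net (by decide)
    refine ⟨?_, hsh1, hpr1⟩
    rw [e₂, e₃]
    refine hs.extracted.step hR hNe hLe hinj ?_ ?_ (fun e' he' => ?_) (fun e' he' => ?_)
    · exact fun e' hL' hle => (hnet e' hL' (by omega)).1.separated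
    · exact fun e' hL' hle a ha hX => hnet.sub hL' hle (by omega) ha hX
    · simp only [hsh e' he']
    · simp only [hpr e' he']

/-- Start of the count: before the first round, all of the `e` closest servers are available. -/
lemma card_rank_lt {nr rk : ℕ → ℕ} (h : SortedRow inp a nr rk) (he : e ≤ inp.m) (A : ℕ → Prop)
    (hA : ∀ v < inp.m, A v) : e ≤ (availNear inp (fun _ => rk) A e a).card := by
  have : (Finset.range e).image nr ⊆ availNear inp (fun _ => rk) A e a := by
    intro v hv
    simp only [Finset.mem_image, Finset.mem_range] at hv
    obtain ⟨b, hb, rfl⟩ := hv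
    have := h.near_lt b (by omega)
    exact mem_availNear.2 ⟨this, hA _ this, by rwa [h.rank_near b (by omega)]⟩
  refine le_trans ?_ (Finset.card_le_card this)
  rw [Finset.card_image_of_injOn, Finset.card_range]
  intro b hb b' hb' heq
  simp only [Finset.coe_range, Set.mem_Iio] at hb hb'
  rw [← h.rank_near b (by omega), ← h.rank_near b' (by omega), heq]

lemma computeServerSubsets_spec (hn : inp.n ≤ B) (hm : inp.m ≤ B) (hk1 : 1 ≤ inp.k)
    (hk : inp.k ≤ inp.m) (h0 : ∀ a, a ≠ z → s.nat a = 0) :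
    Spec q B inp computeServerSubsets s fun s' =>
      s'.nat l 0 0 = (inp.k + 1) / 2 ∧
      (∀ a < inp.n, SortedRow inp a (s'.nat near a) (s'.nat rank a)) ∧
      NetsOK inp ((inp.k + 1) / 2) (s'.nat rank) (s'.nat net) ∧
      SubsetsInv inp ((inp.k + 1) / 2) (inp.k + 1 - (inp.k + 1) / 2) s' := by
  refine Spec.seq (Spec.conseq (Q' := fun s' => ∀ v < inp.m, s'.nat avail 0 v = 1)
    (Spec.loop (fun N s' => ∀ v < N, s'.nat avail 0 v = 1) hm (by simp) ?_ fun _ _ h => h) ?_)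
  · intro N hN s' _ h
    refine Spec.nset ?_
    simp +decide
    exact fun v hv hne => h v (by omega)
  intro s₁ hU₁ hav₁
  refine Spec.seq (Spec.nset ?_)
  set L := (inp.k + 1) / 2 with hLdef
  have hs₂ : ∀ a, a ≠ l → a ≠ z → a ≠ avail →
      (s₁.setNat l 0 0 L).nat a = 0 := by
    intro a h1 h2 h3
    rw [State.setNat_nat_of_ne _ h1, hU₁.nat a, h0 a h2]
    simpa [Cmd.natWrites] using ⟨h2, h3⟩
  have hl₂ : (s₁.setNat l 0 0 L).nat l 0 0 = L := by simp
  have hav₂ : ∀ v < inp.m, (s₁.setNat l 0 0 L).nat avail 0 v = 1 := by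
    simpa +decide using hav₁
  change Spec q B inp _ (s₁.setNat l 0 0 L) _
  generalize s₁.setNat l 0 0 L = s₂ at *
  refine Spec.seq ((sortServers_spec hn hm (hs₂ _ (by decide) (by decide) (by decide))).conseq
    fun s₃ hU₃ hsort => ?_)
  have hl₃ : s₃.nat l 0 0 = L := by rw [hU₃.nat l (by decide), hl₂]
  refine Spec.seq ((computeNets_spec (L := L) hn hm (by omega) hl₃ (by omega) ?_ ?_).conseq
    fun s₄ hU₄ hnet => ?_)
  · rw [hU₃.nat net (by decide), hs₂ _ (by decide) (by decide) (by decide)]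
  · intro a ha
    have h1 := (hsort a ha).near_lt 0 (by omega)
    have h2 := (hsort a ha).rank_near 0 (by omega)
    exact ⟨_, h1, by omega, by omega⟩
  have hl₄ : s₄.nat l 0 0 = L := by rw [hU₄.nat l (by decide), hl₃]
  have hrk₄ : s₄.nat rank = s₃.nat rank := hU₄.nat rank (by decide)
  rw [← hrk₄, ← hU₄.nat near (by decide)] at hsort
  rw [← hrk₄] at hnet
  have hav₄ : ∀ v < inp.m, s₄.nat avail 0 v = 1 := by
    rw [hU₄.nat avail (by decide), hU₃.nat avail (by decide)]
    exact hav₂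
  have hsh₄ : s₄.nat shared = 0 := by
    rw [hU₄.nat _ (by decide), hU₃.nat _ (by decide), hs₂ _ (by decide) (by decide) (by decide)]
  have hpr₄ : s₄.nat priv = 0 := by
    rw [hU₄.nat _ (by decide), hU₃.nat _ (by decide), hs₂ _ (by decide) (by decide) (by decide)]
  refine downLoop_spec (L := L) (fun N s' => SubsetsInv inp L N s') hl₄ (by omega) (by omega)
    ?_ ?_ ?_ ?_
  · rintro N s' a v (rfl | rfl) ⟨h1, h2, h3⟩ <;>
      exact ⟨by simpa +decide [State.setNat_nat_of_ne] using h1,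
        by simpa +decide using h2, by simpa +decide using h3⟩
  · refine ⟨?_, by simp [hsh₄], by simp [hpr₄]⟩
    simp only [hsh₄, hpr₄]
    refine ⟨by simp, by simp, by simp, by simp, by simp, fun e he he' => by omega,
      fun e he he' => by omega, fun e hL he a ha _ => ?_⟩
    have := card_rank_lt (hsort a ha) (show e ≤ inp.m by omega) (fun v => s₄.nat avail 0 v = 1) hav₄
    rw [zero_add]
    exact this
  · rintro N e hN hLe s' hU hi hI
    refine chooseServers_spec (L := L) (e := e) hn hm hk (by omega) hLe hN ?_ hi ?_ ?_ hI
    · rw [hU.nat l (by decide), hl₄]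
    · rw [hU.nat near (by decide), hU.nat rank (by decide)]; exact hsort
    · rw [hU.nat net (by decide), hU.nat rank (by decide)]; exact hnet
  · intro s' hU hI
    refine ⟨by rw [hU.nat l (by decide), hl₄], ?_, ?_, hI⟩
    · rw [hU.nat near (by decide), hU.nat rank (by decide)]; exact hsort
    · rw [hU.nat net (by decide), hU.nat rank (by decide)]; exact hnet

end Alg
end MMC

namespace MMC

/-! ## Outer covers -/

section Outer

/-- A maximal set of pairwise unrelated elements, chosen in the order of decreasing radius. -/
lemma exists_greedy_subset {ι : Type*} [DecidableEq ι] (T : Finset ι) (R : ι → ℝ)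
    (sh : ι → ι → Prop) (hsh : ∀ b b', sh b b' → sh b' b) :
    ∃ D ⊆ T, (∀ b ∈ D, ∀ b' ∈ D, b ≠ b' → ¬ sh b b') ∧
      ∀ b ∈ T, b ∈ D ∨ ∃ b' ∈ D, sh b' b ∧ R b ≤ R b' := by
  -- The element added last has the smallest radius, so whatever blocks it is at least as large.
  induction T using Finset.induction_on_min_value R with
  | empty => exact ⟨∅, by simp, by simp, by simp⟩
  | insert a T ha hmin ih =>
    obtain ⟨D, hDT, hD, hdom⟩ := ih
    by_cases hex : ∃ b' ∈ D, sh b' a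
    · refine ⟨D, hDT.trans (Finset.subset_insert _ _), hD, fun b hb => ?_⟩
      rcases Finset.mem_insert.1 hb with rfl | hb
      · obtain ⟨b', hb', h⟩ := hex
        exact Or.inr ⟨b', hb', h, hmin b' (hDT hb')⟩
      · exact hdom b hb
    · push Not at hex
      refine ⟨insert a D, Finset.insert_subset_insert _ hDT, fun b hb b' hb' hne => ?_,
        fun b hb => ?_⟩
      · rcases Finset.mem_insert.1 hb with rfl | h1 <;>
          rcases Finset.mem_insert.1 hb' with rfl | h2
        · exact absurd rfl hne
        · exact fun h => hex b' h2 (hsh _ _ h)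
        · exact hex b h1
        · exact hD b h1 b' h2 hne
      · rcases Finset.mem_insert.1 hb with rfl | hb
        · exact Or.inl (Finset.mem_insert_self _ _)
        · rcases hdom b hb with h | ⟨b', hb', h⟩
          · exact Or.inl (Finset.mem_insert_of_mem h)
          · exact Or.inr ⟨b', Finset.mem_insert_of_mem hb', h⟩

variable {M : Type*} [MetricSpace M] {n m : ℕ} {x : Fin n → M} {y : Fin m → M}
  {rk : Fin n → Fin m → ℕ}

/-- Every client lies in a ball of radius `ρ` around a server of `D` whose radius is at least the
distance from the client to its `e` closest servers. -/
def IsOuterCover (x : Fin n → M) (y : Fin m → M) (rk : Fin n → Fin m → ℕ) (e : ℕ)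
    (D : Finset (Fin m)) (ρ : Fin m → ℝ) : Prop :=
  ∀ c, ∃ b ∈ D, dist (x c) (y b) ≤ ρ b ∧ ∀ z, rk c z < e → dist (x c) (y z) ≤ ρ b

/-- Of the `k` or more balls containing `c`, at most `e - 1` are centred at its `e - 1` closest
servers. Any other one has radius at least the distance from `c` to each of its `e` closest servers.
-/
lemma card_large_balls {k e : ℕ} {r' : Fin m → ℝ} (hinj : ∀ c, Function.Injective (rk c))
    (hmono : ∀ c z z', rk c z ≤ rk c z' → dist (x c) (y z) ≤ dist (x c) (y z'))
    (hr : IsKCover x y k r') (he : 1 ≤ e) (c : Fin n) (G : Finset (Fin m))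
    (hG : ∀ b, dist (x c) (y b) ≤ r' b → (∀ z, rk c z < e → dist (x c) (y z) ≤ r' b) → b ∈ G) :
    k + 1 ≤ G.card + e := by
  classical
  have hK := hr.2 c
  have hset : {j : Fin m | dist (x c) (y j) ≤ r' j} =
      ((Finset.univ.filter fun j => dist (x c) (y j) ≤ r' j : Finset (Fin m)) : Set (Fin m)) := by
    ext; simp
  rw [hset, Set.ncard_coe_finset] at hK
  have hsub : (Finset.univ.filter fun j => dist (x c) (y j) ≤ r' j) ⊆
      G ∪ Finset.univ.filter fun j => rk c j < e - 1 := by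
    intro b hb
    simp only [Finset.mem_filter, Finset.mem_univ, true_and, Finset.mem_union] at hb ⊢
    by_cases hbe : rk c b < e - 1
    · exact Or.inr hbe
    · exact Or.inl (hG b hb fun z hz => (hmono c z b (by omega)).trans hb)
  have hsmall : (Finset.univ.filter fun j => rk c j < e - 1).card ≤ e - 1 := by
    rw [← Finset.card_image_of_injective _ (hinj c)]
    refine (Finset.card_le_card (t := Finset.range (e - 1)) fun v hv => ?_).trans
      (Finset.card_range _).le
    simp only [Finset.mem_image, Finset.mem_filter, Finset.mem_univ, true_and] at hv
    obtain ⟨b, hb, rfl⟩ := hv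
    exact Finset.mem_range.2 hb
  have := (Finset.card_le_card hsub).trans (Finset.card_union_le _ _)
  omega

/-- A `k`-cover contains disjoint outer covers for all levels up to `k`, up to a factor `3` in the
radii. -/
lemma exists_outerCovers {k : ℕ} {r' : Fin m → ℝ} (hinj : ∀ c, Function.Injective (rk c))
    (hmono : ∀ c z z', rk c z ≤ rk c z' → dist (x c) (y z) ≤ dist (x c) (y z'))
    (hr : IsKCover x y k r') :
    ∃ D : ℕ → Finset (Fin m), (∀ e e', e ≠ e' → Disjoint (D e) (D e')) ∧
      ∀ e, 1 ≤ e → e ≤ k → IsOuterCover x y rk e (D e) fun b => 3 * r' b := by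
  classical
  -- Levels are treated from `k` downwards. The added clause bounds, with the original radii, the
  -- number of balls containing a client that each level uses up.
  suffices H : ∀ N ≤ k, ∃ D : ℕ → Finset (Fin m), (∀ e e', e ≠ e' → Disjoint (D e) (D e')) ∧
      (∀ e c, ((D e).filter fun b => dist (x c) (y b) ≤ r' b).card ≤ 1) ∧
      (∀ e, (e + N ≤ k ∨ k < e) → D e = ∅) ∧
      ∀ e, e ≤ k → k < e + N → IsOuterCover x y rk e (D e) fun b => 3 * r' b by
    obtain ⟨D, h1, -, -, h2⟩ := H k le_rfl
    exact ⟨D, h1, fun e he hek => h2 e hek (by omega)⟩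
  intro N
  induction N with
  | zero => exact fun _ => ⟨fun _ => ∅, by simp, by simp, by simp, fun e h1 h2 => by omega⟩
  | succ N ih =>
    intro hN
    obtain ⟨D, hdisj, hone, hempty, hcov⟩ := ih (by omega)
    obtain ⟨e, he⟩ : ∃ e, e + N = k := ⟨k - N, by omega⟩
    set U := (Finset.Ioc e k).biUnion D with hU
    obtain ⟨E, hET, hE, hdom⟩ := exists_greedy_subset (Finset.univ \ U) r'
      (fun b b' => ∃ c, dist (x c) (y b) ≤ r' b ∧ dist (x c) (y b') ≤ r' b')
      fun b b' ⟨c, h1, h2⟩ => ⟨c, h2, h1⟩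
    have hDE : ∀ e', e' ≠ e → Disjoint (D e') E := by
      intro e' hne
      by_cases hU' : e' ∈ Finset.Ioc e k
      · refine Finset.disjoint_left.2 fun b hb hb' => ?_
        exact (Finset.mem_sdiff.1 (hET hb')).2 (Finset.mem_biUnion.2 ⟨e', hU', hb⟩)
      · simp only [Finset.mem_Ioc, not_and, not_le] at hU'
        rw [hempty e' (by omega)]
        simp
    have hDe : D e = ∅ := hempty e (by omega)
    refine ⟨Function.update D e E, fun e₁ e₂ hne => ?_, fun e' c => ?_, fun e' he' => ?_,
      fun e' hk hN' => ?_⟩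
    · by_cases h1 : e₁ = e <;> by_cases h2 : e₂ = e
      · exact absurd (h1.trans h2.symm) hne
      · subst h1
        rw [Function.update_self, Function.update_of_ne h2]
        exact (hDE e₂ h2).symm
      · subst h2
        rw [Function.update_self, Function.update_of_ne h1]
        exact hDE e₁ h1
      · rw [Function.update_of_ne h1, Function.update_of_ne h2]
        exact hdisj e₁ e₂ hne
    · by_cases hee : e' = e
      · subst hee
        rw [Function.update_self, Finset.card_le_one]
        intro b hb b' hb'
        simp only [Finset.mem_filter] at hb hb'
        by_contra hne
        exact hE b hb.1 b' hb'.1 hne ⟨c, hb.2, hb'.2⟩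
      · rw [Function.update_of_ne hee]
        exact hone e' c
    · rw [Function.update_of_ne (by omega)]
      exact hempty e' (by omega)
    · by_cases hee : e' = e
      · subst hee
        rw [Function.update_self]
        intro c
        set G := Finset.univ.filter fun b : Fin m => dist (x c) (y b) ≤ r' b ∧
          ∀ z, rk c z < e' → dist (x c) (y z) ≤ r' b with hG
        have h1 := card_large_balls hinj hmono hr (e := e') (by omega) c G
          fun b hb hb' => by simpa [hG] using ⟨hb, hb'⟩
        have h2 : (U.filter fun b => dist (x c) (y b) ≤ r' b).card ≤ N := by
          rw [hU, Finset.filter_biUnion]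
          refine Finset.card_biUnion_le.trans ((Finset.sum_le_sum fun e' _ => hone e' c).trans ?_)
          simp
          omega
        -- At least `k + 1 - e = N + 1` large balls contain `c`, and the `N` higher levels have used
        -- at most one each.
        obtain ⟨g, hg, hgU⟩ : ∃ g ∈ G, g ∉ U := by
          by_contra! hall
          have : G ⊆ U.filter fun b => dist (x c) (y b) ≤ r' b := fun g hg =>
            Finset.mem_filter.2 ⟨hall g hg, (Finset.mem_filter.1 hg).2.1⟩
          have := Finset.card_le_card this
          omega
        obtain ⟨-, hg1, hg2⟩ := Finset.mem_filter.1 hg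
        have hg0 := hr.1 g
        rcases hdom g (by simpa using hgU) with hgE | ⟨b, hb, ⟨c', hc1, hc2⟩, hle⟩
        · exact ⟨g, hgE, by linarith, fun z hz => by linarith [hg2 z hz]⟩
        -- The free ball `g` was rejected for a larger ball `b` with a common client `c'`; going
        -- through `g` and `c'`, the distance from `c` to `b` is at most `2 * r' g + r' b`.
        · refine ⟨b, hb, ?_, fun z hz => by linarith [hg2 z hz]⟩
          have t1 := dist_triangle (x c) (y g) (y b)
          have t2 := dist_triangle_left (y g) (y b) (x c')
          linarith
      · rw [Function.update_of_ne hee]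
        exact hcov e' hk (by omega)

/-- From an outer cover to a `1`-cover that uses a set `F` which meets the neighbourhoods of all
net points. -/
lemma exists_oneCover {e : ℕ} {α : ℝ} (hα : 1 ≤ α) {D F : Finset (Fin m)} {ρ : Fin m → ℝ}
    (hρ : ∀ b, 0 ≤ ρ b) (hD : IsOuterCover x y rk e D ρ)
    (hF : ∀ c, ∃ w c', (∃ z, rk c z < e ∧ rk w z < e) ∧ (∃ z, rk w z < e ∧ rk c' z < e) ∧
      ∃ f ∈ F, rk c' f < e) :
    ∃ ρ', IsOneCoverOn x y F ρ' ∧ costOn α F ρ' ≤ (12 : ℝ) ^ α * costOn α D ρ := by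
  classical
  have hα0 : α ≠ 0 := by linarith
  have hnear : ∀ c, ∃ b ∈ D, ∃ f ∈ F, dist (x c) (y b) ≤ 5 * ρ b ∧ dist (y b) (y f) ≤ 6 * ρ b := by
    intro c
    obtain ⟨w, c', ⟨z₁, h1, h1'⟩, ⟨z₂, h2, h2'⟩, f, hf, h3⟩ := hF c
    obtain ⟨b₁, hb₁, hd₁, hn₁⟩ := hD c
    obtain ⟨b₂, hb₂, hd₂, hn₂⟩ := hD w
    obtain ⟨b₃, hb₃, hd₃, hn₃⟩ := hD c'
    have d1 := hn₁ z₁ h1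
    have d2 := hn₂ z₁ h1'
    have d3 := hn₂ z₂ h2
    have d4 := hn₃ z₂ h2'
    have d5 := hn₃ f h3
    have t1 := dist_triangle_right (x c) (x w) (y z₁)
    have t2 := dist_triangle_right (x w) (x c') (y z₂)
    -- The largest of the three outer balls is used, with radius `ρ`. Each hop is at most `2ρ`, and
    -- the last step to `f` at most `ρ`. The extreme cases are the ball of `c'` (distance `2ρ + 2ρ +
    -- ρ` from `c`) and the ball of `c` (distance `ρ + 2ρ + 2ρ + ρ` to `f`).
    rcases le_total (ρ b₁) (ρ b₂) with h12 | h12 <;> rcases le_total (ρ b₁) (ρ b₃) with h13 | h13 <;>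
      rcases le_total (ρ b₂) (ρ b₃) with h23 | h23
    all_goals
      first
      | refine ⟨b₁, hb₁, f, hf, by linarith [hρ b₁], ?_⟩
        have t3 := dist_triangle_left (y b₁) (y f) (x c)
        have t4 := dist_triangle (x c) (x w) (y f)
        have t5 := dist_triangle (x w) (x c') (y f)
        linarith [hρ b₁]
      | have t3 := dist_triangle (x c) (x w) (y b₂)
        have t4 := dist_triangle_left (y b₂) (y f) (x w)
        have t5 := dist_triangle (x w) (x c') (y f)
        exact ⟨b₂, hb₂, f, hf, by linarith [hρ b₂], by linarith [hρ b₂]⟩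
      | have t3 := dist_triangle (x c) (x w) (y b₃)
        have t4 := dist_triangle (x w) (x c') (y b₃)
        have t5 := dist_triangle_left (y b₃) (y f) (x c')
        exact ⟨b₃, hb₃, f, hf, by linarith [hρ b₃], by linarith [hρ b₃]⟩
  choose bb hbb ff hff h5 h6 using hnear
  -- Clients sharing an outer server `b` may point to different servers of `F`. One of these is
  -- fixed for `b`, which is harmless because the bound `6 * ρ b` does not depend on the client.
  set σ : Fin m → Fin m := fun b => if h : ∃ c, bb c = b then ff h.choose else b with hσ
  have hσ' : ∀ c, σ (bb c) ∈ F ∧ dist (y (bb c)) (y (σ (bb c))) ≤ 6 * ρ (bb c) := by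
    intro c
    have hex : ∃ c', bb c' = bb c := ⟨c, rfl⟩
    have e1 : σ (bb c) = ff hex.choose := by simp only [hσ]; rw [dif_pos hex]
    have e2 := hex.choose_spec
    rw [e1]
    refine ⟨hff _, ?_⟩
    have := h6 hex.choose
    rwa [e2] at this
  have hpow : ∀ b, (0 : ℝ) ≤ (12 * ρ b) ^ α := fun b =>
    Real.rpow_nonneg (mul_nonneg (by norm_num) (hρ b)) _
  -- If several outer servers are sent to `j`, the maximal radius serves all of them and costs no
  -- more than the sum. The factor 12 exceeds the `5 + 6` that is needed.
  have hmax : ∀ j, ∃ v : ℝ, 0 ≤ v ∧ (∀ b ∈ D, σ b = j → 12 * ρ b ≤ v) ∧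
      v ^ α ≤ ∑ b ∈ D with σ b = j, (12 * ρ b) ^ α := by
    intro j
    rcases (D.filter fun b => σ b = j).eq_empty_or_nonempty with hemp | hne
    · refine ⟨0, le_rfl, fun b hb hj => ?_, ?_⟩
      · have : b ∈ D.filter fun b => σ b = j := Finset.mem_filter.2 ⟨hb, hj⟩
        simp [hemp] at this
      · rw [hemp, Real.zero_rpow hα0, Finset.sum_empty]
    · obtain ⟨b₀, hb₀, hm⟩ := Finset.exists_max_image _ (fun b => 12 * ρ b) hne
      refine ⟨12 * ρ b₀, mul_nonneg (by norm_num) (hρ b₀), fun b hb hj => ?_, ?_⟩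
      · exact hm b (Finset.mem_filter.2 ⟨hb, hj⟩)
      · exact Finset.single_le_sum (f := fun b => (12 * ρ b) ^ α) (fun b _ => hpow b) hb₀
  choose ρ' h0 hle hcost using hmax
  refine ⟨ρ', ⟨fun j _ => h0 j, fun c => ⟨σ (bb c), (hσ' c).1, ?_⟩⟩, ?_⟩
  · have h1 := hle _ (bb c) (hbb c) rfl
    have h2 := (hσ' c).2
    have h3 := h5 c
    have := dist_triangle (x c) (y (bb c)) (y (σ (bb c)))
    linarith [hρ (bb c)]
  · calc costOn α F ρ' ≤ ∑ j ∈ F, ∑ b ∈ D with σ b = j, (12 * ρ b) ^ α :=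
          Finset.sum_le_sum fun j _ => hcost j
      _ ≤ ∑ j, ∑ b ∈ D with σ b = j, (12 * ρ b) ^ α :=
          Finset.sum_le_sum_of_subset_of_nonneg (Finset.subset_univ _)
            fun j _ _ => Finset.sum_nonneg fun b _ => hpow b
      _ = ∑ b ∈ D, (12 * ρ b) ^ α := Finset.sum_fiberwise _ _ _
      _ = (12 : ℝ) ^ α * costOn α D ρ := by
          rw [costOn, Finset.mul_sum]
          exact Finset.sum_congr rfl fun b _ => Real.mul_rpow (by norm_num) (hρ b)

end Outer
end MMC

namespace MMC
namespace Alg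

/-! ## Correctness of `MetricMultiCover` -/

variable {M : Type u} [MetricSpace M] {n m k : ℕ} {x : Fin n → M} {y : Fin m → M} {α : ℝ}
  {q : Polynomial ℕ} {B : ℕ} {s : State} {C : Cmd}

/-- The set of the servers marked in a row of an array. -/
def rowSet (m : ℕ) (s : State) (a e : ℕ) : Finset (Fin m) :=
  Finset.univ.filter fun b => s.nat a e b = 1

/-- A call marks the nonzero entries, whereas `rowSet` collects the entries equal to 1; this is why
the invariants record that entries are at most 1. -/
lemma restrict_encode (a e : ℕ) (hle : ∀ v, s.nat a e v ≤ 1) :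
    ((encode x y k α Finset.univ).restrict fun b => s.nat a e b ≠ 0) =
      encode x y 1 α (rowSet m s a e) := by
  unfold Input.restrict encode
  congr 1
  funext b
  have := hle b
  by_cases hb : b < m
  · have h1 : s.nat a e b = 1 ↔ s.nat a e b ≠ 0 := by omega
    simp [hb, rowSet, h1]
  · simp [hb]

/-- The radii on the servers of row `e` of `a` are an outcome of `C`. -/
def Covered (x : Fin n → M) (y : Fin m → M) (α : ℝ) (C : Cmd) (s : State) (a e : ℕ) : Prop :=
  ∃ p ∈ exec C (encode x y 1 α (rowSet m s a e)) State.init,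
    ∀ j ∈ rowSet m s a e, s.radii m j = p.1.radii m j

/-- The sets stored in the rows `e` of the arrays `a` with `D a e` have been covered. -/
structure CoveredInv (x : Fin n → M) (y : Fin m → M) (α : ℝ) (C : Cmd) (D : ℕ → ℕ → Prop)
    (s : State) : Prop where
  covered : ∀ a e, D a e → Covered x y α C s a e
  zero : ∀ j : Fin m, (∀ a e, D a e → s.nat a e j ≠ 1) → s.radii m j = 0

lemma CoveredInv.congr {D D' : ℕ → ℕ → Prop} {s' : State} (h : CoveredInv x y α C D s)
    (hD : ∀ a e, D' a e ↔ D a e) (hn : ∀ a e, D a e → s'.nat a = s.nat a)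
    (hr : s'.real = s.real) : CoveredInv x y α C D' s' := by
  have hrad : s'.radii m = s.radii m := by unfold State.radii; rw [hr]
  refine ⟨fun a e hae => ?_, fun j hj => ?_⟩
  · have hae' := (hD a e).1 hae
    have hrow : rowSet m s' a e = rowSet m s a e := by unfold rowSet; rw [hn a e hae']
    unfold Covered
    rw [hrow, hrad]
    exact h.covered a e hae'
  · rw [hrad]
    exact h.zero j fun a e hae => by
      rw [← hn a e hae]; exact hj a e ((hD a e).2 hae)

lemma useCover_spec {a e : ℕ} (hC : IsCoverAlgorithm.{u} C q α) (ha : a ≠ z)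
    (hi : s.nat i 0 0 = e) (hle : ∀ v, s.nat a e v ≤ 1)
    (hne : (rowSet m s a e).Nonempty ∨ n = 0) :
    Spec q (n + m) (encode x y k α Finset.univ) (useCover C a) s fun s' =>
      ∃ p ∈ exec C (encode x y 1 α (rowSet m s a e)) State.init, ∀ b,
        s'.real r 0 b = if b < m ∧ s.nat a e b = 1 then p.1.real 0 0 b else s.real r 0 b := by
  have hCe := hC M n m x y (rowSet m s a e) hne
  have hev : (val i).eval (encode x y k α Finset.univ) s = e := by simp [hi]
  have hinp := restrict_encode (x := x) (y := y) (k := k) (α := α) a e hle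
  refine Spec.seq (Spec.call (Nat.le_add_left m n) ?_ ?_)
  · rw [hev, hinp]; exact hCe.1
  · rw [hev, hinp]
    intro p hp
    refine ⟨(hCe.2 p hp).1, ?_⟩
    refine Spec.loop (fun N s' => ∀ b, s'.real r 0 b =
      if b < N ∧ s.nat a e b = 1 then p.1.real 0 0 b else s.real r 0 b) (Nat.le_add_left m n)
      ?_ ?_ ?_
    · intro b
      simp +decide
    · intro N hN s' hU h
      have ha' : s'.nat a = s.nat a := by
        rw [hU.nat a (by simpa [Cmd.natWrites, when] using ha)]; rfl
      have hi' : s'.nat i 0 0 = e := by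
        rw [hU.nat i (by simp +decide [Cmd.natWrites, when])]; exact hi
      have hr' : ∀ b < m, s'.real rbar 0 b = p.1.real 0 0 b := by
        intro b hb
        rw [hU.real rbar (by simp +decide [Cmd.realWrites, when])]
        simp [encode, hb]
      have hN' : N < m := hN
      refine Spec.when (fun hh => Spec.rset ?_) (fun hh => ?_)
      · simp +decide [ha, ha', hi'] at hh ⊢
        intro b
        by_cases hb : b = N
        · simp [hb, hh, hr' N hN']
        · rw [if_neg hb, h b]
          congr 1
          grind
      · simp +decide [ha, ha', hi'] at hh ⊢
        intro b
        rw [h b]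
        congr 1
        grind
    · intro s' _ h
      exact ⟨p, hp, h⟩

/-- The new radii are written only on a set disjoint from those already covered, so the earlier
outcomes survive. -/
lemma CoveredInv.useCover {D D' : ℕ → ℕ → Prop} {a e : ℕ}
    (hC : IsCoverAlgorithm.{u} C q α) (ha : a ≠ z) (hi : s.nat i 0 0 = e)
    (hle : ∀ v, s.nat a e v ≤ 1) (hne : (rowSet m s a e).Nonempty ∨ n = 0)
    (hDz : ∀ a' e', D a' e' → a' ≠ z)
    (hdisj : ∀ a' e', D a' e' → ∀ v, s.nat a e v = 1 → s.nat a' e' v ≠ 1)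
    (hD' : ∀ a' e', D' a' e' ↔ D a' e' ∨ a' = a ∧ e' = e) (h : CoveredInv x y α C D s) :
    Spec q (n + m) (encode x y k α Finset.univ) (useCover C a) s (CoveredInv x y α C D') := by
  refine (useCover_spec hC ha hi hle hne).conseq ?_
  rintro s' hU ⟨p, hp, hr⟩
  have hn : ∀ a', a' ≠ z → s'.nat a' = s.nat a' := fun a' ha' =>
    hU.nat a' (by simpa [Alg.useCover, Cmd.natWrites, when] using ha')
  have hrad : ∀ j : Fin m, s'.radii m j =
      if s.nat a e j = 1 then p.1.radii m j else s.radii m j := fun j => by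
    have := hr j
    simp only [j.2, true_and] at this
    exact this
  have hrow : ∀ a' e', a' ≠ z → rowSet m s' a' e' = rowSet m s a' e' := fun a' e' ha' => by
    unfold rowSet; rw [hn a' ha']
  refine ⟨fun a' e' hae => ?_, fun j hj => ?_⟩
  · rcases (hD' a' e').1 hae with hae | ⟨rfl, rfl⟩
    · obtain ⟨p', hp', hr'⟩ := h.covered a' e' hae
      unfold Covered
      rw [hrow a' e' (hDz a' e' hae)]
      refine ⟨p', hp', fun j hj => ?_⟩
      rw [hrad, if_neg, hr' j hj]
      intro hj'
      exact hdisj a' e' hae j hj' (by simpa [rowSet] using hj)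
    · unfold Covered
      rw [hrow a' e' ha]
      refine ⟨p, hp, fun j hj => ?_⟩
      rw [hrad, if_pos (by simpa [rowSet] using hj)]
  · have h1 := hj a e ((hD' a e).2 (Or.inr ⟨rfl, rfl⟩))
    rw [hn a ha] at h1
    rw [hrad, if_neg h1]
    refine h.zero j fun a' e' hae => ?_
    rw [← hn a' (hDz a' e' hae)]
    exact hj a' e' ((hD' a' e').2 (Or.inl hae))

/-- The rows that hold a server set of a level above `k - N`. -/
def Slot (k L N a e : ℕ) : Prop :=
  e ≤ k ∧ k < e + N ∧ L ≤ e ∧ (a = shared ∧ L < e ∨ a = priv ∧ (L < e ∨ k < L + L))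

/-- The server sets computed by `computeServerSubsets` are pairwise disjoint. -/
lemma SubsetsInv.disj {inp : Input} {L N : ℕ} (h : SubsetsInv inp L N s) {a e a' e' v : ℕ}
    (ha : a = shared ∨ a = priv) (ha' : a' = shared ∨ a' = priv) (h1 : s.nat a e v = 1)
    (h2 : s.nat a' e' v = 1) : a = a' ∧ e = e' := by
  rcases ha with rfl | rfl <;> rcases ha' with rfl | rfl
  · exact ⟨rfl, h.extracted.shared_disj e e' v h1 h2⟩
  · exact absurd h2 (h.extracted.shared_private e e' v h1)
  · exact absurd h1 (h.extracted.shared_private e' e v h2)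
  · exact ⟨rfl, h.extracted.private_disj e e' v h1 h2⟩

lemma Slot.array {L N a e : ℕ} (h : Slot k L N a e) : a = shared ∨ a = priv := by
  rcases h with ⟨-, -, -, ⟨h, -⟩ | ⟨h, -⟩⟩
  exacts [Or.inl h, Or.inr h]

/-- Every net point has one of its `e` closest servers in each server set of level `e`. -/
lemma slot_hits {inp : Input} {L N a e : ℕ} (hs : SubsetsInv inp L N s)
    (h : Slot inp.k L N a e) {c : ℕ} (hc : c < inp.n) (hX : s.nat net e c = 1) :
    ∃ v < inp.m, s.nat a e v = 1 ∧ s.nat rank c v < e := by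
  rcases h with ⟨hk, hN, hL, ⟨rfl, hLe⟩ | ⟨rfl, h'⟩⟩
  · exact hs.extracted.shared_hits e hk hN hLe c hc hX
  · obtain ⟨v, hv, h1, h2⟩ := hs.extracted.private_hits e hk hN hL h' c hc hX
    exact ⟨v, hv, h1, by omega⟩

/-- If there is a client, then there is a net point, and its neighbourhood meets the set. This is
the precondition under which the Cover algorithm guarantees anything. -/
lemma slot_nonempty {L N a e : ℕ} (hs : SubsetsInv (encode x y k α Finset.univ) L N s)
    (hnet : NetsOK (encode x y k α Finset.univ) L (s.nat rank) (s.nat net))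
    (h : Slot k L N a e) : (rowSet m s a e).Nonempty ∨ n = 0 := by
  by_cases hn : n = 0
  · exact Or.inr hn
  · left
    obtain ⟨c, hc, hX, -⟩ := (hnet e h.2.2.1 h.1).1.covers 0 (Nat.pos_of_ne_zero hn)
    obtain ⟨v, hv, h1, -⟩ := slot_hits hs h hc hX
    exact ⟨⟨v, hv⟩, by simpa [rowSet] using h1⟩

lemma coverLoop_spec {L : ℕ} (hC : IsCoverAlgorithm.{u} C q α) (hL : 1 ≤ L)
    (hk : k ≤ m) (hl : s.nat l 0 0 = L)
    (hs : SubsetsInv (encode x y k α Finset.univ) L (k + 1 - L) s)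
    (hnet : NetsOK (encode x y k α Finset.univ) L (s.nat rank) (s.nat net))
    (hr : ∀ j, s.radii m j = 0) :
    Spec q (n + m) (encode x y k α Finset.univ) (downLoop (block [
      when aboveL (useCover C shared),
      when aboveLOrOdd (useCover C priv)])) s
      (CoveredInv x y α C (Slot k L (k + 1 - L))) := by
  refine downLoop_spec (L := L) (fun N s' => CoveredInv x y α C (Slot k L N) s') hl hL
    (hk.trans (Nat.le_add_left m n)) ?_ ?_ ?_ (fun s' _ h => h)
  · intro N s' a v hav h
    refine h.congr (fun _ _ => Iff.rfl) (fun a' e hae => ?_) rfl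
    refine s'.setNat_nat_of_ne ?_ _ _ _
    rcases hae.array with rfl | rfl <;> rcases hav with rfl | rfl <;> decide
  · exact ⟨fun a e h => by unfold Slot at h; omega, fun j _ => hr j⟩
  · intro N e hN hLe s₁ hU hi hI
    have hN : N + e = k := hN
    have hnat : ∀ a, a = shared ∨ a = priv ∨ a = l → s₁.nat a = s.nat a := by
      intro a ha
      refine hU.nat a ?_
      rcases ha with rfl | rfl | rfl <;>
        simp +decide [downLoop, useCover, Cmd.natWrites, when, put]
    have hslot : ∀ {N' a e}, Slot k L N' a e → s₁.nat a = s.nat a := fun h =>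
      hnat _ (h.array.imp id Or.inl)
    have hdisj : ∀ {a e a' e' v : ℕ}, (a = shared ∨ a = priv) → (a' = shared ∨ a' = priv) →
        s₁.nat a e v = 1 → s₁.nat a' e' v = 1 → a = a' ∧ e = e' := by
      intro a e a' e' v ha ha' h1 h2
      rw [hnat a (ha.imp id Or.inl)] at h1
      rw [hnat a' (ha'.imp id Or.inl)] at h2
      exact hs.disj ha ha' h1 h2
    have hl₁ : s₁.nat l 0 0 = L := by rw [hnat l (by simp), hl]
    have hne : ∀ {a}, Slot k L (k + 1 - L) a e → (rowSet m s₁ a e).Nonempty ∨ n = 0 := by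
      intro a ha
      have : rowSet m s₁ a e = rowSet m s a e := by unfold rowSet; rw [hslot ha]
      rw [this]
      exact slot_nonempty hs hnet ha
    have hz : ∀ {a : ℕ}, (a = shared ∨ a = priv) → a ≠ z := by
      rintro a (rfl | rfl) <;> decide
    refine Spec.seq (Spec.conseq (Q' := CoveredInv x y α C fun a' e' =>
      Slot k L N a' e' ∨ L < e ∧ a' = shared ∧ e' = e) (Spec.when (fun hh => ?_) fun hh => ?_) ?_)
    · simp +decide [aboveL, hi, hl₁] at hh
      refine hI.useCover (e := e) hC (by decide) hi (fun v => ?_) (hne ?_)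
        (fun a' e' h => hz h.array) (fun a' e' h v h1 h2 => ?_) fun a' e' => ?_
      · rw [hnat shared (by simp)]; exact hs.shared_le e v
      · exact ⟨by omega, by omega, hLe, Or.inl ⟨rfl, hh⟩⟩
      · have := (hdisj (Or.inl rfl) h.array h1 h2).2
        unfold Slot at h
        omega
      · simp [hh]
    · simp +decide [aboveL, hi, hl₁] at hh
      refine hI.congr (fun a' e' => ?_) (fun _ _ _ => rfl) rfl
      constructor
      · rintro (h | h)
        exacts [h, by omega]
      · exact Or.inl
    · intro s₂ hU₂ hI₂
      have hnat₂ : ∀ a, a ≠ z → s₂.nat a = s₁.nat a := by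
        intro a ha
        refine hU₂.nat a ?_
        simpa [useCover, Cmd.natWrites, when] using ha
      have hi₂ : s₂.nat i 0 0 = e := by rw [hnat₂ i (by decide), hi]
      have hl₂ : s₂.nat l 0 0 = L := by rw [hnat₂ l (by decide), hl₁]
      have hD : ∀ a' e', Slot k L (N + 1) a' e' ↔ (Slot k L N a' e' ∨ L < e ∧ a' = shared ∧ e' = e) ∨
          (L < e ∨ k < L + L) ∧ a' = priv ∧ e' = e := by
        intro a' e'
        by_cases hee : e' = e
        · subst hee
          unfold Slot
          constructor
          · rintro ⟨h1, h2, h3, ⟨h4, h5⟩ | ⟨h4, h5⟩⟩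
            · exact Or.inl (Or.inr ⟨h5, h4, rfl⟩)
            · exact Or.inr ⟨h5, h4, rfl⟩
          · rintro ((h | ⟨h5, h4, -⟩) | ⟨h5, h4, -⟩)
            · omega
            · exact ⟨by omega, by omega, hLe, Or.inl ⟨h4, h5⟩⟩
            · exact ⟨by omega, by omega, hLe, Or.inr ⟨h4, h5⟩⟩
        · have : k < e' + (N + 1) ↔ k < e' + N := by omega
          simp [Slot, hee, this]
      refine Spec.when (fun hh => ?_) fun hh => ?_
      · simp +decide only [BExp.Holds, aboveL, aboveLOrOdd, NExp.eval, val, zero, hi₂,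
          hl₂] at hh
        have hh : L < e ∨ k < L + L := hh
        refine hI₂.useCover (e := e) hC (by decide) ?_ (fun v => ?_) ?_
          (fun a' e' h => ?_) (fun a' e' h v h1 h2 => ?_) fun a' e' => ?_
        · exact hi₂
        · rw [hnat₂ priv (by decide), hnat priv (by simp)]; exact hs.priv_le e v
        · have : rowSet m s₂ priv e = rowSet m s₁ priv e := by
            unfold rowSet; rw [hnat₂ priv (by decide)]
          rw [this]
          exact hne ⟨by omega, by omega, hLe, Or.inr ⟨rfl, hh⟩⟩
        · rcases h with h | ⟨-, rfl, -⟩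
          exacts [hz h.array, by decide]
        · have hzz : a' ≠ z := by
            rcases h with h | ⟨-, rfl, -⟩
            exacts [hz h.array, by decide]
          rw [hnat₂ priv (by decide)] at h1
          rw [hnat₂ a' hzz] at h2
          rcases h with h | ⟨-, rfl, -⟩
          · have := (hdisj (Or.inr rfl) h.array h1 h2).2
            unfold Slot at h
            omega
          · exact absurd (hdisj (Or.inr rfl) (Or.inl rfl) h1 h2).1 (by decide)
        · rw [hD]
          simp [hh]
      · simp +decide only [BExp.Holds, aboveL, aboveLOrOdd, NExp.eval, val, zero, hi₂,
          hl₂] at hh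
        have hh : ¬ (L < e ∨ k < L + L) := hh
        refine hI₂.congr (fun a' e' => ?_) (fun _ _ _ => rfl) rfl
        rw [hD]
        simp [hh]

end Alg
end MMC

/-! ### Assembly: numbering of the `k` sets, total cost, and the main theorem. -/

namespace MMC
namespace Alg

variable {M : Type u} [MetricSpace M] {n m k : ℕ} {x : Fin n → M} {y : Fin m → M} {α : ℝ}
  {q : Polynomial ℕ} {C : Cmd}

/-- What is known about the memory after a run of `metricMultiCover`. -/
structure Outcome (x : Fin n → M) (y : Fin m → M) (k : ℕ) (α : ℝ) (C : Cmd) (L : ℕ) (s : State) :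
    Prop where
  sorted : ∀ a < n, ∃ nr, SortedRow (encode x y k α Finset.univ) a nr (s.nat rank a)
  nets : NetsOK (encode x y k α Finset.univ) L (s.nat rank) (s.nat net)
  subsets : SubsetsInv (encode x y k α Finset.univ) L (k + 1 - L) s
  covers : CoveredInv x y α C (Slot k L (k + 1 - L)) s

lemma metricMultiCover_spec (hC : IsCoverAlgorithm.{u} C q α) (hk1 : 1 ≤ k)
    (hk : k ≤ m) :
    Spec q (n + m) (encode x y k α Finset.univ) (metricMultiCover C) State.init
      (Outcome x y k α C ((k + 1) / 2)) := by
  have hn : (encode x y k α Finset.univ).n ≤ n + m := Nat.le_add_right n m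
  have hm : (encode x y k α Finset.univ).m ≤ n + m := Nat.le_add_left m n
  refine Spec.seq (Spec.conseq (Q' := fun s => ∀ j, s.real r 0 j = 0)
    (Spec.loop (fun _ s => ∀ j, s.real r 0 j = 0) hm (fun _ => rfl) ?_ fun _ _ h => h) ?_)
  · intro N _ s _ h
    refine Spec.rset ?_
    simp +decide [h]
  intro s₁ hU₁ hr₁
  refine Spec.seq ((computeServerSubsets_spec hn hm hk1 hk fun a ha => ?_).conseq ?_)
  · rw [hU₁.nat a (by simpa [Cmd.natWrites] using ha)]; rfl
  rintro s₂ hU₂ ⟨hl, hsort, hnet, hsub⟩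
  refine (coverLoop_spec (L := (k + 1) / 2) hC (by omega) hk hl hsub hnet fun j => ?_).conseq fun s₃ hU₃ hcov => ?_
  · change s₂.real r 0 j = 0
    rw [hU₂.real r (by decide)]
    exact hr₁ j
  have hnat : ∀ a, a = rank ∨ a = net ∨ a = avail ∨ a = shared ∨ a = priv →
      s₃.nat a = s₂.nat a := by
    intro a ha
    refine hU₃.nat a ?_
    rcases ha with rfl | rfl | rfl | rfl | rfl <;>
      simp +decide [downLoop, useCover, Cmd.natWrites, when, put]
  refine ⟨fun a ha => ⟨s₂.nat near a, ?_⟩, ?_, ⟨?_, ?_, ?_⟩, hcov⟩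
  · rw [hnat rank (by simp)]; exact hsort a ha
  · rw [hnat rank (by simp), hnat net (by simp)]; exact hnet
  · rw [hnat rank (by simp), hnat net (by simp), hnat avail (by simp), hnat shared (by simp),
      hnat priv (by simp)]
    exact hsub.extracted
  · rw [hnat shared (by simp)]; exact hsub.shared_le
  · rw [hnat priv (by simp)]; exact hsub.priv_le

/-- The array in which the server set number `a` is stored; its row is `k - a / 2`. -/
def slotArray (a : ℕ) : ℕ := if a % 2 = 0 then priv else shared

/-- Numbers `2 * (k - e)` and `2 * (k - e) + 1` belong to level `e`. If `k` is odd, the last number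
`k - 1` is even and is the private set of level `(k + 1) / 2`; otherwise that level gets no number.
-/
lemma slot_slotArray (hk1 : 1 ≤ k) {a : ℕ} (ha : a < k) :
    Slot k ((k + 1) / 2) (k + 1 - (k + 1) / 2) (slotArray a) (k - a / 2) := by
  unfold Slot slotArray
  refine ⟨by omega, by omega, by omega, ?_⟩
  split_ifs with h
  · exact Or.inr ⟨rfl, by omega⟩
  · exact Or.inl ⟨rfl, by omega⟩

lemma exists_slotArray {a e : ℕ} (h : Slot k ((k + 1) / 2) (k + 1 - (k + 1) / 2) a e) :
    ∃ b < k, slotArray b = a ∧ k - b / 2 = e := by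
  obtain ⟨h1, -, h2, ⟨rfl, h3⟩ | ⟨rfl, h3⟩⟩ := h
  · refine ⟨2 * (k - e) + 1, by omega, ?_, by omega⟩
    rw [slotArray, if_neg (by omega)]
  · refine ⟨2 * (k - e), by omega, ?_, by omega⟩
    rw [slotArray, if_pos (by omega)]

lemma slotArray_inj {a b : ℕ} (ha : a < k) (hb : b < k) (h : slotArray a = slotArray b)
    (h' : k - a / 2 = k - b / 2) : a = b := by
  have : a % 2 = 0 ↔ b % 2 = 0 := by
    unfold slotArray at h
    split_ifs at h with h1 h2 h2
    · simp [h1, h2]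
    · exact absurd h (by decide)
    · exact absurd h (by decide)
    · simp [h1, h2]
  omega

/-- Source of the factor 2 in the cost: each level is charged twice. -/
lemma sum_div_two (f : ℕ → ℝ) (N : ℕ) :
    ∑ a ∈ Finset.range (2 * N), f (a / 2) = 2 * ∑ b ∈ Finset.range N, f b := by
  induction N with
  | zero => simp
  | succ N ih =>
    rw [Nat.mul_succ, Finset.sum_range_succ, Finset.sum_range_succ, Finset.sum_range_succ, ih,
      show 2 * N / 2 = N by omega, show (2 * N + 1) / 2 = N by omega]
    ring

lemma costOn_congr {S : Finset (Fin m)} {ρ ρ' : Fin m → ℝ} (h : ∀ j ∈ S, ρ j = ρ' j) :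
    costOn α S ρ = costOn α S ρ' :=
  Finset.sum_congr rfl fun j hj => by rw [h j hj]

namespace Outcome

variable {L : ℕ} {s : State}

lemma rank_injective (h : Outcome x y k α C L s) (c : Fin n) :
    Function.Injective fun z : Fin m => s.nat rank c z := by
  intro z z' hzz
  obtain ⟨nr, hs⟩ := h.sorted c c.2
  have h1 := hs.near_rank z z.2
  have h2 := hs.near_rank z' z'.2
  simp only at hzz
  rw [hzz, h2] at h1
  exact Fin.ext h1.symm

lemma rank_mono (h : Outcome x y k α C L s) (c : Fin n) (z z' : Fin m)
    (hzz : s.nat rank c z ≤ s.nat rank c z') : dist (x c) (y z) ≤ dist (x c) (y z') := by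
  obtain ⟨nr, hs⟩ := h.sorted c c.2
  have := hs.mono _ _ hzz (hs.rank_lt z' z'.2)
  rw [hs.near_rank z z.2, hs.near_rank z' z'.2] at this
  have e1 : (encode x y k α Finset.univ).cs c z = dist (x c) (y z) :=
    distTable_of_lt x y c.2 z.2
  have e2 : (encode x y k α Finset.univ).cs c z' = dist (x c) (y z') :=
    distTable_of_lt x y c.2 z'.2
  rwa [e1, e2] at this

lemma isOneCoverOn (h : Outcome x y k α C L s) (hC : IsCoverAlgorithm.{u} C q α) {a e : ℕ}
    (hae : Slot k L (k + 1 - L) a e) :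
    IsOneCoverOn x y (rowSet m s a e) (s.radii m) ∧
    ∀ r', IsOneCoverOn x y (rowSet m s a e) r' →
      costOn α (rowSet m s a e) (s.radii m) ≤ (3 : ℝ) ^ α * costOn α (rowSet m s a e) r' := by
  obtain ⟨p, hp, hr⟩ := h.covers.covered a e hae
  obtain ⟨-, h1, h2⟩ := (hC M n m x y _ (slot_nonempty h.subsets h.nets hae)).2 p hp
  refine ⟨⟨fun j hj => by rw [hr j hj]; exact h1.1 j hj, fun c => ?_⟩, fun r' hr' => ?_⟩
  · obtain ⟨j, hj, hd⟩ := h1.2 c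
    exact ⟨j, hj, by rwa [hr j hj]⟩
  · rw [costOn_congr hr]
    exact h2 r' hr'

/-- The factors are 3 for the Cover algorithm, 12 for the passage from an outer cover to servers of
the set, and 3 for the outer cover itself. -/
lemma costOn_le (h : Outcome x y k α C L s) (hα : 1 ≤ α) (hC : IsCoverAlgorithm.{u} C q α)
    {a e : ℕ} (hae : Slot k L (k + 1 - L) a e) {D : Finset (Fin m)} {r' : Fin m → ℝ}
    (hr' : ∀ j, 0 ≤ r' j)
    (hD : IsOuterCover x y (fun c z => s.nat rank c z) e D fun b => 3 * r' b) :
    costOn α (rowSet m s a e) (s.radii m) ≤ (108 : ℝ) ^ α * costOn α D r' := by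
  obtain ⟨ρ, hρ, hcost⟩ := exists_oneCover (F := rowSet m s a e) hα
    (fun b => mul_nonneg (by norm_num) (hr' b)) hD fun c => by
      obtain ⟨c', hc', hX, w, hw, ⟨z₁, hz₁, h1, h1'⟩, z₂, hz₂, h2, h2'⟩ :=
        (h.nets e hae.2.2.1 hae.1).1.covers c c.2
      obtain ⟨v, hv, h3, h4⟩ := slot_hits h.subsets hae hc' hX
      exact ⟨⟨w, hw⟩, ⟨c', hc'⟩, ⟨⟨z₂, hz₂⟩, h2', h2⟩, ⟨⟨z₁, hz₁⟩, h1', h1⟩, ⟨v, hv⟩,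
        by simpa [rowSet] using h3, h4⟩
  have h3 : costOn α D (fun b => 3 * r' b) = (3 : ℝ) ^ α * costOn α D r' := by
    rw [costOn, costOn, Finset.mul_sum]
    exact Finset.sum_congr rfl fun b _ => Real.mul_rpow (by norm_num) (hr' b)
  have h108 : (108 : ℝ) ^ α = (3 : ℝ) ^ α * ((12 : ℝ) ^ α * (3 : ℝ) ^ α) := by
    rw [← Real.mul_rpow (by norm_num) (by norm_num), ← Real.mul_rpow (by norm_num) (by norm_num)]
    norm_num
  refine ((h.isOneCoverOn hC hae).2 ρ hρ).trans ?_
  rw [h108, mul_assoc, mul_assoc, ← h3]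
  exact mul_le_mul_of_nonneg_left hcost (by positivity)

theorem main (h : Outcome x y k α C ((k + 1) / 2) s) (hα : 1 ≤ α)
    (hC : IsCoverAlgorithm.{u} C q α) (hk1 : 1 ≤ k) :
    IsKCover x y k (s.radii m) ∧
    (∀ r' : Fin m → ℝ, IsKCover x y k r' →
      cost α (s.radii m) ≤ 2 * (108 : ℝ) ^ α * cost α r') ∧
    ∃ F : Fin k → Finset (Fin m),
      Pairwise (fun a b => Disjoint (F a) (F b)) ∧
      (∀ a, IsOneCoverOn x y (F a) (s.radii m)) ∧
      (∀ a, ∃ p' ∈ exec C (encode x y 1 α (F a)) State.init,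
        ∀ j ∈ F a, s.radii m j = p'.1.radii m j) ∧
      ∀ j, (∀ a, j ∉ F a) → s.radii m j = 0 := by
  classical
  set F : Fin k → Finset (Fin m) := fun a => rowSet m s (slotArray a) (k - a / 2) with hF
  have hslot : ∀ a : Fin k, Slot k ((k + 1) / 2) (k + 1 - (k + 1) / 2) (slotArray a) (k - a / 2) :=
    fun a => slot_slotArray hk1 a.2
  have hdisj : Pairwise (fun a b => Disjoint (F a) (F b)) := by
    intro a b hab
    refine Finset.disjoint_left.2 fun j ha hb => hab (Fin.ext ?_)
    simp only [hF, rowSet, Finset.mem_filter, Finset.mem_univ, true_and] at ha hb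
    obtain ⟨h1, h2⟩ := h.subsets.disj (hslot a).array (hslot b).array ha hb
    exact slotArray_inj a.2 b.2 h1 h2
  have hone : ∀ a, IsOneCoverOn x y (F a) (s.radii m) := fun a => (h.isOneCoverOn hC (hslot a)).1
  have hzero : ∀ j, (∀ a, j ∉ F a) → s.radii m j = 0 := by
    intro j hj
    refine h.covers.zero j fun a e hae h1 => ?_
    obtain ⟨b, hb, rfl, rfl⟩ := exists_slotArray hae
    exact hj ⟨b, hb⟩ (by simpa [hF, rowSet] using h1)
  refine ⟨⟨fun j => ?_, fun c => ?_⟩, fun r' hr' => ?_, F, hdisj, hone,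
    fun a => h.covers.covered _ _ (hslot a), hzero⟩
  · by_cases hj : ∃ a, j ∈ F a
    · obtain ⟨a, ha⟩ := hj
      exact (hone a).1 j ha
    · push Not at hj
      exact (hzero j hj).ge
  -- Each of the `k` disjoint sets contributes its own server whose ball contains `c`.
  · choose g hg hd using fun a => (hone a).2 c
    have hinj : Function.Injective g := by
      intro a b hab
      by_contra hne
      exact Finset.disjoint_left.1 (hdisj hne) (hg a) (hab ▸ hg b)
    calc k = (Set.range g).ncard := by
          rw [← Set.image_univ, Set.ncard_image_of_injective _ hinj, Set.ncard_univ,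
            Nat.card_eq_fintype_card, Fintype.card_fin]
      _ ≤ _ := Set.ncard_le_ncard (by rintro _ ⟨a, rfl⟩; exact hd a) (Set.toFinite _)
  · obtain ⟨D, hDdisj, hD⟩ := exists_outerCovers h.rank_injective h.rank_mono hr'
    have hpow : ∀ j, 0 ≤ r' j ^ α := fun j => Real.rpow_nonneg (hr'.1 j) _
    have hcost : cost α (s.radii m) = ∑ a, costOn α (F a) (s.radii m) := by
      unfold cost costOn
      rw [← Finset.sum_biUnion (s := Finset.univ) (t := F) fun a _ b _ hab => hdisj hab]
      symm
      refine Finset.sum_subset (Finset.subset_univ _) fun j _ hj => ?_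
      rw [hzero j fun a ha => hj (Finset.mem_biUnion.2 ⟨a, Finset.mem_univ _, ha⟩),
        Real.zero_rpow (by linarith)]
    have hlevels : ∑ b ∈ Finset.range k, costOn α (D (k - b)) r' ≤ cost α r' := by
      unfold cost costOn
      rw [← Finset.sum_biUnion]
      · exact Finset.sum_le_sum_of_subset_of_nonneg (Finset.subset_univ _) fun j _ _ => hpow j
      · intro b hb b' hb' hne
        simp only [Finset.coe_range, Set.mem_Iio] at hb hb'
        exact hDdisj _ _ (by omega)
    calc cost α (s.radii m) = ∑ a, costOn α (F a) (s.radii m) := hcost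
      _ ≤ ∑ a : Fin k, (108 : ℝ) ^ α * costOn α (D (k - a / 2)) r' :=
          Finset.sum_le_sum fun a _ => h.costOn_le hα hC (hslot a) hr'.1
            (hD _ (by omega) (by omega))
      _ = ∑ a ∈ Finset.range k, (108 : ℝ) ^ α * costOn α (D (k - a / 2)) r' :=
          Fin.sum_univ_eq_sum_range (fun a => (108 : ℝ) ^ α * costOn α (D (k - a / 2)) r') k
      -- Adding the nonnegative terms up to `2 * k` lets each level from `k` down to 1 occur exactly
      -- twice.
      _ ≤ ∑ a ∈ Finset.range (2 * k), (108 : ℝ) ^ α * costOn α (D (k - a / 2)) r' := by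
          refine Finset.sum_le_sum_of_subset_of_nonneg ?_ fun a _ _ =>
            mul_nonneg (by positivity) (Finset.sum_nonneg fun j _ => hpow j)
          intro a ha
          simp only [Finset.mem_range] at ha ⊢
          omega
      _ = 2 * (108 : ℝ) ^ α * ∑ b ∈ Finset.range k, costOn α (D (k - b)) r' := by
          rw [← Finset.mul_sum, sum_div_two fun b => costOn α (D (k - b)) r']
          ring
      _ ≤ 2 * (108 : ℝ) ^ α * cost α r' := mul_le_mul_of_nonneg_left hlevels (by positivity)

end Outcome

end Alg
end MMC

theorem mainTheorem1 :
    (∃ (C : MMC.Cmd) (q : Polynomial ℕ), ∀ α : ℝ, 1 ≤ α → MMC.IsCoverAlgorithm.{u} C q α) ∧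
    ∀ q : Polynomial ℕ, ∃ P : Polynomial ℕ,
      ∀ (C : MMC.Cmd) (α : ℝ), 1 ≤ α → MMC.IsCoverAlgorithm.{u} C q α →
      ∀ (M : Type u) [MetricSpace M] (n m : ℕ) (x : Fin n → M) (y : Fin m → M) (k : ℕ),
        1 ≤ k → k ≤ m →
        (MMC.exec (MMC.Alg.metricMultiCover C) (MMC.encode x y k α Finset.univ)
          MMC.State.init).Nonempty ∧
        ∀ p ∈ MMC.exec (MMC.Alg.metricMultiCover C) (MMC.encode x y k α Finset.univ)
            MMC.State.init,
          p.2 ≤ P.eval (n + m) ∧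
          MMC.IsKCover x y k (p.1.radii m) ∧
          (∀ r' : Fin m → ℝ, MMC.IsKCover x y k r' →
            MMC.cost α (p.1.radii m) ≤ 2 * (108 : ℝ) ^ α * MMC.cost α r') ∧
          ∃ F : Fin k → Finset (Fin m),
            Pairwise (fun a b => Disjoint (F a) (F b)) ∧
            (∀ a, MMC.IsOneCoverOn x y (F a) (p.1.radii m)) ∧
            (∀ a, ∃ p' ∈ MMC.exec C (MMC.encode x y 1 α (F a)) MMC.State.init,
              ∀ j ∈ F a, p.1.radii m j = p'.1.radii m j) ∧
            ∀ j, (∀ a, j ∉ F a) → p.1.radii m j = 0 := by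
  -- A call is charged `q` whatever program is called, so the time polynomial computed with `.skip`
  -- in place of `C` is the same for all `C`.
  refine ⟨⟨_, _, fun α hα => MMC.PrimalDual.isCoverAlgorithm hα⟩,
    fun q => ⟨(MMC.Alg.metricMultiCover .skip).time q, ?_⟩⟩
  intro C α hα hC M _ n m x y k hk1 hk
  have h := MMC.Alg.metricMultiCover_spec (x := x) (y := y) hC hk1 hk
  refine ⟨h.1, fun p hp => ?_⟩
  obtain ⟨htime, hout⟩ := h.2 p hp
  exact ⟨htime, hout.main hα hC hk1⟩
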